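/- **Setting.** Let $P\ne Q$ be probability distributions on a measurable space $\mathcal X$, with densities $P(x),Q(x)$ with respect to $P+Q$, and let $\varepsilon>0$. Put $D_y(P\|Q)=\int\max\{P(x)-e^{y}Q(x),0\}\,dx$ and $\tau=\max\{D_\varepsilon(P\|Q),D_\varepsilon(Q\|P)\}$. Let $a$ (resp. $b$) be the largest number in $[0,\varepsilon]$ with $D_a(P\|Q)=\tau$ (resp. $D_b(Q\|P)=\tau$), and let $P'=\min\{P,e^{a}Q\}/(1-\tau)$, $Q'=\min\{Q,e^{b}P\}/(1-\tau)$ and $H^2(P',Q')=\frac12\int(\sqrt{P'(x)}-\sqrt{Q'(x)})^2dx$ (read as $0$ if $\tau=1$). Let $\mathrm{SC}_\varepsilon$ be the least $N$ for which there is an $\varepsilon$-differentially private randomized test $K$ with $\Pr_{x\sim P^m}[K(x)=P]-\Pr_{x\sim Q^m}[K(x)=P]\ge 2/3$ for all $m\ge N$. In change-point detection with change point $k^*\ge1$ the data points are independent, $x_1,\dots,x_{k^*-1}\sim P$ and $x_{k^*},x_{k^*+1},\dots\sim Q$. Offline, the input is $x_1,\dots,x_N$ and $1\le k^*\le N$;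 online, it is an infinite stream, read point by point. An algorithm is $(\alpha,\beta)$-accurate if for each $k^*$ (and each $N$), with probability at least $1-\beta$ over the data and its coins, it outputs $\hat k$ with $|\hat k-k^*|\le\alpha$. It is $\varepsilon$-differentially private if changing one data point changes the probability of any output event by a factor at most $e^{\varepsilon}$, for all data. Algorithms are randomized real-RAM programs: finitely many real registers, and unit cost for each arithmetic operation, exponential, logarithm, comparison, coin flip of given bias, and reading of the next data point (through its densities under $P$ and $Q$). Finitely many real numbers that depend on $(P,Q,\varepsilon,\beta)$, and on nothing else, may be supplied to a program as parameters. **Theorem.** There are two fixed programs and an absolute constant $T$ such that for each $\beta_0\in(0,1)$ there are constants $C,C_0>0$ and $D_d$ ($d\in\mathbb N$), depending only on $\beta_0$ (and $d$), for which the following holds for all $P\neq Q$, all $\varepsilon>0$ and all $\beta\in(0,\beta_0]$, with $$\alpha=C\cdot\frac{\log(1/\beta)}{\min\{\varepsilon,1\}\,\tau+H^2(P',Q')}.$$ 1. *(Offline)* The first program, with suitable parameters, is $\varepsilon$-differentially private and $(\alpha,\beta)$-accurate for offline change-point detection from $P$ to $Q$, and takes at most $T(N+1)$ steps on each data set of size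 $N$. 2. *(Online)* The second program, with suitable parameters and an additional input $n\ge1$, is $\varepsilon$-differentially private (for the pair of $\hat k$ and the number of observed points); on each stream it halts almost surely, and at any moment before halting it has made at most $T(s+1)$ steps, where $s$ is the number of points observed so far. For all $k^*\ge1$ and $n\ge1$ with $n\ge C_0\,\mathrm{SC}_\varepsilon\log\frac{k^*}{n\beta}$: with probability at least $1-\beta$ it outputs $\hat k$ with $|\hat k-k^*|\le\alpha$; whenever $|\hat k-k^*|\le\alpha$ it has observed at most $k^*+2n$ points (almost surely over its coins, for each stream); and for every $d\in\mathbb N$ it observes at most $k^*+D_d\,n\log n$ points with probability at least $1-n^{-d}$. -/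

import Mathlib

open MeasureTheory

namespace ChangePoint

noncomputable section

/-! ### Densities, the divergence `τ`, the clamped distributions `P'`, `Q'` -/

section Divergences

variable {X : Type*} [MeasurableSpace X]

/-- The densities of `P` and of `Q` at a point, with respect to the dominating measure `P + Q`. -/
def densities (P Q : Measure X) (x : X) : ℝ × ℝ :=
  ((P.rnDeriv (P + Q) x).toReal, (Q.rnDeriv (P + Q) x).toReal)

/-- The hockey-stick divergence `∫ max (P(x) - e^y Q(x), 0) dx`. -/
def hockeyStick (P Q : Measure X) (y : ℝ) : ℝ :=
  ∫ x, max ((densities P Q x).1 - Real.exp y * (densities P Q x).2) 0 ∂(P + Q)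

/-- `τ(P, Q)`: the larger of the two hockey-stick divergences at level `ε`. -/
def tau (P Q : Measure X) (ε : ℝ) : ℝ :=
  max (hockeyStick P Q ε) (hockeyStick Q P ε)

/-- The largest `y ∈ [0, ε]` with `∫ max (P(x) - e^y Q(x), 0) dx = τ(P, Q)`.
If the divergence from `P` to `Q` is the larger one, then `clampLevel P Q ε = ε`
and `clampLevel Q P ε` is the level usually called `ε'`; otherwise the roles of `P` and `Q`
are exchanged. -/
def clampLevel (P Q : Measure X) (ε : ℝ) : ℝ :=
  sSup {y : ℝ | y ∈ Set.Icc 0 ε ∧ hockeyStick P Q y = tau P Q ε}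

/-- The density of `P' = min (P, e^a Q) / (1 - τ)`, where `a = clampLevel P Q ε`
(it is `0` if `τ = 1`). -/
def clampedP (P Q : Measure X) (ε : ℝ) (x : X) : ℝ :=
  min (densities P Q x).1 (Real.exp (clampLevel P Q ε) * (densities P Q x).2) / (1 - tau P Q ε)

/-- The density of `Q' = min (Q, e^b P) / (1 - τ)`, where `b = clampLevel Q P ε`
(it is `0` if `τ = 1`). -/
def clampedQ (P Q : Measure X) (ε : ℝ) (x : X) : ℝ :=
  min (densities P Q x).2 (Real.exp (clampLevel Q P ε) * (densities P Q x).1) / (1 - tau P Q ε)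

/-- The squared Hellinger distance `H²(P', Q') = ½ ∫ (√P'(x) - √Q'(x))² dx`. -/
def hellingerSqClamped (P Q : Measure X) (ε : ℝ) : ℝ :=
  (1 / 2) * ∫ x, (√(clampedP P Q ε x) - √(clampedQ P Q ε x)) ^ 2 ∂(P + Q)

end Divergences

/-! ### Private hypothesis tests and their sample complexity -/

section Testing

variable {X : Type*} [MeasurableSpace X]

/-- Two data sets (or streams) are neighbors if they differ in at most one entry. -/
def Neighbors {ι Y : Type*} (x x' : ι → Y) : Prop :=
  ∃ i, ∀ j, j ≠ i → x j = x' j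

/-- A randomized test: `g n x` is the probability that it answers "`P`" on the data set `x`
of size `n`. -/
structure Test (X : Type*) [MeasurableSpace X] where
  g : ∀ n : ℕ, (Fin n → X) → ℝ
  measurable_g : ∀ n, Measurable (g n)
  mem_Icc : ∀ n x, g n x ∈ Set.Icc (0 : ℝ) 1

/-- `ε`-differential privacy of a test. -/
def Test.IsPrivate (K : Test X) (ε : ℝ) : Prop :=
  ∀ n : ℕ, ∀ x x' : Fin n → X, Neighbors x x' →
    K.g n x ≤ Real.exp ε * K.g n x' ∧ 1 - K.g n x ≤ Real.exp ε * (1 - K.g n x')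

/-- The advantage of a test on samples of size `n`. -/
def Test.advantage (K : Test X) (P Q : Measure X) (n : ℕ) : ℝ :=
  (∫ x, K.g n x ∂(Measure.pi fun _ : Fin n => P)) -
    ∫ x, K.g n x ∂(Measure.pi fun _ : Fin n => Q)

/-- The sample complexity of `ε`-differentially privately distinguishing `P` from `Q`: the least
`N` such that some `ε`-private test has advantage at least `2/3` for all sample sizes `n ≥ N`. -/
def sampleComplexity (P Q : Measure X) (ε : ℝ) : ℕ :=
  sInf {N : ℕ | ∃ K : Test X, K.IsPrivate ε ∧ ∀ n, N ≤ n → 2 / 3 ≤ K.advantage P Q n}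

end Testing

/-! ### The machine model

A randomized program over finitely many real registers (indexed by `ℕ`, since a program mentions
only finitely many of them), reading the data points one after the other.  Each arithmetic
operation, coin flip, comparison, sequencing and data access costs one step. A data point is seen
through the pair of densities of `P` and `Q` at it. -/

section Machine

/-- Programs.  In `whileLe a b c` and `ifLe a b c₁ c₂` the test is `reg a ≤ reg b`. -/
inductive Prog : Type
  | const (d : ℕ) (c : ℚ)
  | add (d a b : ℕ)
  | sub (d a b : ℕ)
  | mul (d a b : ℕ)
  | div (d a b : ℕ)
  | exp (d a : ℕ)
  | log (d a : ℕ)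
  | flip (d a : ℕ)
  | read (e p q : ℕ)
  | seq (c₁ c₂ : Prog)
  | ifLe (a b : ℕ) (c₁ c₂ : Prog)
  | whileLe (a b : ℕ) (c : Prog)

/-- A configuration: the programs still to be executed, the registers, and the number of
data points observed so far. -/
structure Config where
  stack : List Prog
  reg : ℕ → ℝ
  pos : ℕ

/-- A biased coin: `true` with probability `p`, where `p` is first clamped to `[0, 1]`. -/
def coin (p : ℝ) : PMF Bool :=
  PMF.ofFintype
    (fun b => if b then ENNReal.ofReal (max 0 (min 1 p)) else ENNReal.ofReal (1 - max 0 (min 1 p)))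
    (by
      have h0 : 0 ≤ max 0 (min 1 p) := le_max_left _ _
      have h1 : max 0 (min 1 p) ≤ 1 := max_le zero_le_one (min_le_left _ _)
      rw [Fintype.sum_bool]
      simp only [if_true, Bool.false_eq_true, if_false]
      rw [← ENNReal.ofReal_add h0 (sub_nonneg.mpr h1), add_sub_cancel, ENNReal.ofReal_one])

/-- One step of computation.  `data i` is the pair of densities at the `i`-th data point (counted
from `0`), or `none` if there is no such point; `read e p q` consumes the next data point, stores
its densities in registers `p` and `q`, and sets register `e` to `1`; at the end of the data
it sets register `e` to `0`.  `flip d a` sets register `d` to `1` with probability `reg a`, and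
to `0` otherwise. -/
def step (data : ℕ → Option (ℝ × ℝ)) (c : Config) : PMF Config :=
  match c.stack with
  | [] => PMF.pure c
  | .const d r :: K => PMF.pure ⟨K, Function.update c.reg d r, c.pos⟩
  | .add d a b :: K => PMF.pure ⟨K, Function.update c.reg d (c.reg a + c.reg b), c.pos⟩
  | .sub d a b :: K => PMF.pure ⟨K, Function.update c.reg d (c.reg a - c.reg b), c.pos⟩
  | .mul d a b :: K => PMF.pure ⟨K, Function.update c.reg d (c.reg a * c.reg b), c.pos⟩
  | .div d a b :: K => PMF.pure ⟨K, Function.update c.reg d (c.reg a / c.reg b), c.pos⟩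
  | .exp d a :: K => PMF.pure ⟨K, Function.update c.reg d (Real.exp (c.reg a)), c.pos⟩
  | .log d a :: K => PMF.pure ⟨K, Function.update c.reg d (Real.log (c.reg a)), c.pos⟩
  | .flip d a :: K =>
      (coin (c.reg a)).map fun b => ⟨K, Function.update c.reg d (if b then 1 else 0), c.pos⟩
  | .read e p q :: K =>
      match data c.pos with
      | none => PMF.pure ⟨K, Function.update c.reg e 0, c.pos⟩
      | some (u, v) =>
          PMF.pure ⟨K, Function.update (Function.update (Function.update c.reg p u) q v) e 1,
            c.pos + 1⟩
  | .seq c₁ c₂ :: K => PMF.pure ⟨c₁ :: c₂ :: K, c.reg, c.pos⟩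
  | .ifLe a b c₁ c₂ :: K =>
      open Classical in
      PMF.pure ⟨(if c.reg a ≤ c.reg b then c₁ else c₂) :: K, c.reg, c.pos⟩
  | .whileLe a b c₁ :: K =>
      open Classical in
      PMF.pure ⟨if c.reg a ≤ c.reg b then c₁ :: .whileLe a b c₁ :: K else K, c.reg, c.pos⟩

/-- The distribution of the configuration after `t` steps.  The input list `θ` is stored in the
first registers; all other registers start at `0`. -/
def run (A : Prog) (θ : List ℝ) (data : ℕ → Option (ℝ × ℝ)) : ℕ → PMF Config
  | 0 => PMF.pure ⟨[A], fun i => θ.getD i 0, 0⟩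
  | t + 1 => (run A θ data t).bind (step data)

/-- The probability that the program halts with a result in `S`.  The result is the pair
`(k̂, s)` of the output `k̂`, found in register `0`, and the number `s` of observed data points. -/
def outProb (A : Prog) (θ : List ℝ) (data : ℕ → Option (ℝ × ℝ)) (S : Set (ℕ × ℕ)) : ENNReal :=
  ⨆ t, (run A θ data t).toOuterMeasure {c | c.stack = [] ∧ (⌊c.reg 0⌋₊, c.pos) ∈ S}

end Machine

/-! ### Change-point detection -/

section Problem

variable {X : Type*} [MeasurableSpace X]

/-- The distribution of the data point with index `i` (counted from `0`): the points
`x_1, …, x_{k-1}` come from `P`, the points `x_k, x_{k+1}, …` come from `Q`. -/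
def law (P Q : Measure X) (k i : ℕ) : Measure X :=
  if i + 1 < k then P else Q

instance law.instIsProbabilityMeasure (P Q : Measure X) [IsProbabilityMeasure P]
    [IsProbabilityMeasure Q] (k i : ℕ) : IsProbabilityMeasure (law P Q k i) := by
  unfold law; split_ifs <;> infer_instance

/-- A data set, as a program sees it. -/
def offlineData (P Q : Measure X) {n : ℕ} (x : Fin n → X) (i : ℕ) : Option (ℝ × ℝ) :=
  if h : i < n then some (densities P Q (x ⟨i, h⟩)) else none

/-- A data stream, as a program sees it. -/
def onlineData (P Q : Measure X) (x : ℕ → X) (i : ℕ) : Option (ℝ × ℝ) :=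
  some (densities P Q (x i))

/-- On each data set of size `n`, the program halts within `T * (n + 1)` steps. -/
def OfflineEfficient (P Q : Measure X) (A : Prog) (θ : List ℝ) (T : ℕ) : Prop :=
  ∀ (n : ℕ) (x : Fin n → X),
    ∀ c ∈ (run A θ (offlineData P Q x) (T * (n + 1))).support, c.stack = []

/-- The output `k̂` is an `ε`-differentially private function of the data set. -/
def OfflinePrivate (P Q : Measure X) (A : Prog) (θ : List ℝ) (ε : ℝ) : Prop :=
  ∀ (n : ℕ) (x x' : Fin n → X), Neighbors x x' → ∀ S : Set ℕ,
    outProb A θ (offlineData P Q x) {r | r.1 ∈ S} ≤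
      ENNReal.ofReal (Real.exp ε) * outProb A θ (offlineData P Q x') {r | r.1 ∈ S}

/-- For all sizes `n` and change points `k ∈ {1, …, n}`, the output satisfies `|k̂ - k| ≤ α` with
probability at least `1 - β` over the data and the coins. -/
def OfflineAccurate (P Q : Measure X) (A : Prog) (θ : List ℝ) (α β : ℝ) : Prop :=
  ∀ n k : ℕ, 1 ≤ k → k ≤ n →
    ENNReal.ofReal (1 - β) ≤
      ∫⁻ x, outProb A θ (offlineData P Q x) {r | |(r.1 : ℝ) - k| ≤ α}
        ∂(Measure.pi fun i : Fin n => law P Q k i)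

/-- On each stream the program halts almost surely, and at each moment before it halts it has made
at most `T * (s + 1)` steps, where `s` is the number of data points observed so far. -/
def OnlineEfficient (P Q : Measure X) (A : Prog) (θ : List ℝ) (T : ℕ) : Prop :=
  ∀ x : ℕ → X,
    outProb A θ (onlineData P Q x) Set.univ = 1 ∧
    ∀ t, ∀ c ∈ (run A θ (onlineData P Q x) t).support, c.stack ≠ [] → t ≤ T * (c.pos + 1)

/-- The output `k̂` together with the stopping time is an `ε`-differentially private function of
the stream. -/
def OnlinePrivate (P Q : Measure X) (A : Prog) (θ : List ℝ) (ε : ℝ) : Prop :=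
  ∀ x x' : ℕ → X, Neighbors x x' → ∀ S : Set (ℕ × ℕ),
    outProb A θ (onlineData P Q x) S ≤
      ENNReal.ofReal (Real.exp ε) * outProb A θ (onlineData P Q x') S

/-- The probability, over the stream with change point `k` and the coins, that the program halts
with a result in `S`. -/
def onlineProb (P Q : Measure X) [IsProbabilityMeasure P] [IsProbabilityMeasure Q]
    (A : Prog) (θ : List ℝ) (k : ℕ) (S : Set (ℕ × ℕ)) : ENNReal :=
  ∫⁻ x, outProb A θ (onlineData P Q x) S ∂(Measure.infinitePi fun i : ℕ => law P Q k i)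

end Problem

end

end ChangePoint

/-! A data point gets the score `R^(1/4) * e^l`, where `R` is the likelihood ratio P/Q clamped to
`[e^(-b), e^a]` and `l` is a normalizing shift. The weight of candidate `j + 1` is the product of
the first `j` scores, so it tends to rise while the data come from P and to fall once they come from
Q. Both programs draw a candidate with probability proportional to its weight, in one pass, by
reservoir sampling (`candMean_eq`).

Privacy: since `a, b ≤ ε`, replacing one point changes its score by a factor of at most `e^(ε/2)`.
When two weights are compared across neighboring data sets, a changed score common to both cancels
(`prod_mul_prod_le`), so the law of the candidate changes by only one such factor. The online
program raises an alarm at the end of a block with probability `1/(1+V)`, where `V` is the product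
of the block's scores. A point influences the alarm of its own block alone, so the alarm time costs
a second factor `e^(ε/2)`, and together they give `e^ε`.

Rate: the square of the score is `√R * e^(2l)`, and the moments of `√R` are explicit: `E_P[1/√R] = A
+ τ e^(-a/2)` and `E_Q[√R] = A + τ e^(-b/2)`, where `A` is the affinity of the truncated densities.
As `A = (1-τ)(1-H²)` and one of the levels `a`, `b` equals `ε`, the product of the two moments is at
most `1 - rate/4`. A suitable `l` balances them, so that `E_P[1/score]` and `E_Q[score]` are both at
most `r = 1 - rate/16` (`exists_shift`).

Accuracy: quotients of weights on one side of the change are products of independent factors of mean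
at most `r`. Comparing a far candidate with a window of about `1/(1-r)` candidates at the change
point, rather than with a single one, makes the geometric sums cancel. The far candidates together
have expected share at most `2 r^(A-m)`, with no union bound over the data size
(`lintegral_farMass_le`). The online program can fail only through a false alarm, a missed alarm in
the first full block from Q, or far candidates at one of the two possible alarm times
(`one_le_alarmSum_add`).

The condition on `n` is stated through the sample complexity, which has to be bounded below by a
multiple of `1/rate` (`le_sampleComplexity_mul_rate`). For this, P is replaced by a hybrid that
differs from it in mass `τ`. A private test notices this by at most `N τ min(ε,1)`, and the hybrid
has affinity at least `1 - H²` with Q. -/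

namespace ChangePoint
noncomputable section

/-! ### Semantics of programs -/

section Semantics

variable {data : ℕ → Option (ℝ × ℝ)}

/-- The distribution of the configuration reached from `c` after `t` steps. -/
def stepN (data : ℕ → Option (ℝ × ℝ)) : ℕ → Config → PMF Config
  | 0, c => PMF.pure c
  | t + 1, c => (step data c).bind (stepN data t)

theorem stepN_succ' (t : ℕ) (c : Config) :
    stepN data (t + 1) c = (stepN data t c).bind (step data) := by
  induction t generalizing c with
  | zero => simp [stepN]
  | succ t ih =>
    have h : stepN data (t + 1) = fun c => (stepN data t c).bind (step data) := funext ih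
    change (step data c).bind (stepN data (t + 1)) =
      ((step data c).bind (stepN data t)).bind (step data)
    rw [h, PMF.bind_bind]

theorem run_eq_stepN (A : Prog) (θ : List ℝ) (t : ℕ) :
    run A θ data t = stepN data t ⟨[A], fun i => θ.getD i 0, 0⟩ := by
  induction t with
  | zero => rfl
  | succ t ih => rw [stepN_succ', ← ih]; rfl

theorem step_nil {c : Config} (h : c.stack = []) : step data c = PMF.pure c := by
  unfold step; rw [h]

theorem stepN_nil {c : Config} (h : c.stack = []) (t : ℕ) : stepN data t c = PMF.pure c := by
  induction t with
  | zero => rfl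
  | succ t ih => rw [stepN, step_nil h, PMF.pure_bind, ih]

/-- The configurations that have halted with a result in `S`. -/
def haltSet (S : Set (ℕ × ℕ)) : Set Config := {c | c.stack = [] ∧ (⌊c.reg 0⌋₊, c.pos) ∈ S}

/-- The probability of having halted with a result in `S` after `t` steps from `c`. -/
def haltProb (data : ℕ → Option (ℝ × ℝ)) (S : Set (ℕ × ℕ)) (t : ℕ) (c : Config) : ENNReal :=
  (stepN data t c).toOuterMeasure (haltSet S)

variable {S : Set (ℕ × ℕ)}

/-- Halted configurations are fixed points of `step`, so no halting mass is ever lost. -/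
theorem haltProb_succ_le (t : ℕ) (c : Config) :
    haltProb data S t c ≤ haltProb data S (t + 1) c := by
  induction t generalizing c with
  | zero =>
    by_cases h : c.stack = []
    · simp [haltProb, stepN_nil h]
    · have : c ∉ haltSet S := fun h' => h h'.1
      simp [haltProb, stepN, this]
  | succ t ih =>
    unfold haltProb
    rw [stepN, stepN, PMF.toOuterMeasure_bind_apply, PMF.toOuterMeasure_bind_apply]
    exact ENNReal.tsum_le_tsum fun c' => mul_le_mul_right (ih c') _

theorem haltProb_mono (c : Config) : Monotone fun t => haltProb data S t c :=
  monotone_nat_of_le_succ fun t => haltProb_succ_le t c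

theorem haltProb_le_one (t : ℕ) (c : Config) : haltProb data S t c ≤ 1 := by
  unfold haltProb
  rw [PMF.toOuterMeasure_apply, ← (stepN data t c).tsum_coe]
  exact ENNReal.tsum_le_tsum fun c' => Set.indicator_le_self _ _ _

/-- The probability of ever halting with a result in `S`, starting from `c`. -/
def value (data : ℕ → Option (ℝ × ℝ)) (S : Set (ℕ × ℕ)) (c : Config) : ℝ :=
  (⨆ t, haltProb data S t c).toReal

theorem iSup_haltProb_le_one (c : Config) : ⨆ t, haltProb data S t c ≤ 1 :=
  iSup_le fun t => haltProb_le_one t c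

theorem iSup_haltProb_ne_top (c : Config) : ⨆ t, haltProb data S t c ≠ ⊤ :=
  ne_top_of_le_ne_top ENNReal.one_ne_top (iSup_haltProb_le_one c)

theorem outProb_eq_value (A : Prog) (θ : List ℝ) :
    outProb A θ data S =
      ENNReal.ofReal (value data S ⟨[A], fun i => θ.getD i 0, 0⟩) := by
  rw [value, ENNReal.ofReal_toReal (iSup_haltProb_ne_top _)]
  simp only [outProb, run_eq_stepN]
  rfl

theorem value_nonneg (c : Config) : 0 ≤ value data S c := ENNReal.toReal_nonneg

theorem value_le_one (c : Config) : value data S c ≤ 1 :=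
  ENNReal.toReal_le_of_le_ofReal zero_le_one (by simpa using iSup_haltProb_le_one c)

theorem iSup_haltProb_succ (c : Config) :
    ⨆ t, haltProb data S t c = ⨆ t, haltProb data S (t + 1) c :=
  ((haltProb_mono c).iSup_nat_add 1).symm

open Classical in
/-- The indicator function of a set, with real values. -/
def ind {α : Type*} (S : Set α) (a : α) : ℝ := if a ∈ S then 1 else 0

theorem value_nil (r : ℕ → ℝ) (p : ℕ) :
    value data S ⟨[], r, p⟩ = ind S (⌊r 0⌋₊, p) := by
  simp only [value, haltProb, stepN_nil, haltSet, PMF.toOuterMeasure_pure_apply,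
    Set.mem_ofPred_eq, true_and, ciSup_const, ind]
  by_cases h : (⌊r 0⌋₊, p) ∈ S <;> simp [h]

theorem value_of_step_eq_pure {c c' : Config} (h : step data c = PMF.pure c') :
    value data S c = value data S c' := by
  rw [value, iSup_haltProb_succ]
  simp only [haltProb, stepN, h, PMF.pure_bind]
  rfl

theorem value_flip (d a : ℕ) (K : List Prog) (r : ℕ → ℝ) (p : ℕ) (h0 : 0 ≤ r a)
    (h1 : r a ≤ 1) :
    value data S ⟨.flip d a :: K, r, p⟩ =
      r a * value data S ⟨K, Function.update r d 1, p⟩ +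
        (1 - r a) * value data S ⟨K, Function.update r d 0, p⟩ := by
  have key : ∀ t, haltProb data S (t + 1) ⟨.flip d a :: K, r, p⟩ =
      ENNReal.ofReal (r a) * haltProb data S t ⟨K, Function.update r d 1, p⟩ +
      ENNReal.ofReal (1 - r a) * haltProb data S t ⟨K, Function.update r d 0, p⟩ := by
    intro t
    unfold haltProb
    rw [stepN]
    simp only [step]
    rw [PMF.bind_map, PMF.toOuterMeasure_bind_apply, tsum_bool]
    simp [coin, h0, h1, add_comm]
  rw [value, iSup_haltProb_succ]
  simp only [key]
  -- The supremum distributes over the sum because both terms increase with `t`.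
  rw [← ENNReal.iSup_add_iSup_of_monotone, ← ENNReal.mul_iSup, ← ENNReal.mul_iSup,
    ENNReal.toReal_add, ENNReal.toReal_mul, ENNReal.toReal_mul, ENNReal.toReal_ofReal h0,
    ENNReal.toReal_ofReal (sub_nonneg.2 h1)]
  · rfl
  · exact ENNReal.mul_ne_top ENNReal.ofReal_ne_top (iSup_haltProb_ne_top _)
  · exact ENNReal.mul_ne_top ENNReal.ofReal_ne_top (iSup_haltProb_ne_top _)
  · exact fun i j h => mul_le_mul_right (haltProb_mono _ h) _
  · exact fun i j h => mul_le_mul_right (haltProb_mono _ h) _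

theorem value_read_some (e a b : ℕ) (K : List Prog) (r : ℕ → ℝ) (p : ℕ) {u : ℝ × ℝ}
    (h : data p = some u) :
    value data S ⟨.read e a b :: K, r, p⟩ = value data S ⟨K,
      Function.update (Function.update (Function.update r a u.1) b u.2) e 1, p + 1⟩ :=
  value_of_step_eq_pure (by simp [step, h])

theorem value_read_none (e a b : ℕ) (K : List Prog) (r : ℕ → ℝ) (p : ℕ) (h : data p = none) :
    value data S ⟨.read e a b :: K, r, p⟩ = value data S ⟨K, Function.update r e 0, p⟩ :=
  value_of_step_eq_pure (by simp [step, h])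

theorem value_seq (a b : Prog) (K : List Prog) (r : ℕ → ℝ) (p : ℕ) :
    value data S ⟨.seq a b :: K, r, p⟩ = value data S ⟨a :: b :: K, r, p⟩ :=
  value_of_step_eq_pure rfl

theorem value_while_true (a b : ℕ) (c : Prog) (K : List Prog) (r : ℕ → ℝ) (p : ℕ)
    (h : r a ≤ r b) :
    value data S ⟨.whileLe a b c :: K, r, p⟩ =
      value data S ⟨c :: .whileLe a b c :: K, r, p⟩ :=
  value_of_step_eq_pure (by simp [step, h])

theorem value_while_false (a b : ℕ) (c : Prog) (K : List Prog) (r : ℕ → ℝ) (p : ℕ)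
    (h : r b < r a) :
    value data S ⟨.whileLe a b c :: K, r, p⟩ = value data S ⟨K, r, p⟩ :=
  value_of_step_eq_pure (by simp [step, h.not_ge])

/-- Programs without coin flips, reading and loops. -/
def Prog.IsDet : Prog → Prop
  | .flip _ _ | .read _ _ _ | .whileLe _ _ _ => False
  | .seq c₁ c₂ | .ifLe _ _ c₁ c₂ => c₁.IsDet ∧ c₂.IsDet
  | _ => True

open Classical in
/-- The effect on the registers of a program without coin flips, reading and loops. -/
def exec : Prog → (ℕ → ℝ) → ℕ → ℝ
  | .const d c, r => Function.update r d c
  | .add d a b, r => Function.update r d (r a + r b)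
  | .sub d a b, r => Function.update r d (r a - r b)
  | .mul d a b, r => Function.update r d (r a * r b)
  | .div d a b, r => Function.update r d (r a / r b)
  | .exp d a, r => Function.update r d (Real.exp (r a))
  | .log d a, r => Function.update r d (Real.log (r a))
  | .seq c₁ c₂, r => exec c₂ (exec c₁ r)
  | .ifLe a b c₁ c₂, r => if r a ≤ r b then exec c₁ r else exec c₂ r
  | _, r => r

theorem value_exec {c : Prog} (hc : c.IsDet) (K : List Prog) (r : ℕ → ℝ) (p : ℕ) :
    value data S ⟨c :: K, r, p⟩ = value data S ⟨K, exec c r, p⟩ := by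
  induction c generalizing K r with
  | const | add | sub | mul | div | exp | log => exact value_of_step_eq_pure rfl
  | flip | read | whileLe => exact hc.elim
  | seq a b iha ihb => rw [value_seq, iha hc.1, ihb hc.2]; rfl
  | ifLe a b c₁ c₂ ih₁ ih₂ =>
    rw [value_of_step_eq_pure (c' := ⟨(if r a ≤ r b then c₁ else c₂) :: K, r, p⟩) rfl, exec]
    split_ifs
    · exact ih₁ hc.1 _ _
    · exact ih₂ hc.2 _ _

/-- Starting from `c` at time `t`, the program has, within the next `J` steps, not halted only
at moments that are at most `b s`, where `s` is the number of observed points. -/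
def OnTime (data : ℕ → Option (ℝ × ℝ)) (b : ℕ → ℕ) (J t : ℕ) (c : Config) : Prop :=
  ∀ j < J, ∀ c' ∈ (stepN data j c).support, c'.stack ≠ [] → t + j ≤ b c'.pos

variable {b : ℕ → ℕ}

theorem OnTime.zero (t : ℕ) (c : Config) : OnTime data b 0 t c :=
  fun _ h => absurd h (Nat.not_lt_zero _)

theorem OnTime.mono {J J' t t' : ℕ} {c : Config} (h : OnTime data b J t c) (hJ : J' ≤ J)
    (ht : t' ≤ t) : OnTime data b J' t' c := fun j hj c' hc' hs =>
  (Nat.add_le_add_right ht j).trans (h j (hj.trans_le hJ) c' hc' hs)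

theorem OnTime.nil (J t : ℕ) (r : ℕ → ℝ) (p : ℕ) : OnTime data b J t ⟨[], r, p⟩ := by
  intro j _ c' hc' hs
  rw [stepN_nil rfl, PMF.support_pure] at hc'
  rw [Set.mem_singleton_iff.1 hc'] at hs
  exact (hs rfl).elim

/-- Each step uses up one unit of the horizon `J`; this is what makes induction on `J` possible for
a loop without an a priori bound on its iterations. -/
theorem OnTime.of_step_succ {J t : ℕ} {c : Config} (hb : t ≤ b c.pos)
    (h : ∀ c' ∈ (step data c).support, OnTime data b J (t + 1) c') :
    OnTime data b (J + 1) t c := by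
  intro j hj c' hc' hs
  cases j with
  | zero =>
    rw [stepN, PMF.support_pure] at hc'
    rwa [Set.mem_singleton_iff.1 hc']
  | succ j =>
    rw [stepN, PMF.mem_support_bind_iff] at hc'
    obtain ⟨c'', h1, h2⟩ := hc'
    have := h c'' h1 j (by omega) c' h2 hs
    omega

theorem OnTime.of_step {J t : ℕ} {c : Config} (hb : t ≤ b c.pos)
    (h : ∀ c' ∈ (step data c).support, OnTime data b J (t + 1) c') :
    OnTime data b J t c :=
  (OnTime.of_step_succ hb h).mono (Nat.le_succ J) le_rfl

theorem OnTime.of_pure {J t : ℕ} {c c' : Config} (hs : step data c = PMF.pure c')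
    (hb : t ≤ b c.pos) (h : OnTime data b J (t + 1) c') : OnTime data b J t c :=
  OnTime.of_step hb fun c'' hc'' => by
    rw [hs, PMF.support_pure] at hc''
    rwa [Set.mem_singleton_iff.1 hc'']

/-- Programs without reading and loops. -/
def Prog.IsStraight : Prog → Prop
  | .read _ _ _ | .whileLe _ _ _ => False
  | .seq c₁ c₂ | .ifLe _ _ c₁ c₂ => c₁.IsStraight ∧ c₂.IsStraight
  | _ => True

/-- An upper bound for the number of steps of a program without reading and loops. -/
def Prog.cost : Prog → ℕ
  | .seq c₁ c₂ | .ifLe _ _ c₁ c₂ => 1 + c₁.cost + c₂.cost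
  | _ => 1

theorem OnTime.straight {c : Prog} (hc : c.IsStraight) {J t : ℕ} {K : List Prog}
    {r : ℕ → ℝ} {p : ℕ} (hb : t + c.cost ≤ b p)
    (h : ∀ r', OnTime data b J (t + c.cost) ⟨K, r', p⟩) :
    OnTime data b J t ⟨c :: K, r, p⟩ := by
  induction c generalizing K r t with
  | const | add | sub | mul | div | exp | log =>
    exact OnTime.of_pure rfl ((Nat.le_add_right _ _).trans hb) (h _)
  | read | whileLe => exact hc.elim
  | flip =>
    refine OnTime.of_step ((Nat.le_add_right _ _).trans hb) fun c' hc' => ?_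
    simp only [step, PMF.support_map] at hc'
    obtain ⟨x, -, rfl⟩ := hc'
    exact h _
  | seq a b iha ihb =>
    simp only [Prog.cost] at hb h
    refine OnTime.of_pure rfl (by dsimp only; omega) ?_
    refine iha hc.1 (by omega) fun r' => ihb hc.2 (by omega) fun r'' => ?_
    exact (h r'').mono le_rfl (by omega)
  | ifLe a b c₁ c₂ ih₁ ih₂ =>
    simp only [Prog.cost] at hb h
    refine OnTime.of_pure rfl (by dsimp only; omega) ?_
    split_ifs
    · exact ih₁ hc.1 (by omega) fun r' => (h r').mono le_rfl (by omega)
    · exact ih₂ hc.2 (by omega) fun r' => (h r').mono le_rfl (by omega)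

end Semantics

end

end ChangePoint

namespace ChangePoint
noncomputable section

/-! ### The two programs -/

section Programs

/-- The sequential composition of a list of programs. -/
def block : List Prog → Prog
  -- The empty block still needs an instruction; register 29 is a dummy that no program reads.
  | [] => .const 29 0
  | c :: cs => .seq c (block cs)

/-- Computes the score of a data point (register 15) from its densities (registers 7 and 8),
updates the total weight (register 17) of the candidates, and computes the probability
(register 19) with which the new candidate (register 16) replaces the old one. -/
def scoreProg : Prog := block
  [.div 13 7 8, .mul 14 1 8, .ifLe 14 7 (.add 13 1 9) (.add 13 13 9),
   .mul 14 2 7, .ifLe 14 8 (.add 13 3 9) (.add 13 13 9),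
   .log 13 13, .mul 13 13 11, .add 13 13 4, .exp 15 13,
   .add 16 16 10, .add 17 17 18, .div 19 18 17]

/-- Replaces the candidate (register 21) if register 20 is `1`, and updates the weight
(register 18) of the next candidate. -/
def candProg : Prog := block [.sub 14 16 21, .mul 14 14 20, .add 21 21 14, .mul 18 18 15]

/-- Computes the alarm probability (register 24), which is `0` unless a block of data points is
complete. -/
def alarmProg : Prog := block
  [.mul 22 22 15, .add 23 23 12, .add 24 10 22, .div 24 10 24,
   .ifLe 23 0 (.const 24 0) (.seq (.const 22 1) (.const 23 0))]

def offlineInit : Prog := block [.const 10 1, .const 11 (1 / 4), .const 18 1]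

/-- Register 10 already holds `1`. Setting it again lets the timing argument treat all other
registers as arbitrary after each iteration. -/
def offlineBody : Prog :=
  .seq scoreProg (.seq (.flip 20 19) (.seq candProg (.seq (.const 10 1) (.read 6 7 8))))

/-- The offline program: it samples a change point with probability proportional to the product
of the scores of the preceding data points. -/
def offlineProg : Prog :=
  .seq offlineInit (.seq (.seq (.read 6 7 8) (.whileLe 10 6 offlineBody)) (.add 0 21 9))

/-- Register 25 is the loop flag. If the threshold in register 5 exceeds `n`, the flag is set and
the program halts without reading a point, with output `0`. -/
def onlineInit : Prog := block
  [.const 10 1, .const 11 (1 / 4), .const 12 4, .const 18 1, .const 22 1,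
   .ifLe 5 0 (.const 25 0) (.const 25 1)]

def onlineBody : Prog :=
  .seq (.read 6 7 8)
    (.seq scoreProg (.seq (.flip 20 19) (.seq candProg (.seq alarmProg (.flip 25 24)))))

def onlineFinal : Prog := block [.sub 14 16 0, .ifLe 14 21 (.add 0 21 9) (.add 0 14 9)]

/-- The online program: at the end of each block of data points it raises an alarm
if the data points of the block look like samples from `Q`; it then outputs a change point that has
been sampled like in the offline program, but is not allowed to lie too far in the past. -/
def onlineProg : Prog :=
  .seq onlineInit (.seq (.whileLe 25 9 onlineBody) onlineFinal)

/-- The likelihood ratio `p / q`, clamped from above to `A` and from below to `B'`; here `B'` is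
the inverse of `B`. -/
def clampRatio (A B B' : ℝ) (u : ℝ × ℝ) : ℝ :=
  open Classical in if B * u.1 ≤ u.2 then B' else if A * u.2 ≤ u.1 then A else u.1 / u.2

/-- The score of a data point with densities `u`. -/
def score (A B B' l : ℝ) (u : ℝ × ℝ) : ℝ :=
  Real.exp (Real.log (clampRatio A B B' u) * (1 / 4) + l)

/-- The weight of the candidate `j + 1` for the change point, if the scores are `y`. -/
def weight (y : ℕ → ℝ) (j : ℕ) : ℝ := ∏ i ∈ Finset.range j, y i

/-- The total weight of the candidates `1, …, t`. -/
def totalWeight (y : ℕ → ℝ) (t : ℕ) : ℝ := ∑ j ∈ Finset.range t, weight y j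

variable {A B B' l : ℝ} {y : ℕ → ℝ} {s k : ℕ} {r : ℕ → ℝ}

/-- The registers after `s` data points with scores `y`, where `k` is the candidate. -/
structure LoopInv (A B B' l : ℝ) (y : ℕ → ℝ) (s k : ℕ) (r : ℕ → ℝ) : Prop where
  r1 : r 1 = A
  r2 : r 2 = B
  r3 : r 3 = B'
  r4 : r 4 = l
  r9 : r 9 = 0
  r10 : r 10 = 1
  r11 : r 11 = 1 / 4
  r16 : r 16 = s
  r17 : r 17 = totalWeight y s
  r18 : r 18 = weight y s
  r21 : r 21 = k

theorem exec_ite (p : Prop) [Decidable p] (a b : ℕ → ℝ) (i : ℕ) :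
    (if p then a else b) i = if p then a i else b i := by split_ifs <;> rfl

theorem exec_scoreProg (h : LoopInv A B B' l y s k r) :
    exec scoreProg r 15 = score A B B' l (r 7, r 8) ∧
    exec scoreProg r 16 = s + 1 ∧
    exec scoreProg r 17 = totalWeight y (s + 1) ∧
    exec scoreProg r 19 = weight y s / totalWeight y (s + 1) := by
  have ht : totalWeight y (s + 1) = totalWeight y s + weight y s := Finset.sum_range_succ _ _
  refine ⟨?_, ?_, ?_, ?_⟩
  · by_cases h1 : B * r 7 ≤ r 8 <;> by_cases h2 : A * r 8 ≤ r 7 <;>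
    simp [scoreProg, block, exec, h.r1, h.r2, h.r3, h.r4, h.r9,
      h.r11, score, clampRatio, h1, h2]
  · simp [scoreProg, block, exec, exec_ite, h.r16, h.r10]
  · simp [scoreProg, block, exec, exec_ite, h.r17, h.r18, ht]
  · simp [scoreProg, block, exec, exec_ite, h.r17, h.r18, ht]

theorem exec_scoreProg_of_notMem {i : ℕ} (hi : i ∉ [13, 14, 15, 16, 17, 19, 29]) :
    exec scoreProg r i = r i := by
  simp only [List.mem_cons, List.not_mem_nil, or_false, not_or] at hi
  simp [scoreProg, block, exec, exec_ite, hi]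

theorem exec_candProg_of_notMem {i : ℕ} (hi : i ∉ [14, 18, 21, 29]) :
    exec candProg r i = r i := by
  simp only [List.mem_cons, List.not_mem_nil, or_false, not_or] at hi
  simp [candProg, block, exec, hi]

theorem LoopInv.scoreCand (h : LoopInv A B B' l y s k r)
    (hy : y s = score A B B' l (r 7, r 8)) (b : Bool) :
    LoopInv A B B' l y (s + 1) (if b then s + 1 else k)
      (exec candProg (Function.update (exec scoreProg r) 20 (if b then 1 else 0))) := by
  obtain ⟨h15, h16, h17, h19⟩ := exec_scoreProg h
  constructor
  case r16 => 
    rw [exec_candProg_of_notMem (by decide), Function.update_of_ne (by decide), h16]; push_cast; rfl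
  case r17 => rw [exec_candProg_of_notMem (by decide), Function.update_of_ne (by decide), h17]
  case r18 =>
    simp only [candProg, block, exec]
    simp [h15, exec_scoreProg_of_notMem, h.r18, ← hy, weight,
      Finset.prod_range_succ]
  case r21 =>
    simp only [candProg, block, exec]
    cases b <;> simp [h16, exec_scoreProg_of_notMem, h.r21]
  all_goals
    rw [exec_candProg_of_notMem (by decide), Function.update_of_ne (by decide),
      exec_scoreProg_of_notMem (by decide)]
  exacts [h.r1, h.r2, h.r3, h.r4, h.r9, h.r10, h.r11]

theorem isDet_scoreProg : scoreProg.IsDet := by simp [scoreProg, block, Prog.IsDet]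
theorem isDet_candProg : candProg.IsDet := by simp [candProg, block, Prog.IsDet]
theorem isDet_alarmProg : alarmProg.IsDet := by simp [alarmProg, block, Prog.IsDet]
theorem isDet_offlineInit : offlineInit.IsDet := by simp [offlineInit, block, Prog.IsDet]
theorem isDet_onlineInit : onlineInit.IsDet := by simp [onlineInit, block, Prog.IsDet]
theorem isDet_onlineFinal : onlineFinal.IsDet := by simp [onlineFinal, block, Prog.IsDet]

theorem weight_pos (hy : ∀ i, 0 < y i) (j : ℕ) : 0 < weight y j :=
  Finset.prod_pos fun i _ => hy i

theorem totalWeight_pos (hy : ∀ i, 0 < y i) {t : ℕ} (ht : t ≠ 0) : 0 < totalWeight y t :=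
  Finset.sum_pos (fun j _ => weight_pos hy j) (Finset.nonempty_range_iff.2 ht)

theorem totalWeight_nonneg (hy : ∀ i, 0 < y i) (t : ℕ) : 0 ≤ totalWeight y t :=
  Finset.sum_nonneg fun j _ => (weight_pos hy j).le

theorem weight_div_totalWeight_le_one (hy : ∀ i, 0 < y i) (s : ℕ) :
    weight y s / totalWeight y (s + 1) ≤ 1 := by
  rw [div_le_one (totalWeight_pos hy s.succ_ne_zero), totalWeight, Finset.sum_range_succ]
  exact le_add_of_nonneg_left (totalWeight_nonneg hy s)

/-- The expectation of `f` at the candidate after `t` data points, if `k` is the candidate after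
`s` data points. -/
def candMean (y : ℕ → ℝ) (f : ℕ → ℝ) (s k t : ℕ) : ℝ :=
  (totalWeight y s * f k + ∑ j ∈ Finset.Ico s t, weight y j * f (j + 1)) / totalWeight y t

theorem candMean_self (hy : ∀ i, 0 < y i) (f : ℕ → ℝ) {s : ℕ} (hs : s ≠ 0) (k : ℕ) :
    candMean y f s k s = f k := by
  simp [candMean, (totalWeight_pos hy hs).ne']

theorem candMean_zero (f : ℕ → ℝ) (k t : ℕ) :
    candMean y f 0 k t = (∑ j ∈ Finset.range t, weight y j * f (j + 1)) / totalWeight y t := by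
  simp [candMean, totalWeight]

/-- Reservoir sampling: the newcomer `s + 1` wins with probability `w_s / W_(s+1)`, and otherwise
the old candidate survives, with probability `W_s / W_(s+1)`. Iterating this yields probabilities
proportional to the weights. -/
theorem candMean_eq (hy : ∀ i, 0 < y i) (f : ℕ → ℝ) {s t : ℕ} (hst : s < t) (k : ℕ) :
    candMean y f s k t =
      weight y s / totalWeight y (s + 1) * candMean y f (s + 1) (s + 1) t +
      (1 - weight y s / totalWeight y (s + 1)) * candMean y f (s + 1) k t := by
  have hW := totalWeight_pos hy (Nat.ne_zero_of_lt hst)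
  have hW' := totalWeight_pos hy s.succ_ne_zero
  have ht : totalWeight y (s + 1) = totalWeight y s + weight y s := Finset.sum_range_succ _ _
  unfold candMean
  rw [Finset.sum_eq_sum_Ico_succ_bot hst, ht]
  rw [ht] at hW'
  field_simp
  ring

variable {data : ℕ → Option (ℝ × ℝ)} {S : Set (ℕ × ℕ)}

theorem value_scoreCand (hy : ∀ i, 0 < y i) (h : LoopInv A B B' l y s k r) (K : Prog)
    (L : List Prog) (p : ℕ) :
    value data S ⟨.seq scoreProg (.seq (.flip 20 19) (.seq candProg K)) :: L, r, p⟩ =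
      weight y s / totalWeight y (s + 1) * value data S
        ⟨K :: L, exec candProg (Function.update (exec scoreProg r) 20 1), p⟩ +
      (1 - weight y s / totalWeight y (s + 1)) * value data S
        ⟨K :: L, exec candProg (Function.update (exec scoreProg r) 20 0), p⟩ := by
  obtain ⟨-, -, -, h19⟩ := exec_scoreProg h
  rw [value_seq, value_exec isDet_scoreProg, value_seq, value_flip, value_seq, value_seq,
    value_exec isDet_candProg, value_exec isDet_candProg, h19]
  · rw [h19]
    exact div_nonneg (weight_pos hy s).le (totalWeight_nonneg hy _)
  · rw [h19]
    exact weight_div_totalWeight_le_one hy s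

end Programs

/-! ### The output law of the offline program -/

section Offline

variable {A B B' l : ℝ} {y : ℕ → ℝ} {data : ℕ → Option (ℝ × ℝ)}

/-- Backward induction from the end of the data: one pass through the loop reproduces the recursion
`candMean_eq`. -/
theorem value_offlineLoop (S : Set (ℕ × ℕ)) {N : ℕ} (hy : ∀ i, 0 < y i)
    (hd : ∀ s < N, ∃ u, data s = some u ∧ y s = score A B B' l u) (hN : data N = none)
    (hN0 : N ≠ 0) {s k : ℕ} {r : ℕ → ℝ} (hs : s ≤ N) (h : LoopInv A B B' l y s k r) :
    value data S ⟨[.read 6 7 8, .whileLe 10 6 offlineBody, .add 0 21 9], r, s⟩ =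
      candMean y (fun j => ind S (j, N)) s k N := by
  induction hs using Nat.decreasingInduction generalizing k r with
  | self =>
    rw [candMean_self hy _ hN0, value_read_none _ _ _ _ _ _ hN, value_while_false, value_exec (by simp [Prog.IsDet]),
      value_nil]
    · simp [exec, h.r21, h.r9]
    · simp [h.r10]
  | of_succ s hs ih =>
    obtain ⟨u, hu, hyu⟩ := hd s hs
    rw [candMean_eq hy _ hs, value_read_some _ _ _ _ _ _ hu, value_while_true _ _ _ _ _ _
      (by simp [h.r10])]
    generalize hr' : Function.update (Function.update (Function.update r 7 u.1) 8 u.2) 6 1 = r'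
    have hinv : LoopInv A B B' l y s k r' := by
      subst hr'
      constructor <;> simp [h.r1, h.r2, h.r3, h.r4, h.r9, h.r10, h.r11,
        h.r16, h.r17, h.r18, h.r21]
    have h78 : (r' 7, r' 8) = u := by simp [← hr']
    have hstep : ∀ b : Bool, LoopInv A B B' l y (s + 1) (if b then s + 1 else k)
        (Function.update (exec candProg (Function.update (exec scoreProg r') 20
          (if b then 1 else 0))) 10 1) := by
      intro b
      have := hinv.scoreCand (hyu.trans (by rw [h78])) b
      rwa [Function.update_eq_self_iff.2 this.r10.symm]
    have h1 := ih (hstep true)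
    have h0 := ih (hstep false)
    simp only [if_true, Bool.false_eq_true, if_false] at h1 h0
    have hbody : ∀ r'', value data S ⟨.seq (.const 10 1) (.read 6 7 8) ::
        [.whileLe 10 6 offlineBody, .add 0 21 9], r'', s + 1⟩ = value data S
        ⟨[.read 6 7 8, .whileLe 10 6 offlineBody, .add 0 21 9],
          Function.update r'' 10 1, s + 1⟩ := by
      intro r''
      rw [value_seq, value_exec (by simp [Prog.IsDet])]
      simp [exec]
    refine (value_scoreCand hy hinv _ _ _).trans ?_
    rw [hbody, hbody]
    rw [h1, h0]

/-- The distribution of the output of the offline program. -/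
theorem value_offlineProg (S : Set (ℕ × ℕ)) {N : ℕ} (hy : ∀ i, 0 < y i)
    (hd : ∀ s < N, ∃ u, data s = some u ∧ y s = score A B B' l u) (hN : data N = none)
    (hN0 : N ≠ 0) :
    value data S ⟨[offlineProg], fun i => [0, A, B, B', l].getD i 0, 0⟩ =
      (∑ j ∈ Finset.range N, weight y j * ind S (j + 1, N)) / totalWeight y N := by
  rw [offlineProg, value_seq, value_exec isDet_offlineInit, value_seq]
  rw [value_seq, value_offlineLoop (k := 0) S hy hd hN hN0 (Nat.zero_le _), candMean_zero]
  constructor <;> simp [offlineInit, block, exec, totalWeight, weight]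

end Offline

/-! ### The output law of the online program -/

section Online

variable {A B B' l : ℝ} {y : ℕ → ℝ} {n : ℕ}

/-- The length of the blocks at whose ends the online program may raise an alarm. -/
def blockLen (n : ℕ) : ℕ := n / 4 + 1

/-- The probability that the online program raises an alarm after the data point with index `s`,
if it has not done so before. -/
def alarm (L : ℕ) (y : ℕ → ℝ) (s : ℕ) : ℝ :=
  if (s + 1) % L = 0 then 1 / (1 + ∏ i ∈ Finset.Ico (s + 1 - L) (s + 1), y i) else 0

theorem alarm_nonneg (hy : ∀ i, 0 < y i) (L s : ℕ) : 0 ≤ alarm L y s := by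
  unfold alarm
  split_ifs
  · have : 0 < ∏ i ∈ Finset.Ico (s + 1 - L) (s + 1), y i := Finset.prod_pos fun i _ => hy i
    positivity
  · exact le_rfl

theorem alarm_le_one (hy : ∀ i, 0 < y i) (L s : ℕ) : alarm L y s ≤ 1 := by
  unfold alarm
  split_ifs
  · have : 0 < ∏ i ∈ Finset.Ico (s + 1 - L) (s + 1), y i := Finset.prod_pos fun i _ => hy i
    rw [div_le_one (by positivity)]
    linarith
  · exact zero_le_one

/-- The registers of the online program after `s` data points with scores `y`. -/
structure OnlineInv (A B B' l : ℝ) (n : ℕ) (y : ℕ → ℝ) (s k : ℕ) (r : ℕ → ℝ) : Prop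
    extends LoopInv A B B' l y s k r where
  r0 : r 0 = n
  r12 : r 12 = 4
  r22 : r 22 = ∏ i ∈ Finset.Ico (s - s % blockLen n) s, y i
  r23 : r 23 = 4 * (s % blockLen n : ℕ)

theorem exec_alarmProg_of_notMem {r : ℕ → ℝ} {i : ℕ} (hi : i ∉ [22, 23, 24, 29]) :
    exec alarmProg r i = r i := by
  simp only [List.mem_cons, List.not_mem_nil, or_false, not_or] at hi
  simp [alarmProg, block, exec, exec_ite, hi]

theorem exec_alarmProg {s : ℕ} {r : ℕ → ℝ} (h0 : r 0 = n) (h10 : r 10 = 1) (h12 : r 12 = 4)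
    (h15 : r 15 = y s)
    (h22 : r 22 = ∏ i ∈ Finset.Ico (s - s % blockLen n) s, y i)
    (h23 : r 23 = 4 * (s % blockLen n : ℕ)) :
    exec alarmProg r 24 = alarm (blockLen n) y s ∧
    exec alarmProg r 22 = ∏ i ∈ Finset.Ico (s + 1 - (s + 1) % blockLen n) (s + 1), y i ∧
    exec alarmProg r 23 = 4 * ((s + 1) % blockLen n : ℕ) := by
  set L := blockLen n with hL
  have hL0 : 0 < L := Nat.succ_pos _
  have hlt : s % L < L := Nat.mod_lt _ hL0
  have hle : s % L ≤ s := Nat.mod_le _ _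
  have hprod : (∏ i ∈ Finset.Ico (s - s % L) s, y i) * y s =
      ∏ i ∈ Finset.Ico (s - s % L) (s + 1), y i :=
    (Finset.prod_Ico_succ_top (Nat.sub_le _ _) _).symm
  -- The machine cannot take the integer part of `n / 4`; the counter therefore advances by four and
  -- is compared with `n` itself.
  have hiff : (4 * (s % L : ℕ) + 4 : ℝ) ≤ n ↔ s % L + 1 < L := by
    rw [hL, blockLen, Nat.add_lt_add_iff_right, ← blockLen, ← hL, ← Nat.add_one_le_iff,
      Nat.le_div_iff_mul_le (by norm_num)]
    rw [← @Nat.cast_le ℝ]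
    push_cast
    rw [add_mul, one_mul, mul_comm]
  by_cases hc : s % L + 1 < L
  · have h1 : (s + 1) % L = s % L + 1 := by
      rw [Nat.add_mod, Nat.mod_eq_of_lt (a := 1) (by omega), Nat.mod_eq_of_lt hc]
    have h2 := hiff.2 hc
    have h3 : s + 1 - (s % L + 1) = s - s % L := by omega
    rw [h1, h3, ← hprod]
    refine ⟨?_, ?_, ?_⟩
    · simp [alarmProg, block, exec, h0, h12, h23, h2, alarm, h1]
    · simp [alarmProg, block, exec, h0, h12, h23, h2, h22, h15]
    · simp [alarmProg, block, exec, h0, h12, h23, h2]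
      ring
  · have h1 : (s + 1) % L = 0 := by
      have : s + 1 = L * (s / L) + L := by have := Nat.div_add_mod s L; omega
      rw [this]; simp
    have h2 := mt hiff.1 hc
    have h3 : s + 1 - L = s - s % L := by omega
    rw [h1]
    refine ⟨?_, ?_, ?_⟩
    · simp [alarmProg, block, exec, h0, h12, h23, h2, alarm, h1, h3, h22, h15, h10,
        hprod]
    · simp [alarmProg, block, exec, h0, h12, h23, h2]
    · simp [alarmProg, block, exec, h0, h12, h23, h2]

theorem OnlineInv.iterate {s k : ℕ} {r : ℕ → ℝ} (h : OnlineInv A B B' l n y s k r)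
    (hy : y s = score A B B' l (r 7, r 8)) (b : Bool) (x : ℝ) :
    exec alarmProg (exec candProg (Function.update (exec scoreProg r) 20 (if b then 1 else 0))) 24 =
      alarm (blockLen n) y s ∧
    OnlineInv A B B' l n y (s + 1) (if b then s + 1 else k) (Function.update
      (exec alarmProg (exec candProg (Function.update (exec scoreProg r) 20
        (if b then 1 else 0)))) 25 x) := by
  have h1 := h.toLoopInv.scoreCand hy b
  have h15 := (exec_scoreProg h.toLoopInv).1
  set r' := exec candProg (Function.update (exec scoreProg r) 20 (if b then 1 else 0)) with hr'
  have hr : ∀ i, i ∉ [13, 14, 15, 16, 17, 18, 19, 20, 21, 29] → r' i = r i := by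
    intro i hi
    simp only [List.mem_cons, List.not_mem_nil, or_false, not_or] at hi
    rw [hr', exec_candProg_of_notMem (by simp [hi]), Function.update_of_ne (by simp [hi]),
      exec_scoreProg_of_notMem (by simp [hi])]
  have h15' : r' 15 = y s := by
    rw [hr', exec_candProg_of_notMem (by decide), Function.update_of_ne (by decide), h15, hy]
  obtain ⟨h24, h22, h23⟩ := exec_alarmProg (y := y) (s := s) ((hr 0 (by decide)).trans h.r0) h1.r10
    ((hr 12 (by decide)).trans h.r12) h15' ((hr 22 (by decide)).trans h.r22)
    ((hr 23 (by decide)).trans h.r23)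
  refine ⟨h24, ?_⟩
  have hfr : ∀ i, i ∉ [22, 23, 24, 25, 29] → Function.update (exec alarmProg r') 25 x i = r' i := by
    intro i hi
    simp only [List.mem_cons, List.not_mem_nil, or_false, not_or] at hi
    rw [Function.update_of_ne (by simp [hi]), exec_alarmProg_of_notMem (by simp [hi])]
  refine ⟨⟨?_, ?_, ?_, ?_, ?_, ?_, ?_, ?_, ?_, ?_, ?_⟩, ?_, ?_, ?_, ?_⟩
  case refine_14 => rw [Function.update_of_ne (by decide), h22]
  case refine_15 => rw [Function.update_of_ne (by decide), h23]
  all_goals rw [hfr _ (by decide)]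
  exacts [h1.r1, h1.r2, h1.r3, h1.r4, h1.r9, h1.r10, h1.r11, h1.r16, h1.r17, h1.r18, h1.r21,
    (hr 0 (by decide)).trans h.r0, (hr 12 (by decide)).trans h.r12]

variable {data : ℕ → Option (ℝ × ℝ)}

/-- The result of the online program, if there is an alarm after `t` data points, with
candidate `k`. -/
def onlineResult (n t k : ℕ) : ℕ × ℕ := (max k (t - n), t)

theorem value_onlineFinal (S : Set (ℕ × ℕ)) {s k p : ℕ} {r : ℕ → ℝ}
    (h0 : r 0 = n) (h9 : r 9 = 0) (h16 : r 16 = s) (h21 : r 21 = k) :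
    value data S ⟨[onlineFinal], r, p⟩ = ind S (max k (s - n), p) := by
  rw [value_exec isDet_onlineFinal, value_nil]
  congr 2
  by_cases hc : (s : ℝ) - n ≤ k
  · have : max k (s - n) = k := by
      have : (s : ℝ) ≤ k + n := by linarith
      have : s ≤ k + n := by exact_mod_cast this
      omega
    rw [this]
    simp [onlineFinal, block, exec, h0, h9, h16, h21, hc]
  · have h1 : k + n < s := by
      have : (k + n : ℝ) < s := by linarith
      exact_mod_cast this
    have : max k (s - n) = s - n := by omega
    rw [this]
    have h2 : (s : ℝ) - n = (s - n : ℕ) := by rw [Nat.cast_sub (by omega)]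
    rw [h2] at hc
    simp only [onlineFinal, block, exec]
    simp [h0, h9, h16, h21, h2, hc]

/-- The probability of an alarm with a result in `S` within the next `h` data points, if
`k` is the candidate after `s` data points and there was no alarm so far. -/
def alarmSum (n : ℕ) (y : ℕ → ℝ) (S : Set (ℕ × ℕ)) (h s k : ℕ) : ℝ :=
  ∑ t ∈ Finset.Ico s (s + h), (∏ i ∈ Finset.Ico s t, (1 - alarm (blockLen n) y i)) *
    alarm (blockLen n) y t * candMean y (fun j => ind S (onlineResult n (t + 1) j)) s k (t + 1)

theorem alarmSum_succ (hy : ∀ i, 0 < y i) (S : Set (ℕ × ℕ)) (h s k : ℕ) :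
    alarmSum n y S (h + 1) s k =
      weight y s / totalWeight y (s + 1) * (alarm (blockLen n) y s *
        ind S (onlineResult n (s + 1) (s + 1)) +
        (1 - alarm (blockLen n) y s) * alarmSum n y S h (s + 1) (s + 1)) +
      (1 - weight y s / totalWeight y (s + 1)) * (alarm (blockLen n) y s *
        ind S (onlineResult n (s + 1) k) +
        (1 - alarm (blockLen n) y s) * alarmSum n y S h (s + 1) k) := by
  have key : ∀ k', alarmSum n y S h (s + 1) k' =
      ∑ t ∈ Finset.Ico (s + 1) (s + (h + 1)),
        (∏ i ∈ Finset.Ico (s + 1) t, (1 - alarm (blockLen n) y i)) *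
        alarm (blockLen n) y t *
        candMean y (fun j => ind S (onlineResult n (t + 1) j)) (s + 1) k' (t + 1) := by
    intro k'
    rw [alarmSum, show s + 1 + h = s + (h + 1) by ring]
  rw [key, key, alarmSum, Finset.sum_eq_sum_Ico_succ_bot (by omega), Finset.Ico_self,
    Finset.prod_empty, candMean_eq hy _ (Nat.lt_succ_self s), candMean_self hy _ s.succ_ne_zero,
    candMean_self hy _ s.succ_ne_zero]
  have : ∀ t ∈ Finset.Ico (s + 1) (s + (h + 1)),
      (∏ i ∈ Finset.Ico s t, (1 - alarm (blockLen n) y i)) * alarm (blockLen n) y t *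
        candMean y (fun j => ind S (onlineResult n (t + 1) j)) s k (t + 1) =
      weight y s / totalWeight y (s + 1) * (1 - alarm (blockLen n) y s) *
        ((∏ i ∈ Finset.Ico (s + 1) t, (1 - alarm (blockLen n) y i)) * alarm (blockLen n) y t *
        candMean y (fun j => ind S (onlineResult n (t + 1) j)) (s + 1) (s + 1) (t + 1)) +
      (1 - weight y s / totalWeight y (s + 1)) * (1 - alarm (blockLen n) y s) *
        ((∏ i ∈ Finset.Ico (s + 1) t, (1 - alarm (blockLen n) y i)) * alarm (blockLen n) y t *
        candMean y (fun j => ind S (onlineResult n (t + 1) j)) (s + 1) k (t + 1)) := by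
    intro t ht
    rw [Finset.mem_Ico] at ht
    rw [candMean_eq hy _ (by omega : s < t + 1),
      Finset.prod_eq_prod_Ico_succ_bot (by omega : s < t)]
    ring
  rw [Finset.sum_congr rfl this, Finset.sum_add_distrib, ← Finset.mul_sum, ← Finset.mul_sum]
  ring

/-- The loop has no fixed end, so its value is only squeezed: what is undecided after `h` more
points is at most the probability of no alarm in them. The slack tends to `0` as `h` grows. -/
theorem value_onlineLoop (S : Set (ℕ × ℕ)) (hy : ∀ i, 0 < y i)
    (hd : ∀ s, ∃ u, data s = some u ∧ y s = score A B B' l u) (h : ℕ) {s k : ℕ} {r : ℕ → ℝ}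
    (hr : OnlineInv A B B' l n y s k r) (h25 : r 25 = 0) :
    alarmSum n y S h s k ≤ value data S ⟨[.whileLe 25 9 onlineBody, onlineFinal], r, s⟩ ∧
    value data S ⟨[.whileLe 25 9 onlineBody, onlineFinal], r, s⟩ ≤
      alarmSum n y S h s k +
        ∏ i ∈ Finset.Ico s (s + h), (1 - alarm (blockLen n) y i) := by
  induction h generalizing s k r with
  | zero => simp [alarmSum, value_nonneg, value_le_one]
  | succ h ih =>
    obtain ⟨u, hu, hyu⟩ := hd s
    rw [value_while_true _ _ _ _ _ _ (by rw [h25, hr.r9]), onlineBody, value_seq,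
      value_read_some _ _ _ _ _ _ hu, ← onlineBody]
    generalize hr' : Function.update (Function.update (Function.update r 7 u.1) 8 u.2) 6 1 = r'
    have hinv : OnlineInv A B B' l n y s k r' := by
      subst hr'
      refine ⟨⟨?_, ?_, ?_, ?_, ?_, ?_, ?_, ?_, ?_, ?_, ?_⟩, ?_, ?_, ?_, ?_⟩ <;>
      simp [hr.r1, hr.r2, hr.r3, hr.r4, hr.r9, hr.r10, hr.r11,
        hr.r16, hr.r17, hr.r18, hr.r21, hr.r0, hr.r12, hr.r22, hr.r23]
    have h78 : (r' 7, r' 8) = u := by simp [← hr']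
    have hit := hinv.iterate (hyu.trans (by rw [h78]))
    set a := alarm (blockLen n) y s with ha
    have ha0 : 0 ≤ a := alarm_nonneg hy _ _
    have ha1 : a ≤ 1 := alarm_le_one hy _ _
    set ρ := weight y s / totalWeight y (s + 1) with hρ
    have hρ0 : 0 ≤ ρ := div_nonneg (weight_pos hy s).le (totalWeight_nonneg hy _)
    have hρ1 : ρ ≤ 1 := weight_div_totalWeight_le_one hy s
    set R := ∏ i ∈ Finset.Ico (s + 1) (s + 1 + h), (1 - alarm (blockLen n) y i) with hR
    have hR' : ∏ i ∈ Finset.Ico s (s + (h + 1)), (1 - alarm (blockLen n) y i) = (1 - a) * R := by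
      rw [Finset.prod_eq_prod_Ico_succ_bot (by omega), hR, show s + 1 + h = s + (h + 1) by ring]
    have hb : ∀ b : Bool,
        a * ind S (onlineResult n (s + 1) (if b then s + 1 else k)) +
          (1 - a) * alarmSum n y S h (s + 1) (if b then s + 1 else k) ≤
        value data S ⟨[.seq alarmProg (.flip 25 24), .whileLe 25 9 onlineBody, onlineFinal],
          exec candProg (Function.update (exec scoreProg r') 20 (if b then 1 else 0)), s + 1⟩ ∧
        value data S ⟨[.seq alarmProg (.flip 25 24), .whileLe 25 9 onlineBody, onlineFinal],
          exec candProg (Function.update (exec scoreProg r') 20 (if b then 1 else 0)), s + 1⟩ ≤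
        a * ind S (onlineResult n (s + 1) (if b then s + 1 else k)) +
          (1 - a) * (alarmSum n y S h (s + 1) (if b then s + 1 else k) + R) := by
      intro b
      rw [value_seq, value_exec isDet_alarmProg]
      have h24 := (hit b 0).1
      have h1 := (hit b 1).2
      have h0 := ih (hit b 0).2 (Function.update_self _ _ _)
      rw [value_flip _ _ _ _ _ (by rw [h24]; exact ha0) (by rw [h24]; exact ha1), h24,
        value_while_false _ _ _ _ _ _ (by rw [h1.r9, Function.update_self]; exact one_pos),
        value_onlineFinal S h1.r0 h1.r9 h1.r16 h1.r21]
      have h1a := sub_nonneg.2 ha1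
      exact ⟨add_le_add le_rfl (mul_le_mul_of_nonneg_left h0.1 h1a),
        add_le_add le_rfl (mul_le_mul_of_nonneg_left h0.2 h1a)⟩
    rw [alarmSum_succ hy, hR', value_scoreCand hy hinv.toLoopInv]
    have hbt := hb true
    have hbf := hb false
    simp only [if_true, Bool.false_eq_true, if_false] at hbt hbf
    have h1ρ := sub_nonneg.2 hρ1
    constructor
    · exact add_le_add (mul_le_mul_of_nonneg_left hbt.1 hρ0)
        (mul_le_mul_of_nonneg_left hbf.1 h1ρ)
    · refine (add_le_add (mul_le_mul_of_nonneg_left hbt.2 hρ0)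
        (mul_le_mul_of_nonneg_left hbf.2 h1ρ)).trans (le_of_eq ?_)
      ring

theorem value_onlineProg (S : Set (ℕ × ℕ)) (hy : ∀ i, 0 < y i)
    (hd : ∀ s, ∃ u, data s = some u ∧ y s = score A B B' l u) {T : ℝ} (hT : T ≤ n) (h : ℕ) :
    alarmSum n y S h 0 0 ≤
      value data S ⟨[onlineProg], fun i => [(n : ℝ), A, B, B', l, T].getD i 0, 0⟩ ∧
    value data S ⟨[onlineProg], fun i => [(n : ℝ), A, B, B', l, T].getD i 0, 0⟩ ≤
      alarmSum n y S h 0 0 + ∏ i ∈ Finset.range h, (1 - alarm (blockLen n) y i) := by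
  rw [onlineProg, value_seq, value_exec isDet_onlineInit, value_seq]
  have := value_onlineLoop (n := n) (k := 0) (s := 0)
    (r := exec onlineInit fun i => [(n : ℝ), A, B, B', l, T].getD i 0) S hy hd h ?_ ?_
  · rwa [zero_add, ← Finset.range_eq_Ico] at this
  · refine ⟨⟨?_, ?_, ?_, ?_, ?_, ?_, ?_, ?_, ?_, ?_, ?_⟩, ?_, ?_, ?_, ?_⟩ <;>
    simp [onlineInit, block, exec, exec_ite, totalWeight, weight]
  · simp [onlineInit, block, exec, hT]

theorem value_onlineProg_of_lt (S : Set (ℕ × ℕ)) {T : ℝ} (hT : n < T) :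
    value data S ⟨[onlineProg], fun i => [(n : ℝ), A, B, B', l, T].getD i 0, 0⟩ =
      ind S (0, 0) := by
  rw [onlineProg, value_seq, value_exec isDet_onlineInit, value_seq, value_while_false,
    value_onlineFinal (n := n) (s := 0) (k := 0)]
  · simp
  all_goals simp [onlineInit, block, exec, hT.not_ge]

end Online

end

end ChangePoint

namespace ChangePoint
noncomputable section

/-! ### Running times -/

section Timing

variable {data : ℕ → Option (ℝ × ℝ)}

theorem isStraight_scoreProg : scoreProg.IsStraight := by simp [scoreProg, block, Prog.IsStraight]
theorem isStraight_candProg : candProg.IsStraight := by simp [candProg, block, Prog.IsStraight]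
theorem isStraight_alarmProg : alarmProg.IsStraight := by
  simp [alarmProg, block, Prog.IsStraight]
theorem isStraight_onlineInit : onlineInit.IsStraight := by
  simp [onlineInit, block, Prog.IsStraight]
theorem isStraight_onlineFinal : onlineFinal.IsStraight := by
  simp [onlineFinal, block, Prog.IsStraight]

theorem cost_scoreProg : scoreProg.cost = 29 := rfl
theorem cost_candProg : candProg.cost = 9 := rfl
theorem cost_alarmProg : alarmProg.cost = 15 := rfl
theorem cost_onlineInit : onlineInit.cost = 15 := rfl
theorem cost_onlineFinal : onlineFinal.cost = 7 := rfl

theorem OnTime.seq {b : ℕ → ℕ} {J t s : ℕ} {c₁ c₂ : Prog} {K : List Prog} {r : ℕ → ℝ}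
    (hb : t ≤ b s) (h : OnTime data b J (t + 1) ⟨c₁ :: c₂ :: K, r, s⟩) :
    OnTime data b J t ⟨.seq c₁ c₂ :: K, r, s⟩ :=
  OnTime.of_pure rfl hb h

theorem OnTime.straight_of_cost {b : ℕ → ℕ} {J t s m : ℕ} {c : Prog} {K : List Prog}
    {r : ℕ → ℝ} (hc : c.IsStraight) (hm : c.cost = m) (hb : t + m ≤ b s)
    (h : ∀ r', OnTime data b J (t + m) ⟨K, r', s⟩) : OnTime data b J t ⟨c :: K, r, s⟩ :=
  OnTime.straight hc (hm ▸ hb) (hm ▸ h)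

theorem isStraight_flip (d a : ℕ) : (Prog.flip d a).IsStraight := trivial

theorem cost_flip (d a : ℕ) : (Prog.flip d a).cost = 1 := rfl

theorem onTime_scoreCand {b : ℕ → ℕ} {J t s : ℕ} {K : Prog} {L : List Prog} {r : ℕ → ℝ}
    (hb : t + 42 ≤ b s) (h : ∀ r', OnTime data b J (t + 42) ⟨K :: L, r', s⟩) :
    OnTime data b J t ⟨.seq scoreProg (.seq (.flip 20 19) (.seq candProg K)) :: L, r, s⟩ := by
  refine OnTime.seq (by omega) ?_
  refine OnTime.straight_of_cost isStraight_scoreProg cost_scoreProg (by omega) fun r₁ => ?_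
  refine OnTime.seq (by omega) ?_
  refine OnTime.straight_of_cost (isStraight_flip _ _) (cost_flip _ _) (by omega) fun r₂ => ?_
  refine OnTime.seq (by omega) ?_
  refine OnTime.straight_of_cost isStraight_candProg cost_candProg (by omega) fun r₃ => ?_
  exact (h r₃).mono le_rfl (by omega)

/-- An iteration takes 46 steps: the read, the loop test, 42 for scoring and resampling, and two for
the trailing constant. Of the registers, only the loop bound 10 matters. -/
theorem onTime_offlineLoop {B N : ℕ} (hd : ∀ s < N, ∃ u, data s = some u) (hN : data N = none)
    (J : ℕ) {s t : ℕ} {r : ℕ → ℝ} (hs : s ≤ N) (ht : t + 50 * (N - s) + 10 ≤ B)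
    (hr : r 10 = 1) :
    OnTime data (fun _ => B) J t
      ⟨[.read 6 7 8, .whileLe 10 6 offlineBody, .add 0 21 9], r, s⟩ := by
  induction hs using Nat.decreasingInduction generalizing t r with
  | self =>
    refine OnTime.of_pure (c' := ⟨[.whileLe 10 6 offlineBody, .add 0 21 9],
      Function.update r 6 0, N⟩) (by simp [step, hN]) (by omega) ?_
    refine OnTime.of_pure (c' := ⟨[.add 0 21 9], Function.update r 6 0, N⟩)
      (by simp [step, hr, zero_lt_one.not_ge]) (by omega) ?_
    exact OnTime.of_pure rfl (by omega) (OnTime.nil _ _ _ _)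
  | of_succ s hs ih =>
    obtain ⟨u, hu⟩ := hd s hs
    refine OnTime.of_pure (c' := ⟨[.whileLe 10 6 offlineBody, .add 0 21 9],
      Function.update (Function.update (Function.update r 7 u.1) 8 u.2) 6 1, s + 1⟩)
      (by simp [step, hu]) (by omega) ?_
    refine OnTime.of_pure (c' := ⟨[offlineBody, .whileLe 10 6 offlineBody, .add 0 21 9],
      Function.update (Function.update (Function.update r 7 u.1) 8 u.2) 6 1, s + 1⟩)
      (by simp [step, hr]) (by omega) ?_
    refine onTime_scoreCand (by omega) fun r' => ?_
    refine OnTime.of_pure rfl (by omega) ?_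
    refine OnTime.of_pure rfl (by omega) ?_
    exact (ih (t := t + 46) (by omega) (by simp)).mono le_rfl (by omega)

theorem onTime_offlineProg {N : ℕ} (hd : ∀ s < N, ∃ u, data s = some u) (hN : data N = none)
    (J : ℕ) (r : ℕ → ℝ) :
    OnTime data (fun _ => 50 * N + 30) J 0 ⟨[offlineProg], r, 0⟩ := by
  refine OnTime.of_pure rfl (by omega) ?_
  refine OnTime.of_pure (c' := ⟨[.const 10 1, block [.const 11 (1 / 4), .const 18 1],
    .seq (.seq (.read 6 7 8) (.whileLe 10 6 offlineBody)) (.add 0 21 9)], r, 0⟩) rfl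
    (by omega) ?_
  refine OnTime.of_pure rfl (by omega) ?_
  refine OnTime.of_pure rfl (by omega) ?_
  refine OnTime.of_pure rfl (by omega) ?_
  refine OnTime.of_pure rfl (by omega) ?_
  refine OnTime.of_pure rfl (by omega) ?_
  refine OnTime.of_pure rfl (by omega) ?_
  refine OnTime.of_pure rfl (by omega) ?_
  refine OnTime.of_pure rfl (by omega) ?_
  exact onTime_offlineLoop hd hN J (Nat.zero_le _) (by omega) (by simp)

/-- An iteration takes 62 steps and reads one point, which raises the budget by 100. The initial 20
covers the start-up; the number of iterations is unbounded, whence the induction on `J`. -/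
theorem onTime_onlineLoop (hd : ∀ s, ∃ u, data s = some u) (J : ℕ) {s t : ℕ} {r : ℕ → ℝ}
    (ht : t ≤ 20 + 100 * s) :
    OnTime data (fun s => 100 * (s + 1)) J t
      ⟨[.whileLe 25 9 onlineBody, onlineFinal], r, s⟩ := by
  induction J generalizing s t r with
  | zero => exact OnTime.zero _ _
  | succ J ih =>
    obtain ⟨u, hu⟩ := hd s
    refine OnTime.of_step_succ (by dsimp only; omega) fun c' hc' => ?_
    simp only [step, PMF.support_pure, Set.mem_singleton_iff] at hc'
    subst hc'
    split_ifs
    · refine OnTime.of_pure rfl (by dsimp only; omega) ?_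
      refine OnTime.of_pure (c' := ⟨_, Function.update (Function.update (Function.update r 7 u.1)
        8 u.2) 6 1, s + 1⟩) (by simp only [step, hu]; rfl) (by dsimp only; omega) ?_
      refine onTime_scoreCand (by omega) fun r' => ?_
      refine OnTime.seq (by omega) ?_
      refine OnTime.straight_of_cost isStraight_alarmProg cost_alarmProg (by omega) fun r' => ?_
      refine OnTime.straight_of_cost (isStraight_flip _ _) (cost_flip _ _) (by omega)
        fun r' => ?_
      exact ih (by omega)
    · refine OnTime.straight_of_cost isStraight_onlineFinal cost_onlineFinal (by omega) fun r' => ?_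
      exact OnTime.nil _ _ _ _

theorem onTime_onlineProg (hd : ∀ s, ∃ u, data s = some u) (J : ℕ) (r : ℕ → ℝ) :
    OnTime data (fun s => 100 * (s + 1)) J 0 ⟨[onlineProg], r, 0⟩ := by
  refine OnTime.seq (by omega) ?_
  refine OnTime.straight_of_cost isStraight_onlineInit cost_onlineInit (by omega) fun r' => ?_
  refine OnTime.seq (by omega) ?_
  exact onTime_onlineLoop hd J (by omega)

end Timing

section Efficiency

variable {X : Type*} [MeasurableSpace X]

theorem offlineEfficient_offlineProg (P Q : Measure X) (θ : List ℝ) :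
    OfflineEfficient P Q offlineProg θ 100 := by
  intro n x c hc
  by_contra hs
  rw [run_eq_stepN] at hc
  have := onTime_offlineProg (data := offlineData P Q x) (N := n)
    (fun s hs => ⟨densities P Q (x ⟨s, hs⟩), by simp [offlineData, hs]⟩) (by simp [offlineData])
    (100 * (n + 1) + 1) (fun i => θ.getD i 0) (100 * (n + 1)) (Nat.lt_succ_self _) c hc hs
  dsimp only at this
  omega

theorem online_steps_le (P Q : Measure X) (θ : List ℝ) (x : ℕ → X) (t : ℕ) :
    ∀ c ∈ (run onlineProg θ (onlineData P Q x) t).support, c.stack ≠ [] →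
      t ≤ 100 * (c.pos + 1) := by
  intro c hc hs
  rw [run_eq_stepN] at hc
  have := onTime_onlineProg (data := onlineData P Q x)
    (fun s => ⟨densities P Q (x s), rfl⟩)
    (t + 1) (fun i => θ.getD i 0) t (Nat.lt_succ_self _) c hc hs
  dsimp only at this
  omega

end Efficiency

end

end ChangePoint

namespace ChangePoint
noncomputable section

/-! ### Privacy -/

section Privacy

variable {y y' : ℕ → ℝ} {c : ℝ}

/-- Two sequences of scores that differ in at most one entry, by a factor of at most `c`. -/
def ScoresClose (c : ℝ) (y y' : ℕ → ℝ) : Prop :=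
  ∃ i, (∀ j, j ≠ i → y j = y' j) ∧ y i ≤ c * y' i ∧ y' i ≤ c * y i

theorem prod_mul_eq {ι : Type*} [DecidableEq ι] {y y' : ι → ℝ} {i : ι}
    (h : ∀ j, j ≠ i → y j = y' j) (s : Finset ι) (hi : i ∈ s) :
    (∏ j ∈ s, y j) * y' i = (∏ j ∈ s, y' j) * y i := by
  rw [← Finset.mul_prod_erase s y hi, ← Finset.mul_prod_erase s y' hi,
    Finset.prod_congr rfl fun j hj => h j (Finset.ne_of_mem_erase hj)]
  ring

theorem prod_eq_of_notMem {ι : Type*} {y y' : ι → ℝ} {i : ι} (h : ∀ j, j ≠ i → y j = y' j)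
    (s : Finset ι) (hi : i ∉ s) : ∏ j ∈ s, y j = ∏ j ∈ s, y' j :=
  Finset.prod_congr rfl fun j hj => h j fun e => hi (e ▸ hj)

theorem prod_le_mul_prod {ι : Type*} [DecidableEq ι] {y y' : ι → ℝ} (hy' : ∀ i, 0 < y' i)
    (hc : 1 ≤ c) {i : ι} (h : ∀ j, j ≠ i → y j = y' j) (h1 : y i ≤ c * y' i) (s : Finset ι) :
    ∏ j ∈ s, y j ≤ c * ∏ j ∈ s, y' j := by
  have hp : 0 < ∏ j ∈ s, y' j := Finset.prod_pos fun i _ => hy' i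
  by_cases hi : i ∈ s
  · have := prod_mul_eq h s hi
    refine le_of_mul_le_mul_right ?_ (hy' i)
    rw [this, mul_comm c, mul_assoc]
    exact mul_le_mul_of_nonneg_left h1 hp.le
  · rw [prod_eq_of_notMem h s hi]
    exact le_mul_of_one_le_left hp.le hc

/-- The logistic function is stable under multiplicative perturbations. -/
theorem inv_one_add_le {V V' : ℝ} (hp : 0 < V) (hp' : 0 < V') (hc : 1 ≤ c)
    (h1 : V ≤ c * V') (h2 : V' ≤ c * V) :
    1 / (1 + V) ≤ c * (1 / (1 + V')) ∧ 1 - 1 / (1 + V) ≤ c * (1 - 1 / (1 + V')) := by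
  have e : ∀ v : ℝ, 0 < v → 1 - 1 / (1 + v) = v / (1 + v) := fun v hv => by
    field_simp; ring
  constructor
  · rw [mul_one_div, div_le_div_iff₀ (by positivity) (by positivity)]
    nlinarith
  · rw [e V hp, e V' hp', ← mul_div_assoc, div_le_div_iff₀ (by positivity) (by positivity)]
    nlinarith [mul_pos hp hp']

/-- If the changed index lies in both sets, it contributes `y i * y' i` to either side and cancels.
Otherwise it occurs at most once, so a single factor `c` suffices where bounding the two products
separately would cost `c * c`. -/
theorem prod_mul_prod_le (hy : ∀ i, 0 < y i) (hy' : ∀ i, 0 < y' i) (hc : 1 ≤ c)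
    (h : ScoresClose c y y') (s t : Finset ℕ) :
    (∏ j ∈ s, y j) * ∏ j ∈ t, y' j ≤ c * ((∏ j ∈ s, y' j) * ∏ j ∈ t, y j) := by
  obtain ⟨i, h, h1, h2⟩ := h
  have hp : ∀ s : Finset ℕ, 0 < ∏ j ∈ s, y j := fun s => Finset.prod_pos fun i _ => hy i
  have hp' : ∀ s : Finset ℕ, 0 < ∏ j ∈ s, y' j := fun s => Finset.prod_pos fun i _ => hy' i
  by_cases ht : i ∈ t
  · by_cases hs : i ∈ s
    · refine le_trans (le_of_eq ?_) (le_mul_of_one_le_left (mul_pos (hp' s) (hp t)).le hc)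
      refine mul_right_cancel₀ (mul_pos (hy i) (hy' i)).ne' ?_
      linear_combination (∏ j ∈ t, y' j) * y i * prod_mul_eq h s hs -
        (∏ j ∈ s, y' j) * y i * prod_mul_eq h t ht
    · rw [prod_eq_of_notMem h s hs, mul_left_comm]
      exact mul_le_mul_of_nonneg_left
        (prod_le_mul_prod hy hc (fun j hj => (h j hj).symm) h2 t) (hp' s).le
  · rw [prod_eq_of_notMem h t ht, ← mul_assoc]
    exact mul_le_mul_of_nonneg_right (prod_le_mul_prod hy' hc h h1 s) (hp' t).le

/-- After cross-multiplication, `w_j / W ≤ c * w'_j / W'` holds term by term by `prod_mul_prod_le`.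
The normalization thus costs no extra factor. -/
theorem candMean_le (hy : ∀ i, 0 < y i) (hy' : ∀ i, 0 < y' i) (hc : 1 ≤ c)
    (h : ScoresClose c y y') {f : ℕ → ℝ} (hf : ∀ j, 0 ≤ f j) {t : ℕ} (ht : t ≠ 0) (k : ℕ) :
    candMean y f 0 k t ≤ c * candMean y' f 0 k t := by
  rw [candMean_zero, candMean_zero, Finset.sum_div, Finset.sum_div, Finset.mul_sum]
  refine Finset.sum_le_sum fun j _ => ?_
  have hW := totalWeight_pos hy ht
  have hW' := totalWeight_pos hy' ht
  rw [mul_div_right_comm, mul_div_right_comm, ← mul_assoc]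
  refine mul_le_mul_of_nonneg_right ?_ (hf _)
  rw [← mul_div_assoc, div_le_div_iff₀ hW hW', totalWeight, totalWeight, Finset.mul_sum,
    Finset.mul_sum]
  refine Finset.sum_le_sum fun l _ => ?_
  rw [mul_assoc]
  exact prod_mul_prod_le hy hy' hc h _ _

theorem candMean_nonneg (hy : ∀ i, 0 < y i) {f : ℕ → ℝ} (hf : ∀ j, 0 ≤ f j) (s k t : ℕ) :
    0 ≤ candMean y f s k t :=
  div_nonneg (add_nonneg (mul_nonneg (totalWeight_nonneg hy _) (hf _))
    (Finset.sum_nonneg fun j _ => mul_nonneg (weight_pos hy j).le (hf _)))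
    (totalWeight_nonneg hy _)

theorem alarm_le_mul (hy : ∀ i, 0 < y i) (hy' : ∀ i, 0 < y' i) (hc : 1 ≤ c) (L : ℕ)
    (h : ScoresClose c y y') (s : ℕ) :
    alarm L y s ≤ c * alarm L y' s ∧ 1 - alarm L y s ≤ c * (1 - alarm L y' s) := by
  obtain ⟨i, h, h1, h2⟩ := h
  unfold alarm
  split_ifs
  · exact inv_one_add_le (Finset.prod_pos fun i _ => hy i) (Finset.prod_pos fun i _ => hy' i) hc
      (prod_le_mul_prod hy' hc h h1 _)
      (prod_le_mul_prod hy hc (fun j hj => (h j hj).symm) h2 _)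
  · constructor <;> linarith

/-- The number `i / L * L + L - 1` is the last index of the block that contains `i`, and a score
enters the alarm of its own block only. -/
theorem alarm_eq_of_ne {L : ℕ} (hL : 0 < L) {i : ℕ} (h : ∀ j, j ≠ i → y j = y' j) {s : ℕ}
    (hs : s ≠ i / L * L + L - 1) : alarm L y s = alarm L y' s := by
  unfold alarm
  split_ifs with h0
  · rw [prod_eq_of_notMem h]
    intro hi
    rw [Finset.mem_Ico] at hi
    refine hs ?_
    obtain ⟨m, hm⟩ := Nat.dvd_of_mod_eq_zero h0
    cases m with
    | zero => omega
    | succ m =>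
      rw [Nat.mul_succ] at hm
      have : i / L = m := by
        rw [Nat.div_eq_iff hL, mul_comm]
        omega
      rw [this, mul_comm]
      omega
  · rfl

/-- At most one factor depends on the changed point: none if `t` precedes the end `e` of its block,
the alarm itself if `t = e`, and the absence of an alarm at `e` if `t > e`. -/
theorem prod_alarm_mul_alarm_le (hy : ∀ i, 0 < y i) (hy' : ∀ i, 0 < y' i) (hc : 1 ≤ c) {L : ℕ}
    (hL : 0 < L) (h : ScoresClose c y y') (t : ℕ) :
    (∏ i ∈ Finset.range t, (1 - alarm L y i)) * alarm L y t ≤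
      c * ((∏ i ∈ Finset.range t, (1 - alarm L y' i)) * alarm L y' t) := by
  have ha := alarm_le_mul hy hy' hc L h
  obtain ⟨i, h, -, -⟩ := h
  have heq := fun s hs => alarm_eq_of_ne (s := s) hL h hs
  set e := i / L * L + L - 1
  have hP : 0 ≤ ∏ i ∈ Finset.range t, (1 - alarm L y' i) :=
    Finset.prod_nonneg fun i _ => sub_nonneg.2 (alarm_le_one hy' _ _)
  by_cases he : e < t
  · rw [heq t he.ne', ← mul_assoc]
    refine mul_le_mul_of_nonneg_right ?_ (alarm_nonneg hy' _ _)
    have hm := Finset.mem_range.2 he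
    rw [← Finset.mul_prod_erase _ _ hm, ← Finset.mul_prod_erase _ _ hm, ← mul_assoc,
      Finset.prod_congr rfl fun j hj => by rw [heq j (Finset.ne_of_mem_erase hj)]]
    exact mul_le_mul_of_nonneg_right (ha e).2
      (Finset.prod_nonneg fun i _ => sub_nonneg.2 (alarm_le_one hy' _ _))
  · rw [Finset.prod_congr rfl fun j hj => by
      rw [heq j (by rw [Finset.mem_range] at hj; omega)], mul_left_comm]
    exact mul_le_mul_of_nonneg_left (ha t).1 hP

theorem ind_nonneg {α : Type*} (S : Set α) (a : α) : 0 ≤ ind S a := by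
  unfold ind; split_ifs <;> norm_num

/-- One factor `c` pays for the alarm time and one for the candidate, which is independent of the
alarm coins once the data are fixed. -/
theorem alarmSum_le (hy : ∀ i, 0 < y i) (hy' : ∀ i, 0 < y' i) (hc : 1 ≤ c)
    (h : ScoresClose c y y') (n : ℕ) (S : Set (ℕ × ℕ)) (m k : ℕ) :
    alarmSum n y S m 0 k ≤ c * c * alarmSum n y' S m 0 k := by
  unfold alarmSum
  rw [Finset.mul_sum]
  refine Finset.sum_le_sum fun t _ => ?_
  rw [← Finset.range_eq_Ico, mul_mul_mul_comm c c]
  have hc0 : 0 ≤ c := zero_le_one.trans hc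
  refine mul_le_mul (prod_alarm_mul_alarm_le hy hy' hc (Nat.succ_pos _) h t)
    (candMean_le hy hy' hc h (fun j => ind_nonneg _ _) t.succ_ne_zero k)
    (candMean_nonneg hy (fun j => ind_nonneg _ _) _ _ _) ?_
  exact mul_nonneg hc0 (mul_nonneg (Finset.prod_nonneg fun i _ =>
    sub_nonneg.2 (alarm_le_one hy' _ _)) (alarm_nonneg hy' _ _))

/-- During a block without alarm, the product of the scores is likely to be large. -/
theorem prod_alarm_block_le (hy : ∀ i, 0 < y i) {L : ℕ} (hL : 0 < L) (m : ℕ) :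
    ∏ i ∈ Finset.Ico (m * L) ((m + 1) * L), (1 - alarm L y i) ≤
      1 - 1 / (1 + ∏ i ∈ Finset.Ico (m * L) ((m + 1) * L), y i) := by
  have h1 : (m + 1) * L = m * L + L - 1 + 1 := by rw [add_mul, one_mul]; omega
  have h2 : alarm L y (m * L + L - 1) =
      1 / (1 + ∏ i ∈ Finset.Ico (m * L) ((m + 1) * L), y i) := by
    unfold alarm
    rw [← h1, if_pos (Nat.mul_mod_left _ _)]
    congr 4
    rw [add_mul, one_mul, Nat.add_sub_cancel]
  rw [← h2, h1, Finset.prod_Ico_succ_top (by omega)]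
  exact mul_le_of_le_one_left (sub_nonneg.2 (alarm_le_one hy _ _))
    (Finset.prod_le_one (fun i _ => sub_nonneg.2 (alarm_le_one hy _ _))
      fun i _ => sub_le_self _ (alarm_nonneg hy _ _))

/-- Bounded scores keep the alarm probability of each block above `1 / (1 + M ^ L)`, on every
stream; this gives almost sure halting without any assumption on the data. -/
theorem prod_alarm_range_le (hy : ∀ i, 0 < y i) {M : ℝ} (hM : ∀ i, y i ≤ M) {L : ℕ}
    (hL : 0 < L) (m : ℕ) :
    ∏ i ∈ Finset.range (m * L), (1 - alarm L y i) ≤ (1 - 1 / (1 + M ^ L)) ^ m := by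
  have hM0 : 0 < M := (hy 0).trans_le (hM 0)
  have h0 : 0 ≤ 1 - 1 / (1 + M ^ L) := by
    rw [sub_nonneg, div_le_one (by positivity)]
    have : 0 < M ^ L := by positivity
    linarith
  induction m with
  | zero => simp
  | succ m ih =>
    rw [Finset.range_eq_Ico, ← Finset.prod_Ico_consecutive _ (Nat.zero_le (m * L))
      (Nat.mul_le_mul_right L m.le_succ), ← Finset.range_eq_Ico, pow_succ]
    refine mul_le_mul ih ((prod_alarm_block_le hy hL m).trans ?_)
      (Finset.prod_nonneg fun i _ => sub_nonneg.2 (alarm_le_one hy _ _)) (pow_nonneg h0 m)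
    refine sub_le_sub_left ?_ _
    have hp : 0 < ∏ i ∈ Finset.Ico (m * L) ((m + 1) * L), y i := Finset.prod_pos fun i _ => hy i
    refine one_div_le_one_div_of_le (by positivity) (add_le_add le_rfl ?_)
    refine (Finset.prod_le_prod (fun i _ => (hy i).le) fun i _ => hM i).trans (le_of_eq ?_)
    rw [Finset.prod_const, Nat.card_Ico, add_mul, one_mul, Nat.add_sub_cancel_left]

theorem tendsto_prod_alarm (hy : ∀ i, 0 < y i) {M : ℝ} (hM : ∀ i, y i ≤ M) {L : ℕ}
    (hL : 0 < L) :
    Filter.Tendsto (fun m => ∏ i ∈ Finset.range (m * L), (1 - alarm L y i)) Filter.atTop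
      (nhds 0) := by
  have hM0 : 0 < M := (hy 0).trans_le (hM 0)
  have h1 : (0 : ℝ) < 1 / (1 + M ^ L) := by positivity
  have h0 : 0 ≤ 1 - 1 / (1 + M ^ L) := by
    rw [sub_nonneg, div_le_one (by positivity)]
    have : 0 < M ^ L := by positivity
    linarith
  exact squeeze_zero (fun m => Finset.prod_nonneg fun i _ => sub_nonneg.2 (alarm_le_one hy _ _))
    (prod_alarm_range_le hy hM hL) (tendsto_pow_atTop_nhds_zero_of_lt_one h0 (by linarith))

end Privacy

/-! ### Range and sensitivity of a single score -/

section ScoreBounds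

variable {a b l : ℝ} {u u' : ℝ × ℝ}

theorem clampRatio_mem (ha : 0 ≤ a) (hb : 0 ≤ b) (h1 : 0 ≤ u.1) (h2 : 0 ≤ u.2) :
    Real.exp (-b) ≤ clampRatio (Real.exp a) (Real.exp b) (Real.exp (-b)) u ∧
      clampRatio (Real.exp a) (Real.exp b) (Real.exp (-b)) u ≤ Real.exp a := by
  have hab : Real.exp (-b) ≤ Real.exp a := Real.exp_le_exp.2 (by linarith)
  unfold clampRatio
  split_ifs with h3 h4
  · exact ⟨le_rfl, hab⟩
  · exact ⟨hab, le_rfl⟩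
  · have hu : 0 < u.2 := by
      rcases h2.eq_or_lt with h | h
      · rw [← h, mul_zero] at h4
        exact absurd h1 h4
      · exact h
    rw [le_div_iff₀ hu, div_le_iff₀ hu, Real.exp_neg]
    refine ⟨?_, (not_le.1 h4).le⟩
    rw [inv_mul_le_iff₀ (Real.exp_pos b)]
    exact (not_le.1 h3).le

theorem score_pos (A B B' l : ℝ) (u : ℝ × ℝ) : 0 < score A B B' l u := Real.exp_pos _

theorem score_le (ha : 0 ≤ a) (hb : 0 ≤ b) (h1 : 0 ≤ u.1) (h2 : 0 ≤ u.2) :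
    score (Real.exp a) (Real.exp b) (Real.exp (-b)) l u ≤ Real.exp (a * (1 / 4) + l) := by
  obtain ⟨h3, h4⟩ := clampRatio_mem ha hb h1 h2
  refine Real.exp_le_exp.2 (add_le_add (mul_le_mul_of_nonneg_right ?_ (by norm_num)) le_rfl)
  rw [Real.log_le_iff_le_exp ((Real.exp_pos _).trans_le h3)]
  exact h4

theorem le_score (ha : 0 ≤ a) (hb : 0 ≤ b) (h1 : 0 ≤ u.1) (h2 : 0 ≤ u.2) :
    Real.exp (-b * (1 / 4) + l) ≤ score (Real.exp a) (Real.exp b) (Real.exp (-b)) l u := by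
  obtain ⟨h3, h4⟩ := clampRatio_mem ha hb h1 h2
  refine Real.exp_le_exp.2 (add_le_add (mul_le_mul_of_nonneg_right ?_ (by norm_num)) le_rfl)
  rw [Real.le_log_iff_exp_le ((Real.exp_pos _).trans_le h3)]
  exact h3

/-- Logarithms of scores range over an interval of length `(a + b) / 4 ≤ ε / 2`. The exponent `1/4`
is chosen for this: the online program spends the factor `e^(ε/2)` twice. -/
theorem score_le_mul_score {ε : ℝ} (ha : 0 ≤ a) (hb : 0 ≤ b) (haε : a ≤ ε) (hbε : b ≤ ε)
    (h1 : 0 ≤ u.1) (h2 : 0 ≤ u.2) (h1' : 0 ≤ u'.1) (h2' : 0 ≤ u'.2) :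
    score (Real.exp a) (Real.exp b) (Real.exp (-b)) l u ≤
      Real.exp (ε / 2) * score (Real.exp a) (Real.exp b) (Real.exp (-b)) l u' := by
  refine (score_le ha hb h1 h2).trans
    (le_trans ?_ (mul_le_mul_of_nonneg_left (le_score ha hb h1' h2') (Real.exp_pos _).le))
  rw [← Real.exp_add, Real.exp_le_exp]
  linarith

end ScoreBounds

/-! ### Privacy, termination and late outputs of the two programs -/

section ProgramPrivacy

variable {X : Type*} [MeasurableSpace X] (P Q : Measure X) {a b l ε : ℝ}

/-- The score of a data point, for the clamping levels `a` and `b`. -/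
def pointScore (a b l : ℝ) (x : X) : ℝ :=
  score (Real.exp a) (Real.exp b) (Real.exp (-b)) l (densities P Q x)

/-- The parameters that the two programs have in common. -/
def params (a b l : ℝ) : List ℝ := [Real.exp a, Real.exp b, Real.exp (-b), l]

/-- The scores of a data set, continued by ones. -/
def dataScore (a b l : ℝ) {n : ℕ} (x : Fin n → X) (i : ℕ) : ℝ :=
  if h : i < n then pointScore P Q a b l (x ⟨i, h⟩) else 1

theorem pointScore_pos (x : X) : 0 < pointScore P Q a b l x := score_pos _ _ _ _ _

theorem dataScore_pos {n : ℕ} (x : Fin n → X) (i : ℕ) : 0 < dataScore P Q a b l x i := by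
  unfold dataScore
  split_ifs
  · exact pointScore_pos P Q _
  · exact one_pos

theorem densities_nonneg (x : X) : 0 ≤ (densities P Q x).1 ∧ 0 ≤ (densities P Q x).2 :=
  ⟨ENNReal.toReal_nonneg, ENNReal.toReal_nonneg⟩

theorem pointScore_le_mul (ha : 0 ≤ a) (hb : 0 ≤ b) (haε : a ≤ ε) (hbε : b ≤ ε) (x x' : X) :
    pointScore P Q a b l x ≤ Real.exp (ε / 2) * pointScore P Q a b l x' :=
  score_le_mul_score ha hb haε hbε (densities_nonneg P Q x).1 (densities_nonneg P Q x).2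
    (densities_nonneg P Q x').1 (densities_nonneg P Q x').2

theorem pointScore_le (ha : 0 ≤ a) (hb : 0 ≤ b) (x : X) :
    pointScore P Q a b l x ≤ Real.exp (a * (1 / 4) + l) :=
  score_le ha hb (densities_nonneg P Q x).1 (densities_nonneg P Q x).2

/-- The leading `0` of the parameter list fills register 0, where the online program keeps `n`; both
programs then find their common parameters in registers 1 to 4. -/
theorem outProb_offlineProg {n : ℕ} (hn : n ≠ 0) (x : Fin n → X) (S : Set (ℕ × ℕ)) :
    outProb offlineProg (0 :: params a b l) (offlineData P Q x) S =
      ENNReal.ofReal (candMean (dataScore P Q a b l x) (fun j => ind S (j, n)) 0 0 n) := by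
  rw [outProb_eq_value, candMean_zero]
  congr 1
  refine value_offlineProg S (dataScore_pos P Q x) (fun s hs => ?_) (by simp [offlineData]) hn
  exact ⟨densities P Q (x ⟨s, hs⟩), by simp [offlineData, hs],
    by simp [dataScore, hs, pointScore]⟩

theorem offlinePrivate_offlineProg (ha : 0 ≤ a) (hb : 0 ≤ b) (haε : a ≤ ε) (hbε : b ≤ ε) :
    OfflinePrivate P Q offlineProg (0 :: params a b l) ε := by
  rintro n x x' ⟨i, hi⟩ S
  have hn : n ≠ 0 := by rintro rfl; exact i.elim0
  have hε : 0 ≤ ε := ha.trans haε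
  rw [outProb_offlineProg P Q hn, outProb_offlineProg P Q hn,
    ← ENNReal.ofReal_mul (Real.exp_pos _).le]
  refine ENNReal.ofReal_le_ofReal ((candMean_le (dataScore_pos P Q x) (dataScore_pos P Q x')
    (c := Real.exp (ε / 2)) (Real.one_le_exp (by linarith)) ⟨i, ?_, ?_, ?_⟩
    (fun j => ind_nonneg _ _) hn 0).trans
    (mul_le_mul_of_nonneg_right (Real.exp_le_exp.2 (by linarith))
      (candMean_nonneg (dataScore_pos P Q x') (fun j => ind_nonneg _ _) _ _ _)))
  · intro j hj
    unfold dataScore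
    split_ifs with h
    · rw [hi ⟨j, h⟩ fun e => hj (congrArg Fin.val e)]
    · rfl
  · simp only [dataScore, i.2, dif_pos]
    exact pointScore_le_mul P Q ha hb haε hbε _ _
  · simp only [dataScore, i.2, dif_pos]
    exact pointScore_le_mul P Q ha hb haε hbε _ _

/-- The parameters of the online program. -/
def onlineParams (a b l T : ℝ) : List ℝ := params a b l ++ [T]

variable {T : ℝ} {n : ℕ}

theorem outProb_onlineProg_of_lt (hT : n < T) (x : ℕ → X) (S : Set (ℕ × ℕ)) :
    outProb onlineProg ((n : ℝ) :: onlineParams a b l T) (onlineData P Q x) S =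
      ENNReal.ofReal (ind S (0, 0)) := by
  rw [outProb_eq_value]
  congr 1
  exact value_onlineProg_of_lt S hT

theorem outProb_onlineProg (hT : T ≤ n) (x : ℕ → X) (S : Set (ℕ × ℕ)) (h : ℕ) :
    ENNReal.ofReal (alarmSum n (fun i => pointScore P Q a b l (x i)) S h 0 0) ≤
      outProb onlineProg ((n : ℝ) :: onlineParams a b l T) (onlineData P Q x) S ∧
    outProb onlineProg ((n : ℝ) :: onlineParams a b l T) (onlineData P Q x) S ≤
      ENNReal.ofReal (alarmSum n (fun i => pointScore P Q a b l (x i)) S h 0 0 +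
        ∏ i ∈ Finset.range h,
          (1 - alarm (blockLen n) (fun i => pointScore P Q a b l (x i)) i)) := by
  rw [outProb_eq_value]
  have := value_onlineProg (data := onlineData P Q x) S
    (y := fun i => pointScore P Q a b l (x i)) (fun i => pointScore_pos P Q (x i))
    (fun s => ⟨densities P Q (x s), rfl, rfl⟩) hT h
  exact ⟨ENNReal.ofReal_le_ofReal this.1, ENNReal.ofReal_le_ofReal this.2⟩

/-- Bounds for all finite horizons pass to the limit, since the probability of no alarm vanishes
along multiples of the block length. -/
theorem outProb_le_of_alarmSum_le (ha : 0 ≤ a) (hb : 0 ≤ b) (hT : T ≤ n) (x : ℕ → X)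
    (S : Set (ℕ × ℕ)) {v : ENNReal}
    (hv : ∀ h, ENNReal.ofReal (alarmSum n (fun i => pointScore P Q a b l (x i)) S h 0 0) ≤ v) :
    outProb onlineProg ((n : ℝ) :: onlineParams a b l T) (onlineData P Q x) S ≤ v := by
  have ht := (tendsto_prod_alarm (fun i => pointScore_pos P Q (a := a) (b := b) (l := l) (x i))
    (fun i => pointScore_le P Q ha hb (x i)) (Nat.succ_pos (n / 4)))
  have ht' := (ENNReal.tendsto_ofReal ht).const_add v
  rw [ENNReal.ofReal_zero, add_zero] at ht'
  refine ge_of_tendsto' ht' fun m => ?_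
  refine (outProb_onlineProg P Q hT x S (m * (n / 4).succ)).2.trans
    (ENNReal.ofReal_add_le.trans ?_)
  exact add_le_add (hv _) le_rfl

theorem onlinePrivate_onlineProg (ha : 0 ≤ a) (hb : 0 ≤ b) (haε : a ≤ ε) (hbε : b ≤ ε) :
    OnlinePrivate P Q onlineProg ((n : ℝ) :: onlineParams a b l T) ε := by
  rintro x x' ⟨i, hi⟩ S
  have hε : 0 ≤ ε := ha.trans haε
  rcases lt_or_ge (n : ℝ) T with hT | hT
  · rw [outProb_onlineProg_of_lt P Q hT, outProb_onlineProg_of_lt P Q hT]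
    refine le_mul_of_one_le_left zero_le ?_
    rw [← ENNReal.ofReal_one]
    exact ENNReal.ofReal_le_ofReal (Real.one_le_exp hε)
  · refine outProb_le_of_alarmSum_le P Q ha hb hT x S fun h => ?_
    refine le_trans ?_ (mul_le_mul_right (outProb_onlineProg P Q hT x' S h).1 _)
    rw [← ENNReal.ofReal_mul (Real.exp_pos _).le]
    refine ENNReal.ofReal_le_ofReal ?_
    have := alarmSum_le (fun i => pointScore_pos P Q (a := a) (b := b) (l := l) (x i))
      (fun i => pointScore_pos P Q (a := a) (b := b) (l := l) (x' i)) (c := Real.exp (ε / 2))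
      (Real.one_le_exp (by linarith)) ⟨i, fun j hj => by simp only [hi j hj],
        pointScore_le_mul P Q ha hb haε hbε _ _, pointScore_le_mul P Q ha hb haε hbε _ _⟩ n S h 0
    rwa [← Real.exp_add, add_halves] at this

theorem candMean_one {y : ℕ → ℝ} (hy : ∀ i, 0 < y i) {t : ℕ} (ht : t ≠ 0) (k : ℕ) :
    candMean y (fun _ => 1) 0 k t = 1 := by
  rw [candMean_zero]
  simp only [mul_one]
  exact div_self (totalWeight_pos hy ht).ne'

/-- The probability of an alarm is the complement of the probability that there is none. -/
theorem sum_alarm_eq (L : ℕ) (y : ℕ → ℝ) (h : ℕ) :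
    ∑ t ∈ Finset.range h, (∏ i ∈ Finset.range t, (1 - alarm L y i)) * alarm L y t =
      1 - ∏ i ∈ Finset.range h, (1 - alarm L y i) := by
  induction h with
  | zero => simp
  | succ h ih =>
    rw [Finset.sum_range_succ, ih, Finset.prod_range_succ]
    ring

theorem alarmSum_eq_of_forall {y : ℕ → ℝ} (hy : ∀ i, 0 < y i) {S : Set (ℕ × ℕ)} {h : ℕ}
    (hS : ∀ t ≤ h, ∀ k, (k, t) ∈ S) :
    alarmSum n y S h 0 0 = 1 - ∏ i ∈ Finset.range h, (1 - alarm (blockLen n) y i) := by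
  rw [alarmSum, zero_add, ← sum_alarm_eq, ← Finset.range_eq_Ico]
  refine Finset.sum_congr rfl fun t ht => ?_
  rw [← Finset.range_eq_Ico]
  have : (fun j => ind S (onlineResult n (t + 1) j)) = fun _ => 1 := by
    funext j
    exact if_pos (hS _ (Finset.mem_range.1 ht) _)
  rw [this, candMean_one hy t.succ_ne_zero, mul_one]

theorem onlineEfficient_onlineProg (ha : 0 ≤ a) (hb : 0 ≤ b) :
    OnlineEfficient P Q onlineProg ((n : ℝ) :: onlineParams a b l T) 100 := by
  refine fun x => ⟨?_, online_steps_le P Q _ x⟩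
  rcases lt_or_ge (n : ℝ) T with hT | hT
  · rw [outProb_onlineProg_of_lt P Q hT]
    simp [ind]
  · refine le_antisymm ?_ ?_
    · rw [outProb_eq_value]
      exact ENNReal.ofReal_le_one.2 (value_le_one _)
    · have ht := (tendsto_prod_alarm
        (fun i => pointScore_pos P Q (a := a) (b := b) (l := l) (x i))
        (fun i => pointScore_le P Q ha hb (x i)) (Nat.succ_pos (n / 4)))
      have ht' := ENNReal.tendsto_ofReal (ht.const_sub 1)
      rw [sub_zero, ENNReal.ofReal_one] at ht'
      refine le_of_tendsto' ht' fun m => ?_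
      have := (outProb_onlineProg P Q (a := a) (b := b) (l := l) hT x Set.univ
        (m * (n / 4 + 1))).1
      rwa [alarmSum_eq_of_forall (fun i => pointScore_pos P Q (x i))
        fun _ _ _ => Set.mem_univ _] at this

/-- Accurate results are found soon. -/
theorem outProb_onlineProg_late (ha : 0 ≤ a) (hb : 0 ≤ b) (x : ℕ → X) {α : ℝ} (hα : α ≤ T)
    (k : ℕ) :
    outProb onlineProg ((n : ℝ) :: onlineParams a b l T) (onlineData P Q x)
      {r | |(r.1 : ℝ) - k| ≤ α ∧ k + 2 * n < r.2} = 0 := by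
  rcases lt_or_ge (n : ℝ) T with hT | hT
  · rw [outProb_onlineProg_of_lt P Q hT]
    simp [ind]
  · refine le_antisymm (outProb_le_of_alarmSum_le P Q ha hb hT x _ fun h => ?_) zero_le
    rw [alarmSum, Finset.sum_eq_zero]
    · simp
    intro t _
    have : (fun j => ind {r : ℕ × ℕ | |(r.1 : ℝ) - k| ≤ α ∧ k + 2 * n < r.2}
        (onlineResult n (t + 1) j)) = fun _ => 0 := by
      funext j
      refine if_neg ?_
      rintro ⟨h1, h2⟩
      simp only [onlineResult] at h1 h2
      have h3 := (le_abs_self _).trans h1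
      -- The output trails the stopping time by at most `n`. If it is also within `α ≤ T ≤ n` of
      -- `k`, the stopping time is at most `k + 2 * n`.
      have h4 : t + 1 ≤ max j (t + 1 - n) + n := by omega
      have h5 : ((t + 1 : ℕ) : ℝ) ≤ (max j (t + 1 - n) : ℕ) + n := by exact_mod_cast h4
      have h6 : ((k + 2 * n : ℕ) : ℝ) < (t + 1 : ℕ) := by exact_mod_cast h2
      push_cast at h5 h6 h3
      linarith
    rw [this]
    simp [candMean]

end ProgramPrivacy

end

end ChangePoint

namespace ChangePoint
noncomputable section

set_option linter.unusedSectionVars false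

/-! ### Moments of the scores -/

section Pointwise

variable {p q a b ε : ℝ}

theorem exp_half_mul_self (x : ℝ) : Real.exp (x / 2) * Real.exp (x / 2) = Real.exp x := by
  rw [← Real.exp_add, add_halves]

/-- Where nothing is clamped, both left sides are `√(p * q)`. Where the ratio is clamped to `e^a`,
the density `p` splits into `e^a * q` and the excess, and the excess is multiplied by `e^(-a/2)`;
the lower clamp is symmetric. -/
theorem clampRatio_identities (hp : 0 ≤ p) (hq : 0 ≤ q) (ha : 0 ≤ a) (hb : 0 ≤ b) :
    p * (√(clampRatio (Real.exp a) (Real.exp b) (Real.exp (-b)) (p, q)))⁻¹ =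
      √(min p (Real.exp a * q) * min q (Real.exp b * p)) +
        max (p - Real.exp a * q) 0 * Real.exp (-a / 2) ∧
    q * √(clampRatio (Real.exp a) (Real.exp b) (Real.exp (-b)) (p, q)) =
      √(min p (Real.exp a * q) * min q (Real.exp b * p)) +
        max (q - Real.exp b * p) 0 * Real.exp (-b / 2) := by
  have ha1 : 1 ≤ Real.exp a := Real.one_le_exp ha
  have hb1 : 1 ≤ Real.exp b := Real.one_le_exp hb
  have ea : Real.exp (-a / 2) = (Real.exp (a / 2))⁻¹ := by rw [← Real.exp_neg, neg_div]
  have eb : Real.exp (-b / 2) = (Real.exp (b / 2))⁻¹ := by rw [← Real.exp_neg, neg_div]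
  have sa := exp_half_mul_self a
  have sb := exp_half_mul_self b
  have pa := Real.exp_pos (a / 2)
  have pb := Real.exp_pos (b / 2)
  unfold clampRatio
  dsimp only
  split_ifs with h1 h2
  · have h3 : p ≤ Real.exp a * q := by nlinarith
    rw [min_eq_left h3, min_eq_right h1, max_eq_right (sub_nonpos.2 h3),
      max_eq_left (sub_nonneg.2 h1), ← Real.exp_half, eb,
      show p * (Real.exp b * p) = (Real.exp (b / 2) * p) ^ 2 by rw [← sb]; ring,
      Real.sqrt_sq (by positivity), ← sb]
    constructor
    · rw [inv_inv]; ring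
    · field_simp; ring
  · have h3 : q ≤ Real.exp b * p := by nlinarith
    rw [min_eq_left h3, min_eq_right h2, max_eq_right (sub_nonpos.2 h3),
      max_eq_left (sub_nonneg.2 h2), ← Real.exp_half, ea,
      show Real.exp a * q * q = (Real.exp (a / 2) * q) ^ 2 by rw [← sa]; ring,
      Real.sqrt_sq (by positivity), ← sa]
    constructor
    · field_simp; ring
    · ring
  · have h1' := (not_le.1 h1).le
    have h2' := (not_le.1 h2).le
    have hq0 : 0 < q := by
      rcases hq.eq_or_lt with h | h
      · rw [← h, mul_zero] at h2
        exact absurd hp h2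
      · exact h
    have hp0 : 0 < p := by
      rcases hp.eq_or_lt with h | h
      · rw [← h, mul_zero] at h1
        exact absurd hq h1
      · exact h
    rw [min_eq_left h2', min_eq_left h1', max_eq_right (sub_nonpos.2 h2'),
      max_eq_right (sub_nonpos.2 h1'), Real.sqrt_div hp, Real.sqrt_mul hp]
    have hsp := Real.mul_self_sqrt hp
    have hsq := Real.mul_self_sqrt hq
    have hp1 := Real.sqrt_pos.2 hp0
    have hq1 := Real.sqrt_pos.2 hq0
    constructor
    · rw [inv_div, zero_mul, add_zero, mul_div_assoc', div_eq_iff hp1.ne']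
      nth_rewrite 1 [← hsp]; ring
    · rw [zero_mul, add_zero, mul_div_assoc', div_eq_iff hq1.ne']
      nth_rewrite 1 [← hsq]; ring

/-- The truncated density of P is at most `e^ε` times that of Q; taking the geometric mean of the
two leaves `e^(-ε/2)`. -/
theorem exp_mul_min_le_sqrt (hp : 0 ≤ p) (hq : 0 ≤ q) (ha : a ≤ ε) (hb : 0 ≤ b) (hε : 0 ≤ ε) :
    Real.exp (-ε / 2) * min p (Real.exp a * q) ≤
      √(min p (Real.exp a * q) * min q (Real.exp b * p)) := by
  have hm : 0 ≤ min p (Real.exp a * q) := le_min hp (by positivity)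
  have e := exp_half_mul_self (-ε)
  refine Real.le_sqrt_of_sq_le ?_
  rw [mul_pow, sq, sq, e, mul_left_comm]
  refine mul_le_mul_of_nonneg_left (le_min ?_ ?_) hm
  · rw [Real.exp_neg, inv_mul_le_iff₀ (Real.exp_pos ε)]
    exact (min_le_right _ _).trans (mul_le_mul_of_nonneg_right (Real.exp_le_exp.2 ha) hq)
  · refine (mul_le_mul_of_nonneg_left (min_le_left _ _) (Real.exp_pos _).le).trans
      (mul_le_mul_of_nonneg_right (Real.exp_le_exp.2 (by linarith)) hp)

end Pointwise

/-! ### Clamping levels, affinity of the truncated densities, and normalization of the scores -/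

section Levels

variable {X : Type*} [MeasurableSpace X] (P Q : Measure X)

theorem measurable_densities : Measurable (densities P Q) :=
  ((Measure.measurable_rnDeriv _ _).ennreal_toReal).prodMk
    ((Measure.measurable_rnDeriv _ _).ennreal_toReal)

theorem densities_swap (x : X) : densities Q P x = (densities P Q x).swap := by
  simp [densities, add_comm Q P]

variable [IsProbabilityMeasure P] [IsProbabilityMeasure Q]

theorem absolutelyContinuous_add_left : P ≪ P + Q :=
  Measure.absolutelyContinuous_of_le (Measure.le_add_right le_rfl)

theorem absolutelyContinuous_add_right : Q ≪ P + Q :=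
  Measure.absolutelyContinuous_of_le (Measure.le_add_left le_rfl)

theorem integrable_fst : Integrable (fun x => (densities P Q x).1) (P + Q) :=
  Measure.integrable_toReal_rnDeriv

theorem integrable_snd : Integrable (fun x => (densities P Q x).2) (P + Q) :=
  Measure.integrable_toReal_rnDeriv

theorem integral_fst : ∫ x, (densities P Q x).1 ∂(P + Q) = 1 := by
  have := Measure.integral_toReal_rnDeriv (absolutelyContinuous_add_left P Q)
  rw [probReal_univ] at this
  exact this

theorem integral_snd : ∫ x, (densities P Q x).2 ∂(P + Q) = 1 := by
  have := Measure.integral_toReal_rnDeriv (absolutelyContinuous_add_right P Q)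
  rw [probReal_univ] at this
  exact this

theorem integral_left (f : X → ℝ) :
    ∫ x, f x ∂P = ∫ x, (densities P Q x).1 * f x ∂(P + Q) :=
  (integral_rnDeriv_smul (absolutelyContinuous_add_left P Q)).symm

theorem integral_right (f : X → ℝ) :
    ∫ x, f x ∂Q = ∫ x, (densities P Q x).2 * f x ∂(P + Q) :=
  (integral_rnDeriv_smul (absolutelyContinuous_add_right P Q)).symm

theorem hockeyStick_swap (y : ℝ) : hockeyStick Q P y =
    ∫ x, max ((densities P Q x).2 - Real.exp y * (densities P Q x).1) 0 ∂(P + Q) := by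
  simp only [hockeyStick, densities_swap P Q, add_comm Q P, Prod.fst_swap, Prod.snd_swap]

theorem tau_swap (ε : ℝ) : tau Q P ε = tau P Q ε := max_comm _ _

theorem integrable_excess (y : ℝ) :
    Integrable (fun x => max ((densities P Q x).1 - Real.exp y * (densities P Q x).2) 0)
      (P + Q) :=
  ((integrable_fst P Q).sub ((integrable_snd P Q).const_mul _)).sup (integrable_zero _ _ _)

theorem hockeyStick_nonneg (y : ℝ) : 0 ≤ hockeyStick P Q y :=
  integral_nonneg fun _ => le_max_right _ _

theorem hockeyStick_antitone : Antitone (hockeyStick P Q) := by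
  intro y z h
  refine integral_mono (integrable_excess P Q z) (integrable_excess P Q y) fun x => ?_
  have := (densities_nonneg P Q x).2
  exact max_le_max (by gcongr) le_rfl

theorem hockeyStick_le_one (y : ℝ) : hockeyStick P Q y ≤ 1 := by
  rw [← integral_fst P Q]
  refine integral_mono (integrable_excess P Q y) (integrable_fst P Q) fun x => ?_
  obtain ⟨h1, h2⟩ := densities_nonneg P Q x
  exact max_le (sub_le_self _ (by positivity)) h1

theorem continuous_hockeyStick : Continuous (hockeyStick P Q) := by
  refine continuous_of_dominated (fun y => (integrable_excess P Q y).aestronglyMeasurable)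
    (bound := fun x => (densities P Q x).1) (fun y => ?_) (integrable_fst P Q) ?_
  · refine Filter.Eventually.of_forall fun x => ?_
    obtain ⟨h1, h2⟩ := densities_nonneg P Q x
    rw [Real.norm_of_nonneg (le_max_right _ _)]
    exact max_le (sub_le_self _ (by positivity)) h1
  · exact Filter.Eventually.of_forall fun x => by fun_prop

/-- At level `0` both divergences are the total variation distance. -/
theorem hockeyStick_zero_swap : hockeyStick Q P 0 = hockeyStick P Q 0 := by
  rw [hockeyStick_swap, hockeyStick, ← sub_eq_zero, ← integral_sub]
  · have : ∀ x, max ((densities P Q x).2 - Real.exp 0 * (densities P Q x).1) 0 -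
        max ((densities P Q x).1 - Real.exp 0 * (densities P Q x).2) 0 =
        (densities P Q x).2 - (densities P Q x).1 := by
      intro x
      rw [Real.exp_zero, one_mul, one_mul]
      rcases le_total (densities P Q x).1 (densities P Q x).2 with h | h
      · rw [max_eq_left (sub_nonneg.2 h), max_eq_right (sub_nonpos.2 h), sub_zero]
      · rw [max_eq_left (sub_nonneg.2 h), max_eq_right (sub_nonpos.2 h)]; ring
    simp only [this]
    rw [integral_sub (integrable_snd P Q) (integrable_fst P Q), integral_fst, integral_snd,
      sub_self]
  · exact ((integrable_snd P Q).sub ((integrable_fst P Q).const_mul _)).sup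
      (integrable_zero _ _ _)
  · exact integrable_excess P Q 0

variable {ε : ℝ}

/-- The divergence is continuous and falls from the total variation distance, which is at least `τ`,
to at most `τ` at `ε`. Hence the level `τ` is attained, and compactness puts the supremum into the
set. -/
theorem clampLevel_spec (hε : 0 ≤ ε) :
    clampLevel P Q ε ∈ Set.Icc 0 ε ∧ hockeyStick P Q (clampLevel P Q ε) = tau P Q ε := by
  have hc : IsCompact {y : ℝ | y ∈ Set.Icc 0 ε ∧ hockeyStick P Q y = tau P Q ε} :=
    isCompact_Icc.inter_right (isClosed_eq (continuous_hockeyStick P Q) continuous_const)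
  refine hc.sSup_mem ?_
  have h1 : tau P Q ε ≤ hockeyStick P Q 0 := by
    refine max_le (hockeyStick_antitone P Q hε) ?_
    rw [← hockeyStick_zero_swap]
    exact hockeyStick_antitone Q P hε
  obtain ⟨y, hy, hy'⟩ := intermediate_value_Icc' hε (continuous_hockeyStick P Q).continuousOn
    ⟨le_max_left _ _, h1⟩
  exact ⟨y, hy, hy'⟩

theorem clampLevel_eq (hε : 0 ≤ ε) (h : hockeyStick P Q ε = tau P Q ε) :
    clampLevel P Q ε = ε :=
  IsGreatest.csSup_eq ⟨⟨⟨hε, le_rfl⟩, h⟩, fun _ hy => hy.1.2⟩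

/-- The direction with the larger divergence keeps the full level `ε`. Only in this direction does
the mass `τ` gain the factor `e^(-ε/2)`, which is enough for a bound on the product of the two
moments. -/
theorem clampLevel_eq_or (hε : 0 ≤ ε) : clampLevel P Q ε = ε ∨ clampLevel Q P ε = ε := by
  rcases max_choice (hockeyStick P Q ε) (hockeyStick Q P ε) with h | h
  · exact Or.inl (clampLevel_eq P Q hε h.symm)
  · exact Or.inr (clampLevel_eq Q P hε (by rw [tau_swap]; exact h.symm))

theorem tau_nonneg (ε : ℝ) : 0 ≤ tau P Q ε :=
  (hockeyStick_nonneg P Q ε).trans (le_max_left _ _)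

theorem tau_le_one (ε : ℝ) : tau P Q ε ≤ 1 :=
  max_le (hockeyStick_le_one P Q ε) (hockeyStick_le_one Q P ε)

/-- The density of `P`, truncated at `e^a` times the density of `Q`. -/
def truncP (a : ℝ) (x : X) : ℝ :=
  min (densities P Q x).1 (Real.exp a * (densities P Q x).2)

/-- The density of `Q`, truncated at `e^b` times the density of `P`. -/
def truncQ (b : ℝ) (x : X) : ℝ :=
  min (densities P Q x).2 (Real.exp b * (densities P Q x).1)

variable (a b : ℝ)

theorem truncP_nonneg (x : X) : 0 ≤ truncP P Q a x :=
  le_min (densities_nonneg P Q x).1 (mul_nonneg (Real.exp_pos a).le (densities_nonneg P Q x).2)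

theorem truncQ_nonneg (x : X) : 0 ≤ truncQ P Q b x :=
  le_min (densities_nonneg P Q x).2 (mul_nonneg (Real.exp_pos b).le (densities_nonneg P Q x).1)

theorem integrable_truncP : Integrable (truncP P Q a) (P + Q) :=
  (integrable_fst P Q).inf ((integrable_snd P Q).const_mul _)

theorem integrable_truncQ : Integrable (truncQ P Q b) (P + Q) :=
  (integrable_snd P Q).inf ((integrable_fst P Q).const_mul _)

theorem excess_eq (x : X) : max ((densities P Q x).1 - Real.exp a * (densities P Q x).2) 0 =
    (densities P Q x).1 - truncP P Q a x := by
  unfold truncP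
  rcases le_total (densities P Q x).1 (Real.exp a * (densities P Q x).2) with h | h
  · rw [min_eq_left h, sub_self, max_eq_right (sub_nonpos.2 h)]
  · rw [min_eq_right h, max_eq_left (sub_nonneg.2 h)]

theorem excess_eq' (x : X) : max ((densities P Q x).2 - Real.exp b * (densities P Q x).1) 0 =
    (densities P Q x).2 - truncQ P Q b x := by
  unfold truncQ
  rcases le_total (densities P Q x).2 (Real.exp b * (densities P Q x).1) with h | h
  · rw [min_eq_left h, sub_self, max_eq_right (sub_nonpos.2 h)]
  · rw [min_eq_right h, max_eq_left (sub_nonneg.2 h)]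

theorem integral_truncP : ∫ x, truncP P Q a x ∂(P + Q) = 1 - hockeyStick P Q a := by
  simp only [hockeyStick, excess_eq]
  rw [integral_sub (integrable_fst P Q) (integrable_truncP P Q a), integral_fst]
  ring

theorem integral_truncQ : ∫ x, truncQ P Q b x ∂(P + Q) = 1 - hockeyStick Q P b := by
  simp only [hockeyStick_swap, excess_eq']
  rw [integral_sub (integrable_snd P Q) (integrable_truncQ P Q b), integral_snd]
  ring

/-- The integral of the geometric mean of the two truncated densities. -/
def affinity : ℝ := ∫ x, √(truncP P Q a x * truncQ P Q b x) ∂(P + Q)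

theorem integrable_sqrt_mul {μ : Measure X} {f g : X → ℝ} (hf : Integrable f μ)
    (hg : Integrable g μ) (hf0 : ∀ x, 0 ≤ f x) (hg0 : ∀ x, 0 ≤ g x) :
    Integrable (fun x => √(f x * g x)) μ := by
  refine (hf.add hg).mono'
    (hf.aestronglyMeasurable.aemeasurable.mul hg.aestronglyMeasurable.aemeasurable).sqrt.aestronglyMeasurable
    (Filter.Eventually.of_forall fun x => ?_)
  rw [Real.norm_of_nonneg (Real.sqrt_nonneg _), Pi.add_apply]
  refine Real.sqrt_le_iff.2 ⟨add_nonneg (hf0 x) (hg0 x), ?_⟩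
  nlinarith [hf0 x, hg0 x, mul_nonneg (hf0 x) (hg0 x)]

theorem integrable_affinity :
    Integrable (fun x => √(truncP P Q a x * truncQ P Q b x)) (P + Q) :=
  integrable_sqrt_mul (integrable_truncP P Q a) (integrable_truncQ P Q b) (truncP_nonneg P Q a)
    (truncQ_nonneg P Q b)

theorem affinity_nonneg : 0 ≤ affinity P Q a b := integral_nonneg fun _ => Real.sqrt_nonneg _

theorem sq_sqrt_sub_sqrt {u v : ℝ} (hu : 0 ≤ u) (hv : 0 ≤ v) :
    (√u - √v) ^ 2 = u + v - 2 * √(u * v) := by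
  rw [Real.sqrt_mul hu, sub_sq, Real.sq_sqrt hu, Real.sq_sqrt hv]
  ring

theorem integral_sq_sub_sqrt {t : ℝ} (hP : hockeyStick P Q a = t) (hQ : hockeyStick Q P b = t) :
    ∫ x, (√(truncP P Q a x) - √(truncQ P Q b x)) ^ 2 ∂(P + Q) =
      2 * (1 - t - affinity P Q a b) := by
  simp only [sq_sqrt_sub_sqrt (truncP_nonneg P Q a _) (truncQ_nonneg P Q b _)]
  rw [integral_sub, integral_add (integrable_truncP P Q a) (integrable_truncQ P Q b),
    integral_const_mul, integral_truncP, integral_truncQ, hP, hQ, affinity]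
  · ring
  · exact (integrable_truncP P Q a).add (integrable_truncQ P Q b)
  · exact (integrable_affinity P Q a b).const_mul 2

theorem affinity_le {t : ℝ} (hP : hockeyStick P Q a = t) (hQ : hockeyStick Q P b = t) :
    affinity P Q a b ≤ 1 - t := by
  have := integral_sq_sub_sqrt P Q a b hP hQ
  have h0 : 0 ≤ ∫ x, (√(truncP P Q a x) - √(truncQ P Q b x)) ^ 2 ∂(P + Q) :=
    integral_nonneg fun _ => sq_nonneg _
  linarith

theorem le_affinity (ha : a ≤ ε) (hb : 0 ≤ b) (hε : 0 ≤ ε) :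
    Real.exp (-ε / 2) * (1 - hockeyStick P Q a) ≤ affinity P Q a b := by
  rw [← integral_truncP, ← integral_const_mul]
  refine integral_mono ((integrable_truncP P Q a).const_mul _) (integrable_affinity P Q a b)
    fun x => ?_
  exact exp_mul_min_le_sqrt (densities_nonneg P Q x).1 (densities_nonneg P Q x).2 ha hb hε

theorem one_sub_tau_mul_hellinger (hε : 0 ≤ ε) :
    (1 - tau P Q ε) * hellingerSqClamped P Q ε =
      1 - tau P Q ε - affinity P Q (clampLevel P Q ε) (clampLevel Q P ε) := by
  obtain ⟨-, h1⟩ := clampLevel_spec P Q hε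
  obtain ⟨-, h2⟩ := clampLevel_spec Q P hε
  rw [tau_swap] at h2
  rcases (tau_le_one P Q ε).eq_or_lt with h | h
  -- For `τ = 1` the truncated densities have mass `0`, so both sides vanish.
  · have h3 := affinity_le P Q _ _ h1 h2
    have h4 := affinity_nonneg P Q (clampLevel P Q ε) (clampLevel Q P ε)
    rw [h] at h3 ⊢
    linarith
  · have hc : 0 < 1 - tau P Q ε := sub_pos.2 h
    have h3 := integral_sq_sub_sqrt P Q _ _ h1 h2
    have : ∀ x, (√(clampedP P Q ε x) - √(clampedQ P Q ε x)) ^ 2 = (1 - tau P Q ε)⁻¹ *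
        (√(truncP P Q (clampLevel P Q ε) x) - √(truncQ P Q (clampLevel Q P ε) x)) ^ 2 := by
      intro x
      have e1 : clampedP P Q ε x = truncP P Q (clampLevel P Q ε) x / (1 - tau P Q ε) := rfl
      have e2 : clampedQ P Q ε x = truncQ P Q (clampLevel Q P ε) x / (1 - tau P Q ε) := rfl
      rw [e1, e2, Real.sqrt_div (truncP_nonneg P Q _ _), Real.sqrt_div (truncQ_nonneg P Q _ _),
        ← sub_div, div_pow, Real.sq_sqrt hc.le]
      ring
    rw [hellingerSqClamped]
    simp only [this]
    rw [integral_const_mul, h3]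
    field_simp

theorem hellinger_eq_zero_of_tau (h : tau P Q ε = 1) : hellingerSqClamped P Q ε = 0 := by
  simp [hellingerSqClamped, clampedP, clampedQ, h]

theorem hellinger_nonneg (ε : ℝ) : 0 ≤ hellingerSqClamped P Q ε :=
  mul_nonneg (by norm_num) (integral_nonneg fun _ => sq_nonneg _)

/-- The densities of P' and Q' satisfy `P' ≤ e^ε Q'`, so their affinity is at least `e^(-ε/2)`. -/
theorem hellinger_le (hε : 0 ≤ ε) : hellingerSqClamped P Q ε ≤ 1 - Real.exp (-ε / 2) := by
  have h0 : 0 ≤ 1 - Real.exp (-ε / 2) := sub_nonneg.2 (Real.exp_le_one_iff.2 (by linarith))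
  rcases (tau_le_one P Q ε).eq_or_lt with h | h
  · rwa [hellinger_eq_zero_of_tau P Q h]
  · obtain ⟨h1, h2⟩ := clampLevel_spec P Q hε
    obtain ⟨h3, -⟩ := clampLevel_spec Q P hε
    have h4 := le_affinity P Q _ (clampLevel Q P ε) h1.2 h3.1 hε
    have h5 := one_sub_tau_mul_hellinger P Q hε
    rw [h2] at h4
    nlinarith

/-- The reciprocal of the rate in the theorem. -/
def rate (P Q : Measure X) (ε : ℝ) : ℝ := min ε 1 * tau P Q ε + hellingerSqClamped P Q ε

theorem rate_nonneg (hε : 0 ≤ ε) : 0 ≤ rate P Q ε :=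
  add_nonneg (mul_nonneg (le_min hε zero_le_one) (tau_nonneg P Q ε)) (hellinger_nonneg P Q ε)

theorem rate_le_two (hε : 0 ≤ ε) : rate P Q ε ≤ 2 := by
  have h1 := hellinger_le P Q hε
  have h2 := tau_le_one P Q ε
  have h3 := tau_nonneg P Q ε
  have h4 := Real.exp_pos (-ε / 2)
  have h5 : min ε 1 ≤ 1 := min_le_right _ _
  have h6 : min ε 1 * tau P Q ε ≤ 1 * 1 := mul_le_mul h5 h2 h3 zero_le_one
  unfold rate
  linarith

/-- With `m = min ε 1`, this rests on `e^(-m/2) ≤ 1/(1 + m/2) ≤ 1 - m/3`, where the second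
inequality needs `m ≤ 1`. -/
theorem min_le_three_mul (hε : 0 ≤ ε) : min ε 1 ≤ 3 * (1 - Real.exp (-ε / 2)) := by
  set m := min ε 1
  have hm : 0 ≤ m := le_min hε zero_le_one
  have hm1 : m ≤ 1 := min_le_right _ _
  have h1 : Real.exp (-ε / 2) ≤ Real.exp (-(m / 2)) :=
    Real.exp_le_exp.2 (by linarith [min_le_left ε 1])
  have h2 : Real.exp (-(m / 2)) ≤ (1 + m / 2)⁻¹ := by
    rw [Real.exp_neg]
    exact inv_anti₀ (by linarith) (by linarith [Real.add_one_le_exp (m / 2)])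
  have h3 : (1 + m / 2)⁻¹ ≤ 1 - m / 3 := by
    rw [inv_le_iff_one_le_mul₀ (by linarith)]
    nlinarith
  linarith

/-- Split `H²` into `τ H²` and `(1-τ) H²`. The first part is at most `τ (1 - e^(-ε/2))` by
`hellinger_le`, and `min(ε,1) τ` is at most three times that, which gives the factor 4. -/
theorem rate_le (hε : 0 ≤ ε) : rate P Q ε / 4 ≤
    tau P Q ε * (1 - Real.exp (-ε / 2)) + (1 - tau P Q ε) * hellingerSqClamped P Q ε := by
  have h1 := mul_le_mul_of_nonneg_left (hellinger_le P Q hε) (tau_nonneg P Q ε)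
  have h2 := mul_le_mul_of_nonneg_right (min_le_three_mul hε) (tau_nonneg P Q ε)
  have h3 := mul_nonneg (sub_nonneg.2 (tau_le_one P Q ε)) (hellinger_nonneg P Q ε)
  unfold rate
  nlinarith

theorem eq_of_densities_ae_eq
    (h : ∀ᵐ x ∂(P + Q), (densities P Q x).1 = (densities P Q x).2) : P = Q := by
  ext s _
  have h1 := Measure.setIntegral_toReal_rnDeriv (absolutelyContinuous_add_left P Q) s
  have h2 := Measure.setIntegral_toReal_rnDeriv (absolutelyContinuous_add_right P Q) s
  have h3 : ∫ x in s, (P.rnDeriv (P + Q) x).toReal ∂(P + Q) =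
      ∫ x in s, (Q.rnDeriv (P + Q) x).toReal ∂(P + Q) :=
    integral_congr_ae (ae_restrict_of_ae h)
  rw [h1, h2] at h3
  exact (measureReal_eq_measureReal_iff).1 h3

/-- If the rate vanishes, then `τ = 0` leaves no excess, so truncation changes nothing, and `H² = 0`
makes the truncated densities agree almost everywhere. -/
theorem rate_pos (hε : 0 < ε) (hPQ : P ≠ Q) : 0 < rate P Q ε := by
  refine (rate_nonneg P Q hε.le).lt_of_ne' fun h => hPQ ?_
  have hm : 0 < min ε 1 := lt_min hε one_pos
  have h0 := mul_nonneg hm.le (tau_nonneg P Q ε)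
  have hH := hellinger_nonneg P Q ε
  unfold rate at h
  have hτ : tau P Q ε = 0 := by
    have : min ε 1 * tau P Q ε = 0 := by linarith
    exact (mul_eq_zero.1 this).resolve_left hm.ne'
  have hH0 : hellingerSqClamped P Q ε = 0 := by linarith
  obtain ⟨-, h1⟩ := clampLevel_spec P Q hε.le
  obtain ⟨-, h2⟩ := clampLevel_spec Q P hε.le
  rw [tau_swap] at h2
  have h3 := one_sub_tau_mul_hellinger P Q hε.le
  have h4 := integral_sq_sub_sqrt P Q _ _ h1 h2
  rw [hH0, hτ] at h3
  rw [hτ] at h1 h2 h4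
  set a := clampLevel P Q ε
  set b := clampLevel Q P ε
  have h5 : ∫ x, (√(truncP P Q a x) - √(truncQ P Q b x)) ^ 2 ∂(P + Q) = 0 := by
    rw [h4]; linarith
  rw [hockeyStick] at h1
  rw [hockeyStick_swap] at h2
  replace h1 := (integral_eq_zero_iff_of_nonneg
    (f := fun x => max ((densities P Q x).1 - Real.exp a * (densities P Q x).2) 0)
    (fun _ => le_max_right _ _) (integrable_excess P Q a)).1 h1
  replace h2 := (integral_eq_zero_iff_of_nonneg
    (f := fun x => max ((densities P Q x).2 - Real.exp b * (densities P Q x).1) 0)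
    (fun _ => le_max_right _ _) (((integrable_snd P Q).sub
      ((integrable_fst P Q).const_mul _)).sup (integrable_zero _ _ _))).1 h2
  rw [integral_eq_zero_iff_of_nonneg (fun _ => sq_nonneg _)] at h5
  · refine eq_of_densities_ae_eq P Q ?_
    filter_upwards [h1, h2, h5] with x e1 e2 e5
    simp only [Pi.zero_apply] at e1 e2 e5
    rw [excess_eq] at e1
    rw [excess_eq'] at e2
    have e6 : √(truncP P Q a x) = √(truncQ P Q b x) :=
      sub_eq_zero.1 (pow_eq_zero_iff two_ne_zero |>.1 e5)
    rw [Real.sqrt_inj (truncP_nonneg P Q a x) (truncQ_nonneg P Q b x)] at e6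
    linarith
  · simp only [sq_sqrt_sub_sqrt (truncP_nonneg P Q a _) (truncQ_nonneg P Q b _)]
    exact ((integrable_truncP P Q a).add (integrable_truncQ P Q b)).sub
      ((integrable_affinity P Q a b).const_mul 2)

/-- The density ratio that underlies the scores. -/
def pointRatio (a b : ℝ) (x : X) : ℝ :=
  clampRatio (Real.exp a) (Real.exp b) (Real.exp (-b)) (densities P Q x)

theorem integral_inv_sqrt_pointRatio (ha : 0 ≤ a) (hb : 0 ≤ b) :
    ∫ x, (√(pointRatio P Q a b x))⁻¹ ∂P =
      affinity P Q a b + hockeyStick P Q a * Real.exp (-a / 2) := by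
  rw [integral_left P Q, affinity, hockeyStick, ← integral_mul_const, ← integral_add]
  · refine integral_congr_ae (Filter.Eventually.of_forall fun x => ?_)
    exact (clampRatio_identities (densities_nonneg P Q x).1 (densities_nonneg P Q x).2 ha hb).1
  · exact integrable_affinity P Q a b
  · exact (integrable_excess P Q a).mul_const _

theorem integral_sqrt_pointRatio (ha : 0 ≤ a) (hb : 0 ≤ b) :
    ∫ x, √(pointRatio P Q a b x) ∂Q =
      affinity P Q a b + hockeyStick Q P b * Real.exp (-b / 2) := by
  rw [integral_right P Q, affinity, hockeyStick_swap, ← integral_mul_const, ← integral_add]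
  · refine integral_congr_ae (Filter.Eventually.of_forall fun x => ?_)
    exact (clampRatio_identities (densities_nonneg P Q x).1 (densities_nonneg P Q x).2 ha hb).2
  · exact integrable_affinity P Q a b
  · exact (((integrable_snd P Q).sub ((integrable_fst P Q).const_mul _)).sup
      (integrable_zero _ _ _)).mul_const _

theorem measurable_clampRatio (A B B' : ℝ) : Measurable (clampRatio A B B') := by
  unfold clampRatio
  refine Measurable.ite (measurableSet_le (by fun_prop) (by fun_prop)) measurable_const ?_
  exact Measurable.ite (measurableSet_le (by fun_prop) (by fun_prop)) measurable_const
    (by fun_prop)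

theorem measurable_pointScore (l : ℝ) : Measurable (pointScore P Q a b l) := by
  unfold pointScore score
  have := (measurable_clampRatio (Real.exp a) (Real.exp b) (Real.exp (-b))).comp
    (measurable_densities P Q)
  exact (((Real.measurable_log.comp this).mul_const _).add_const _).exp

theorem sq_pointScore (ha : 0 ≤ a) (hb : 0 ≤ b) (l : ℝ) (x : X) :
    pointScore P Q a b l x ^ 2 = √(pointRatio P Q a b x) * Real.exp (2 * l) := by
  have hR : 0 < pointRatio P Q a b x := (Real.exp_pos _).trans_le
    (clampRatio_mem ha hb (densities_nonneg P Q x).1 (densities_nonneg P Q x).2).1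
  have : √(pointRatio P Q a b x) = Real.exp (Real.log (pointRatio P Q a b x) / 2) := by
    rw [Real.exp_half, Real.exp_log hR]
  rw [this, ← Real.exp_add, pointScore, score, ← Real.exp_nat_mul]
  congr 1
  unfold pointRatio
  push_cast
  ring

theorem integrable_of_bounded {μ : Measure X} [IsFiniteMeasure μ] {f : X → ℝ} (hf : Measurable f)
    {c : ℝ} (h0 : ∀ x, 0 ≤ f x) (hc : ∀ x, f x ≤ c) : Integrable f μ :=
  Integrable.of_bound hf.aestronglyMeasurable c
    (Filter.Eventually.of_forall fun x => by rw [Real.norm_of_nonneg (h0 x)]; exact hc x)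

/-- Jensen's inequality, from `2 r f ≤ f² + r²`. It passes from the explicit moments of `√R` to
those of the fourth root. -/
theorem lintegral_le_of_sq {μ : Measure X} [IsProbabilityMeasure μ] {f : X → ℝ}
    (hf : Measurable f) {c r : ℝ} (h0 : ∀ x, 0 ≤ f x) (hc : ∀ x, f x ≤ c) (hr : 0 < r)
    (h : ∫ x, f x ^ 2 ∂μ ≤ r ^ 2) : ∫⁻ x, ENNReal.ofReal (f x) ∂μ ≤ ENNReal.ofReal r := by
  have hi := integrable_of_bounded (μ := μ) hf h0 hc
  have hi2 : Integrable (fun x => f x ^ 2) μ :=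
    integrable_of_bounded (hf.pow_const 2) (fun x => sq_nonneg _)
      (c := c ^ 2) fun x => pow_le_pow_left₀ (h0 x) (hc x) 2
  rw [← ofReal_integral_eq_lintegral_ofReal hi (Filter.Eventually.of_forall h0)]
  refine ENNReal.ofReal_le_ofReal ?_
  have : ∫ x, 2 * r * f x ∂μ ≤ ∫ x, (f x ^ 2 + r ^ 2) ∂μ :=
    integral_mono (hi.const_mul _) (hi2.add (integrable_const _)) fun x => by
      dsimp only
      nlinarith [sq_nonneg (f x - r)]
  rw [integral_const_mul, integral_add hi2 (integrable_const _), integral_const, probReal_univ,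
    one_smul] at this
  nlinarith

theorem inv_pointScore_le (ha : 0 ≤ a) (hb : 0 ≤ b) (l : ℝ) (x : X) :
    (pointScore P Q a b l x)⁻¹ ≤ (Real.exp (-b * (1 / 4) + l))⁻¹ :=
  inv_anti₀ (Real.exp_pos _)
    (le_score ha hb (densities_nonneg P Q x).1 (densities_nonneg P Q x).2)

/-- The scores can be normalized such that their expectation under `Q`, and the expectation of their
reciprocals under `P`, are both bounded away from `1`. -/
theorem exists_shift (hε : 0 ≤ ε) :
    ∃ l, ∫⁻ x, ENNReal.ofReal (pointScore P Q (clampLevel P Q ε) (clampLevel Q P ε) l x)⁻¹ ∂P ≤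
        ENNReal.ofReal (1 - rate P Q ε / 16) ∧
      ∫⁻ x, ENNReal.ofReal (pointScore P Q (clampLevel P Q ε) (clampLevel Q P ε) l x) ∂Q ≤
        ENNReal.ofReal (1 - rate P Q ε / 16) := by
  obtain ⟨⟨ha, haε⟩, h1⟩ := clampLevel_spec P Q hε
  obtain ⟨⟨hb, hbε⟩, h2⟩ := clampLevel_spec Q P hε
  rw [tau_swap] at h2
  have hor := clampLevel_eq_or P Q hε
  have hA := one_sub_tau_mul_hellinger P Q hε
  have hP := integral_inv_sqrt_pointRatio P Q _ _ ha hb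
  have hQ := integral_sqrt_pointRatio P Q _ _ ha hb
  have hG := rate_le P Q hε
  have hA' := le_affinity P Q _ (clampLevel Q P ε) haε hb hε
  have hr2 := rate_le_two P Q hε
  have hr0 := rate_nonneg P Q hε
  have hτ0 := tau_nonneg P Q ε
  have hτ1 := tau_le_one P Q ε
  have hH := hellinger_nonneg P Q ε
  rw [h1] at hP hA'
  rw [h2] at hQ
  generalize clampLevel P Q ε = a at *
  generalize clampLevel Q P ε = b at *
  generalize affinity P Q a b = A at *
  generalize tau P Q ε = τ at *
  generalize hellingerSqClamped P Q ε = H at *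
  generalize rate P Q ε = γ at *
  have hA0 : A ≤ 1 - τ := by nlinarith
  have ea := Real.exp_pos (-a / 2)
  have eb := Real.exp_pos (-b / 2)
  have ea1 : Real.exp (-a / 2) ≤ 1 := Real.exp_le_one_iff.2 (by linarith)
  have eb1 : Real.exp (-b / 2) ≤ 1 := Real.exp_le_one_iff.2 (by linarith)
  -- For `τ = 0` the positivity comes from the affinity, which is then at least `e^(-ε/2)`. It is
  -- needed for the logarithm in the definition of the shift.
  have hpos : ∀ z, 0 < Real.exp z → 0 < A + τ * Real.exp z := by
    intro z hz
    rcases hτ0.eq_or_lt with h | h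
    · rw [← h] at hA' ⊢
      have := Real.exp_pos (-ε / 2)
      nlinarith
    · have : 0 ≤ A := le_trans (mul_nonneg (Real.exp_pos _).le (by linarith)) hA'
      have := mul_pos h hz
      linarith
  have hp0 := hpos _ ea
  have hq0 := hpos _ eb
  have hp1 : A + τ * Real.exp (-a / 2) ≤ 1 := by nlinarith
  have hq1 : A + τ * Real.exp (-b / 2) ≤ 1 := by nlinarith
  set r := 1 - γ / 16 with hr
  have hrpos : 0 < r := by linarith
  -- The factor with level `ε` is at most `1 - γ/4`, the other at most `1`, and `1 - γ/4 ≤ (1 -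
  -- γ/16)^4`.
  have hprod : (A + τ * Real.exp (-a / 2)) * (A + τ * Real.exp (-b / 2)) ≤ r ^ 4 := by
    have h4 : 1 - γ / 4 ≤ r ^ 4 := by
      have : r ^ 4 = (r ^ 2) ^ 2 := by ring
      nlinarith [sq_nonneg (γ / 16), sq_nonneg (r ^ 2 - 1)]
    refine le_trans ?_ h4
    rcases hor with h | h
    · have : A + τ * Real.exp (-a / 2) ≤ 1 - γ / 4 := by rw [h]; nlinarith
      exact (mul_le_of_le_one_right hp0.le hq1).trans this
    · have : A + τ * Real.exp (-b / 2) ≤ 1 - γ / 4 := by rw [h]; nlinarith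
      exact (mul_le_of_le_one_left hq0.le hp1).trans this
  -- This shift makes the second moment of the inverse score under P equal to `r ^ 2`; then `hprod`
  -- bounds that of the score under Q by `r ^ 4 / r ^ 2`.
  refine ⟨Real.log ((A + τ * Real.exp (-a / 2)) / r ^ 2) / 2, ?_, ?_⟩
  all_goals
    set l := Real.log ((A + τ * Real.exp (-a / 2)) / r ^ 2) / 2 with hl
    have hel : Real.exp (2 * l) = (A + τ * Real.exp (-a / 2)) / r ^ 2 := by
      rw [hl, mul_div_cancel₀ _ two_ne_zero, Real.exp_log (by positivity)]
  · refine lintegral_le_of_sq (f := fun x => (pointScore P Q a b l x)⁻¹)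
      (measurable_pointScore P Q a b l).inv
      (fun x => (inv_pos.2 (pointScore_pos P Q x)).le) (inv_pointScore_le P Q a b ha hb l) hrpos ?_
    simp only [inv_pow, sq_pointScore P Q a b ha hb, mul_inv]
    rw [integral_mul_const, hP, hel, inv_div, mul_div_cancel₀ _ hp0.ne']
  · refine lintegral_le_of_sq (measurable_pointScore P Q a b l)
      (fun x => (pointScore_pos P Q x).le) (pointScore_le P Q ha hb) hrpos ?_
    simp only [sq_pointScore P Q a b ha hb]
    rw [integral_mul_const, hQ, hel, ← mul_div_assoc, div_le_iff₀ (by positivity), mul_comm]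
    calc _ ≤ r ^ 4 := hprod
      _ = r ^ 2 * r ^ 2 := by ring

end Levels

end

end ChangePoint

namespace ChangePoint
noncomputable section

set_option linter.unusedSectionVars false

/-! ### The sample complexity of private testing -/

section ProductMeasures

variable {X : Type*} [MeasurableSpace X]

theorem measurable_cons {n : ℕ} :
    Measurable fun z : X × (Fin n → X) => (Fin.cons z.1 z.2 : Fin (n + 1) → X) := by
  refine measurable_pi_lambda _ fun i => ?_
  refine Fin.cases ?_ (fun j => ?_) i
  · exact measurable_fst
  · exact (measurable_pi_apply j).comp measurable_snd

theorem lintegral_pi_succ (P : Measure X) [IsFiniteMeasure P] {n : ℕ}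
    {g : (Fin (n + 1) → X) → ENNReal} (hg : Measurable g) :
    ∫⁻ x, g x ∂(Measure.pi fun _ : Fin (n + 1) => P) =
      ∫⁻ x, ∫⁻ u, g (Fin.cons u x) ∂P ∂(Measure.pi fun _ : Fin n => P) := by
  have h := (measurePreserving_piFinSuccAbove (fun _ : Fin (n + 1) => P) 0).symm
  rw [← h.lintegral_comp hg, lintegral_prod_symm]
  · refine lintegral_congr fun x => lintegral_congr fun u => congrArg g ?_
    exact Fin.insertNth_zero' u x
  · exact (hg.comp (MeasurableEquiv.measurable _)).aemeasurable

theorem lintegral_pi_zero (P : Measure X) (g : (Fin 0 → X) → ENNReal) :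
    ∫⁻ x, g x ∂(Measure.pi fun _ : Fin 0 => P) = g default := by
  rw [Measure.pi_of_empty _ default, lintegral_dirac]

theorem measurable_lintegral_cons (P : Measure X) [IsFiniteMeasure P] {n : ℕ}
    {g : (Fin (n + 1) → X) → ENNReal} (hg : Measurable g) :
    Measurable fun x : Fin n → X => ∫⁻ u, g (Fin.cons u x) ∂P :=
  Measurable.lintegral_prod_left' (hg.comp measurable_cons)

/-- Replacing the samples one by one changes the expectation of a stable function only
slightly. -/
theorem lintegral_pi_le_add {P G : Measure X} [IsProbabilityMeasure P] [IsProbabilityMeasure G]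
    {δ t : ENNReal}
    (hPG : ∀ f : X → ENNReal, Measurable f → (∀ u u', f u ≤ f u' + δ) →
      ∫⁻ u, f u ∂P ≤ ∫⁻ u, f u ∂G + t)
    (n : ℕ) {g : (Fin n → X) → ENNReal} (hg : Measurable g)
    (hgδ : ∀ x x', Neighbors x x' → g x ≤ g x' + δ) :
    ∫⁻ x, g x ∂(Measure.pi fun _ => P) ≤ ∫⁻ x, g x ∂(Measure.pi fun _ => G) + n * t := by
  induction n with
  | zero => rw [lintegral_pi_zero, lintegral_pi_zero]; simp
  | succ n ih =>
    rw [lintegral_pi_succ P hg, lintegral_pi_succ G hg]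
    -- The hypothesis of induction is applied to the average over the first coordinate, which is
    -- again stable; the first coordinate is replaced afterwards.
    refine (ih (measurable_lintegral_cons P hg) fun x x' hx => ?_).trans ?_
    · have : ∫⁻ u, (g (Fin.cons u x') + δ) ∂P = ∫⁻ u, g (Fin.cons u x') ∂P + δ := by
        rw [lintegral_add_right _ measurable_const]
        simp
      rw [← this]
      refine lintegral_mono fun u => hgδ _ _ ?_
      obtain ⟨i, hi⟩ := hx
      refine ⟨i.succ, fun j hj => ?_⟩
      refine Fin.cases (fun _ => rfl) (fun j hj => ?_) j hj
      exact hi j fun e => hj (e ▸ rfl)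
    · have h1 : ∫⁻ x, ∫⁻ u, g (Fin.cons u x) ∂P ∂(Measure.pi fun _ : Fin n => G) ≤
          ∫⁻ x, (∫⁻ u, g (Fin.cons u x) ∂G + t) ∂(Measure.pi fun _ : Fin n => G) := by
        refine lintegral_mono fun x => hPG _ (hg.comp (measurable_cons.comp
          measurable_prodMk_right)) fun u u' => hgδ _ _ ⟨0, fun j hj => ?_⟩
        exact Fin.cases (fun h => absurd rfl h) (fun j _ => rfl) j hj
      rw [lintegral_add_right _ measurable_const, lintegral_const, measure_univ, mul_one] at h1
      refine (add_le_add h1 le_rfl).trans (le_of_eq ?_)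
      push_cast
      ring

/-- The Cauchy-Schwarz inequality between the affinity measure `ν` of `G` and `Q`, and `G` and `Q`
themselves, carries over to product measures. -/
theorem lintegral_pi_sqrt_le {G Q ν : Measure X} [IsFiniteMeasure G] [IsFiniteMeasure Q]
    [IsFiniteMeasure ν]
    (h : ∀ f₁ f₂ : X → ENNReal, Measurable f₁ → Measurable f₂ →
      ∫⁻ u, f₁ u ^ (1 / 2 : ℝ) * f₂ u ^ (1 / 2 : ℝ) ∂ν ≤
        (∫⁻ u, f₁ u ∂G) ^ (1 / 2 : ℝ) * (∫⁻ u, f₂ u ∂Q) ^ (1 / 2 : ℝ))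
    (n : ℕ) {f₁ f₂ : (Fin n → X) → ENNReal} (h₁ : Measurable f₁) (h₂ : Measurable f₂) :
    ∫⁻ x, f₁ x ^ (1 / 2 : ℝ) * f₂ x ^ (1 / 2 : ℝ) ∂(Measure.pi fun _ => ν) ≤
      (∫⁻ x, f₁ x ∂(Measure.pi fun _ => G)) ^ (1 / 2 : ℝ) *
        (∫⁻ x, f₂ x ∂(Measure.pi fun _ => Q)) ^ (1 / 2 : ℝ) := by
  induction n with
  | zero => rw [lintegral_pi_zero, lintegral_pi_zero, lintegral_pi_zero]
  | succ n ih =>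
    rw [lintegral_pi_succ G h₁, lintegral_pi_succ Q h₂, lintegral_pi_succ ν (by fun_prop)]
    refine le_trans (lintegral_mono fun x => ?_)
      (ih (measurable_lintegral_cons G h₁) (measurable_lintegral_cons Q h₂))
    exact h _ _ (h₁.comp (measurable_cons.comp measurable_prodMk_right))
      (h₂.comp (measurable_cons.comp measurable_prodMk_right))

end ProductMeasures

/-! ### The hybrid distribution and the lower bound for private tests -/

section LowerBound

variable {X : Type*} [MeasurableSpace X] (P Q : Measure X) [IsProbabilityMeasure P]
  [IsProbabilityMeasure Q] {ε : ℝ} (a b : ℝ)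

/-- The density of the distribution that agrees with `P` except for the excess of `P` over `Q`,
which is replaced by the excess of `Q` over `P`. -/
def hybridDensity (x : X) : ℝ := truncP P Q a x + ((densities P Q x).2 - truncQ P Q b x)

/-- The distribution with density `hybridDensity`. -/
def hybrid : Measure X := (P + Q).withDensity fun x => ENNReal.ofReal (hybridDensity P Q a b x)

theorem truncQ_le (x : X) : truncQ P Q b x ≤ (densities P Q x).2 := min_le_left _ _

theorem truncP_le (x : X) : truncP P Q a x ≤ (densities P Q x).1 := min_le_left _ _

theorem hybridDensity_nonneg (x : X) : 0 ≤ hybridDensity P Q a b x :=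
  add_nonneg (truncP_nonneg P Q a x) (sub_nonneg.2 (truncQ_le P Q b x))

theorem measurable_fst_densities : Measurable fun x => (densities P Q x).1 :=
  (measurable_densities P Q).fst

theorem measurable_snd_densities : Measurable fun x => (densities P Q x).2 :=
  (measurable_densities P Q).snd

theorem measurable_truncP : Measurable (truncP P Q a) :=
  (measurable_fst_densities P Q).min ((measurable_snd_densities P Q).const_mul _)

theorem measurable_truncQ : Measurable (truncQ P Q b) :=
  (measurable_snd_densities P Q).min ((measurable_fst_densities P Q).const_mul _)

theorem measurable_hybridDensity : Measurable (hybridDensity P Q a b) :=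
  (measurable_truncP P Q a).add ((measurable_snd_densities P Q).sub (measurable_truncQ P Q b))

theorem integrable_hybridDensity : Integrable (hybridDensity P Q a b) (P + Q) :=
  (integrable_truncP P Q a).add ((integrable_snd P Q).sub (integrable_truncQ P Q b))

theorem integrable_sub_truncP :
    Integrable (fun x => (densities P Q x).1 - truncP P Q a x) (P + Q) :=
  (integrable_fst P Q).sub (integrable_truncP P Q a)

theorem integrable_sub_truncQ :
    Integrable (fun x => (densities P Q x).2 - truncQ P Q b x) (P + Q) :=
  (integrable_snd P Q).sub (integrable_truncQ P Q b)

theorem isProbabilityMeasure_hybrid {t : ℝ} (hP : hockeyStick P Q a = t)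
    (hQ : hockeyStick Q P b = t) : IsProbabilityMeasure (hybrid P Q a b) := by
  constructor
  rw [hybrid, withDensity_apply _ MeasurableSet.univ, Measure.restrict_univ,
    ← ofReal_integral_eq_lintegral_ofReal (integrable_hybridDensity P Q a b)
      (Filter.Eventually.of_forall (hybridDensity_nonneg P Q a b))]
  simp only [hybridDensity]
  rw [integral_add (integrable_truncP P Q a)
    (integrable_sub_truncQ P Q b), integral_sub (integrable_snd P Q)
    (integrable_truncQ P Q b), integral_truncP, integral_truncQ, integral_snd, hP, hQ]
  simp

theorem lintegral_right {f : X → ENNReal} (hf : Measurable f) :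
    ∫⁻ x, f x ∂Q = ∫⁻ x, ENNReal.ofReal (densities P Q x).2 * f x ∂(P + Q) := by
  rw [← lintegral_rnDeriv_mul (absolutelyContinuous_add_right P Q) hf.aemeasurable]
  refine lintegral_congr_ae ?_
  filter_upwards [Measure.rnDeriv_lt_top Q (P + Q)] with x hx
  rw [densities, ENNReal.ofReal_toReal hx.ne]

theorem lintegral_left {f : X → ENNReal} (hf : Measurable f) :
    ∫⁻ x, f x ∂P = ∫⁻ x, ENNReal.ofReal (densities P Q x).1 * f x ∂(P + Q) := by
  rw [← lintegral_rnDeriv_mul (absolutelyContinuous_add_left P Q) hf.aemeasurable]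
  refine lintegral_congr_ae ?_
  filter_upwards [Measure.rnDeriv_lt_top P (P + Q)] with x hx
  rw [densities, ENNReal.ofReal_toReal hx.ne]

theorem lintegral_hybrid {f : X → ENNReal} (hf : Measurable f) :
    ∫⁻ x, f x ∂(hybrid P Q a b) =
      ∫⁻ x, ENNReal.ofReal (hybridDensity P Q a b x) * f x ∂(P + Q) := by
  rw [hybrid, lintegral_withDensity_eq_lintegral_mul _
    (measurable_hybridDensity P Q a b).ennreal_ofReal hf]
  rfl

/-- The two distributions share the truncated part of P and differ in a remaining mass `t`. Moving
this mass costs at most the oscillation `δ` of `f` per unit. -/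
theorem lintegral_left_le_hybrid {t : ℝ} (hP : hockeyStick P Q a = t)
    (hQ : hockeyStick Q P b = t) {δ : ENNReal} {f : X → ENNReal} (hf : Measurable f)
    (hδ : ∀ u u', f u ≤ f u' + δ) :
    ∫⁻ x, f x ∂P ≤ ∫⁻ x, f x ∂(hybrid P Q a b) + ENNReal.ofReal t * δ := by
  set m := ⨅ u, f u with hm
  have hle : ∀ u, f u ≤ m + δ := fun u => by
    rw [hm, ENNReal.iInf_add]
    exact le_iInf fun u' => hδ u u'
  have hge : ∀ u, m ≤ f u := fun u => iInf_le _ u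
  have mP := measurable_truncP P Q a
  have mQ := measurable_truncQ P Q b
  have m1 := measurable_fst_densities P Q
  have m2 := measurable_snd_densities P Q
  have e1 : ∫⁻ x, ENNReal.ofReal ((densities P Q x).1 - truncP P Q a x) ∂(P + Q) =
      ENNReal.ofReal t := by
    rw [← ofReal_integral_eq_lintegral_ofReal (integrable_sub_truncP P Q a)
      (Filter.Eventually.of_forall fun x => sub_nonneg.2 (truncP_le P Q a x)),
      integral_sub (integrable_fst P Q) (integrable_truncP P Q a), integral_fst,
      integral_truncP, hP]
    congr 1; ring
  have e2 : ∫⁻ x, ENNReal.ofReal ((densities P Q x).2 - truncQ P Q b x) ∂(P + Q) =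
      ENNReal.ofReal t := by
    rw [← ofReal_integral_eq_lintegral_ofReal (integrable_sub_truncQ P Q b)
      (Filter.Eventually.of_forall fun x => sub_nonneg.2 (truncQ_le P Q b x)),
      integral_sub (integrable_snd P Q) (integrable_truncQ P Q b), integral_snd,
      integral_truncQ, hQ]
    congr 1; ring
  have h1 : ∫⁻ x, f x ∂P = ∫⁻ x, ENNReal.ofReal (truncP P Q a x) * f x ∂(P + Q) +
      ∫⁻ x, ENNReal.ofReal ((densities P Q x).1 - truncP P Q a x) * f x ∂(P + Q) := by
    rw [lintegral_left P Q hf, ← lintegral_add_left (by fun_prop)]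
    refine lintegral_congr fun x => ?_
    rw [← add_mul, ← ENNReal.ofReal_add (truncP_nonneg P Q a x)
      (sub_nonneg.2 (truncP_le P Q a x)), add_sub_cancel]
  have h2 : ∫⁻ x, f x ∂(hybrid P Q a b) =
      ∫⁻ x, ENNReal.ofReal (truncP P Q a x) * f x ∂(P + Q) +
      ∫⁻ x, ENNReal.ofReal ((densities P Q x).2 - truncQ P Q b x) * f x ∂(P + Q) := by
    rw [lintegral_hybrid P Q a b hf, ← lintegral_add_left (by fun_prop)]
    refine lintegral_congr fun x => ?_
    rw [← add_mul, ← ENNReal.ofReal_add (truncP_nonneg P Q a x)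
      (sub_nonneg.2 (truncQ_le P Q b x)), hybridDensity]
  rw [h1, h2, add_assoc]
  refine add_le_add le_rfl ?_
  calc ∫⁻ x, ENNReal.ofReal ((densities P Q x).1 - truncP P Q a x) * f x ∂(P + Q)
      ≤ ∫⁻ x, ENNReal.ofReal ((densities P Q x).1 - truncP P Q a x) * (m + δ) ∂(P + Q) :=
        lintegral_mono fun x => mul_le_mul_right (hle x) _
    _ = ENNReal.ofReal t * m + ENNReal.ofReal t * δ := by
        rw [lintegral_mul_const _ (by fun_prop), e1, mul_add]
    _ = ∫⁻ x, ENNReal.ofReal ((densities P Q x).2 - truncQ P Q b x) * m ∂(P + Q) +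
          ENNReal.ofReal t * δ := by
        rw [lintegral_mul_const _ (by fun_prop), e2]
    _ ≤ _ := add_le_add (lintegral_mono fun x => mul_le_mul_right (hge x) _) le_rfl

/-- The measure with density the geometric mean of the densities of `hybrid` and `Q`. -/
def affinityMeasure : Measure X := (P + Q).withDensity fun x =>
  ENNReal.ofReal (hybridDensity P Q a b x) ^ (1 / 2 : ℝ) *
    ENNReal.ofReal (densities P Q x).2 ^ (1 / 2 : ℝ)

theorem affinityMeasure_univ : affinityMeasure P Q a b Set.univ =
    ENNReal.ofReal (∫ x, √(hybridDensity P Q a b x * (densities P Q x).2) ∂(P + Q)) := by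
  rw [ofReal_integral_eq_lintegral_ofReal (integrable_sqrt_mul
    (integrable_hybridDensity P Q a b) (integrable_snd P Q) (hybridDensity_nonneg P Q a b)
    fun x => (densities_nonneg P Q x).2)
    (Filter.Eventually.of_forall fun x => Real.sqrt_nonneg _),
    affinityMeasure, withDensity_apply _ MeasurableSet.univ, Measure.restrict_univ]
  refine lintegral_congr fun x => ?_
  rw [← ENNReal.mul_rpow_of_nonneg _ _ (by norm_num), ← ENNReal.ofReal_mul
    (hybridDensity_nonneg P Q a b x), ENNReal.ofReal_rpow_of_nonneg (mul_nonneg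
    (hybridDensity_nonneg P Q a b x) (densities_nonneg P Q x).2) (by norm_num),
    Real.sqrt_eq_rpow]

/-- Pointwise this is `√(u v) + w ≤ √((u + w)(v + w))`, where `w` is the excess of Q, which the
hybrid and Q have in common. -/
theorem affinity_add_le {t : ℝ} (hQ : hockeyStick Q P b = t) :
    affinity P Q a b + t ≤
      ∫ x, √(hybridDensity P Q a b x * (densities P Q x).2) ∂(P + Q) := by
  have e : ∫ x, ((densities P Q x).2 - truncQ P Q b x) ∂(P + Q) = t := by
    rw [integral_sub (integrable_snd P Q) (integrable_truncQ P Q b), integral_snd,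
      integral_truncQ, hQ]
    ring
  rw [affinity, ← e, ← integral_add (integrable_affinity P Q a b)
    (integrable_sub_truncQ P Q b)]
  refine integral_mono ((integrable_affinity P Q a b).add
    (integrable_sub_truncQ P Q b)) (integrable_sqrt_mul
    (integrable_hybridDensity P Q a b) (integrable_snd P Q) (hybridDensity_nonneg P Q a b)
    fun x => (densities_nonneg P Q x).2) fun x => ?_
  have h1 := truncP_nonneg P Q a x
  have h2 := truncQ_nonneg P Q b x
  have h3 := sub_nonneg.2 (truncQ_le P Q b x)
  simp only [hybridDensity]
  generalize truncP P Q a x = u at *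
  generalize truncQ P Q b x = v at *
  have h4 : (densities P Q x).2 = v + ((densities P Q x).2 - v) := by ring
  generalize (densities P Q x).2 - v = w at *
  rw [h4]
  refine Real.le_sqrt_of_sq_le ?_
  have h5 := Real.sqrt_nonneg (u * v)
  have h6 := Real.sq_sqrt (mul_nonneg h1 h2)
  have h7 : 2 * √(u * v) ≤ u + v := by
    have := sq_sqrt_sub_sqrt h1 h2
    nlinarith [sq_nonneg (√u - √v)]
  nlinarith

theorem lintegral_affinityMeasure_le (f₁ f₂ : X → ENNReal) (h₁ : Measurable f₁)
    (h₂ : Measurable f₂) :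
    ∫⁻ u, f₁ u ^ (1 / 2 : ℝ) * f₂ u ^ (1 / 2 : ℝ) ∂(affinityMeasure P Q a b) ≤
      (∫⁻ u, f₁ u ∂(hybrid P Q a b)) ^ (1 / 2 : ℝ) * (∫⁻ u, f₂ u ∂Q) ^ (1 / 2 : ℝ) := by
  have mH := measurable_hybridDensity P Q a b
  have m2 := measurable_snd_densities P Q
  rw [lintegral_hybrid P Q a b h₁, lintegral_right P Q h₂, affinityMeasure,
    lintegral_withDensity_eq_lintegral_mul _ (by fun_prop) (by fun_prop)]
  have hq : (2 : ℝ).HolderConjugate 2 := Real.HolderConjugate.two_two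
  have := ENNReal.lintegral_mul_le_Lp_mul_Lq (P + Q) hq
    (f := fun x => (ENNReal.ofReal (hybridDensity P Q a b x) * f₁ x) ^ (1 / 2 : ℝ))
    (g := fun x => (ENNReal.ofReal (densities P Q x).2 * f₂ x) ^ (1 / 2 : ℝ))
    (by fun_prop) (by fun_prop)
  simp only [← ENNReal.rpow_mul] at this
  norm_num at this
  refine le_trans (le_of_eq (lintegral_congr fun x => ?_)) (by norm_num; exact this)
  simp only [Pi.mul_apply]
  rw [ENNReal.mul_rpow_of_nonneg _ _ (by norm_num), ENNReal.mul_rpow_of_nonneg _ _ (by norm_num)]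
  norm_num
  ring

theorem Test.integrable_g (K : Test X) (n : ℕ) (μ : Measure (Fin n → X)) [IsFiniteMeasure μ] :
    Integrable (K.g n) μ :=
  Integrable.of_bound (K.measurable_g n).aestronglyMeasurable 1
    (Filter.Eventually.of_forall fun x => by
      rw [Real.norm_of_nonneg (K.mem_Icc n x).1]; exact (K.mem_Icc n x).2)

/-- Multiplicative stability of a probability implies additive stability, because `1 - ε ≤ e^(-ε)`.
-/
theorem Test.IsPrivate.le_add {K : Test X} (hK : K.IsPrivate ε) (hε : 0 ≤ ε) {n : ℕ}
    {x x' : Fin n → X} (h : Neighbors x x') : K.g n x ≤ K.g n x' + min ε 1 := by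
  have h1 := (hK n x x' h).1
  have h0 := K.mem_Icc n x
  have h0' := K.mem_Icc n x'
  have h2 : Real.exp (-ε) * K.g n x ≤ K.g n x' := by
    rwa [Real.exp_neg, inv_mul_le_iff₀ (Real.exp_pos ε)]
  have h3 := Real.add_one_le_exp (-ε)
  have h4 := Real.exp_le_one_iff.2 (neg_nonpos.2 hε)
  rcases min_choice ε 1 with h | h <;> rw [h]
  · nlinarith [h0.1, h0.2]
  · linarith [h0.2, h0'.1]

/-- For two Bernoulli laws, the squares of total variation distance and affinity add up to at most
`1`. The cross term is handled by the inequality of arithmetic and geometric means for `u(1-u)` and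
`v(1-v)`. -/
theorem sq_sub_le_of_le_add_sqrt {u v c : ℝ} (hu : 0 ≤ u) (hv : 0 ≤ v) (hu1 : u ≤ 1) (hv1 : v ≤ 1)
    (hc : 0 ≤ c) (h : c ≤ √(u * v) + √((1 - u) * (1 - v))) : (u - v) ^ 2 ≤ 1 - c ^ 2 := by
  have hu' := sub_nonneg.2 hu1
  have hv' := sub_nonneg.2 hv1
  have h1 := Real.sq_sqrt (mul_nonneg hu hv)
  have h2 := Real.sq_sqrt (mul_nonneg hu' hv')
  have h3 : √(u * v) * √((1 - u) * (1 - v)) = √(u * (1 - u)) * √(v * (1 - v)) := by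
    rw [← Real.sqrt_mul (mul_nonneg hu hv), ← Real.sqrt_mul (mul_nonneg hu hu')]
    congr 1; ring
  have h4 := Real.sq_sqrt (mul_nonneg hu hu')
  have h5 := Real.sq_sqrt (mul_nonneg hv hv')
  have h6 := sq_nonneg (√(u * (1 - u)) - √(v * (1 - v)))
  have h7 : c ^ 2 ≤ (√(u * v) + √((1 - u) * (1 - v))) ^ 2 := pow_le_pow_left₀ hc h 2
  nlinarith

theorem lintegral_affinity_pow_le {N : ℕ} {t : ℝ} (hP : hockeyStick P Q a = t)
    (hQ : hockeyStick Q P b = t) {g : (Fin N → X) → ℝ} (hg : Measurable g)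
    (hg0 : ∀ x, 0 ≤ g x) (hg1 : ∀ x, g x ≤ 1) :
    ∫⁻ x, ENNReal.ofReal (g x) ∂(Measure.pi fun _ => affinityMeasure P Q a b) ≤
      ENNReal.ofReal √((∫ x, g x ∂(Measure.pi fun _ => hybrid P Q a b)) *
        ∫ x, g x ∂(Measure.pi fun _ => Q)) := by
  have := isProbabilityMeasure_hybrid P Q a b hP hQ
  have : IsFiniteMeasure (affinityMeasure P Q a b) :=
    ⟨by rw [affinityMeasure_univ]; exact ENNReal.ofReal_lt_top⟩
  have hi : ∀ μ : Measure (Fin N → X), IsFiniteMeasure μ → Integrable g μ := fun μ _ =>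
    Integrable.of_bound hg.aestronglyMeasurable 1 (Filter.Eventually.of_forall fun x => by
      rw [Real.norm_of_nonneg (hg0 x)]; exact hg1 x)
  have h := lintegral_pi_sqrt_le (lintegral_affinityMeasure_le P Q a b) N hg.ennreal_ofReal
    hg.ennreal_ofReal
  have e : ∀ z : ENNReal, z ^ (1 / 2 : ℝ) * z ^ (1 / 2 : ℝ) = z := fun z => by
    rw [← ENNReal.rpow_add_of_nonneg _ _ (by norm_num) (by norm_num)]
    norm_num
  simp only [e] at h
  refine h.trans (le_of_eq ?_)
  rw [← ofReal_integral_eq_lintegral_ofReal (hi _ inferInstance)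
    (Filter.Eventually.of_forall hg0), ← ofReal_integral_eq_lintegral_ofReal
    (hi _ inferInstance) (Filter.Eventually.of_forall hg0),
    ← ENNReal.mul_rpow_of_nonneg _ _ (by norm_num),
    ← ENNReal.ofReal_mul (integral_nonneg hg0), ENNReal.ofReal_rpow_of_nonneg
    (mul_nonneg (integral_nonneg hg0) (integral_nonneg hg0)) (by norm_num), Real.sqrt_eq_rpow]

/-- Lower bound for the number of samples that a private test needs. -/
theorem le_mul_rate_of_test (hε : 0 ≤ ε) {K : Test X} (hK : K.IsPrivate ε) {N : ℕ}
    (h : 2 / 3 ≤ K.advantage P Q N) : 1 / 8 ≤ N * rate P Q ε := by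
  obtain ⟨⟨ha, haε⟩, h1⟩ := clampLevel_spec P Q hε
  obtain ⟨⟨hb, hbε⟩, h2⟩ := clampLevel_spec Q P hε
  rw [tau_swap] at h2
  have hH := one_sub_tau_mul_hellinger P Q hε
  set a := clampLevel P Q ε
  set b := clampLevel Q P ε
  set τ := tau P Q ε with hτ
  have hτ0 : 0 ≤ τ := tau_nonneg P Q ε
  have hτ1 : τ ≤ 1 := tau_le_one P Q ε
  have hH0 := hellinger_nonneg P Q ε
  set δ := min ε 1 with hδ
  have hδ0 : 0 ≤ δ := le_min hε zero_le_one
  have hG := isProbabilityMeasure_hybrid P Q a b h1 h2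
  have hν : IsFiniteMeasure (affinityMeasure P Q a b) :=
    ⟨by rw [affinityMeasure_univ]; exact ENNReal.ofReal_lt_top⟩
  have hg0 := fun x => (K.mem_Icc N x).1
  have hg1 := fun x => (K.mem_Icc N x).2
  set w := ∫ x, K.g N x ∂(Measure.pi fun _ : Fin N => P) with hw
  set v := ∫ x, K.g N x ∂(Measure.pi fun _ : Fin N => Q) with hv
  set u := ∫ x, K.g N x ∂(Measure.pi fun _ : Fin N => hybrid P Q a b) with hu
  have hadv : 2 / 3 ≤ w - v := h
  have hu0 : 0 ≤ u := integral_nonneg hg0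
  have hv0 : 0 ≤ v := integral_nonneg hg0
  have hwu : w ≤ u + N * (τ * δ) := by
    have := lintegral_pi_le_add (P := P) (G := hybrid P Q a b) (δ := ENNReal.ofReal δ)
      (fun f hf hfδ => lintegral_left_le_hybrid P Q a b h1 h2 hf hfδ) N
      (K.measurable_g N).ennreal_ofReal (fun x x' hx => by
        rw [← ENNReal.ofReal_add (hg0 x') hδ0]
        exact ENNReal.ofReal_le_ofReal (hK.le_add hε hx))
    rw [← ofReal_integral_eq_lintegral_ofReal (K.integrable_g N _)
      (Filter.Eventually.of_forall hg0), ← ofReal_integral_eq_lintegral_ofReal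
      (K.integrable_g N _) (Filter.Eventually.of_forall hg0), ← ENNReal.ofReal_mul hτ0,
      ← ENNReal.ofReal_natCast, ← ENNReal.ofReal_mul (Nat.cast_nonneg N),
      ← ENNReal.ofReal_add hu0 (by positivity)] at this
    exact (ENNReal.ofReal_le_ofReal_iff (by positivity)).1 this
  have hcomp : ∀ μ : Measure (Fin N → X), IsProbabilityMeasure μ →
      ∫ x, (1 - K.g N x) ∂μ = 1 - ∫ x, K.g N x ∂μ := fun μ _ => by
    rw [integral_sub (integrable_const _) (K.integrable_g N μ)]
    simp
  have hle1 : ∀ μ : Measure (Fin N → X), IsProbabilityMeasure μ → ∫ x, K.g N x ∂μ ≤ 1 :=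
    fun μ hμ => by
      have := hcomp μ hμ
      have h0 : 0 ≤ ∫ x, (1 - K.g N x) ∂μ := integral_nonneg fun x => sub_nonneg.2 (hg1 x)
      linarith
  have hu1 : u ≤ 1 := hle1 _ inferInstance
  have hv1 : v ≤ 1 := hle1 _ inferInstance
  set c := ∫ x, √(hybridDensity P Q a b x * (densities P Q x).2) ∂(P + Q) with hc
  have hc0 : 0 ≤ c := integral_nonneg fun _ => Real.sqrt_nonneg _
  -- Cauchy-Schwarz is applied to the test and to its complement; the left sides add up to the total
  -- mass `c ^ N` of the product of affinity measures.
  have hcle : c ^ N ≤ √(u * v) + √((1 - u) * (1 - v)) := by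
    have e1 := lintegral_affinity_pow_le P Q a b h1 h2 (K.measurable_g N) hg0 hg1
    have e2 := lintegral_affinity_pow_le P Q a b h1 h2 ((K.measurable_g N).const_sub 1)
      (fun x => sub_nonneg.2 (hg1 x)) (fun x => sub_le_self _ (hg0 x))
    rw [hcomp _ inferInstance, hcomp _ inferInstance] at e2
    have e3 := add_le_add e1 e2
    rw [← lintegral_add_left (K.measurable_g N).ennreal_ofReal,
      ← ENNReal.ofReal_add (Real.sqrt_nonneg _) (Real.sqrt_nonneg _)] at e3
    have e4 : ∀ x, ENNReal.ofReal (K.g N x) + ENNReal.ofReal (1 - K.g N x) = 1 := fun x => by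
      rw [← ENNReal.ofReal_add (hg0 x) (sub_nonneg.2 (hg1 x)), add_sub_cancel,
        ENNReal.ofReal_one]
    simp only [e4] at e3
    rw [lintegral_one, Measure.pi_univ, Finset.prod_const, Finset.card_univ, Fintype.card_fin,
      affinityMeasure_univ, ← hc, ← ENNReal.ofReal_pow hc0] at e3
    exact (ENNReal.ofReal_le_ofReal_iff (by positivity)).1 e3
  have hsq := sq_sub_le_of_le_add_sqrt hu0 hv0 hu1 hv1 (pow_nonneg hc0 N) hcle
  -- The affinity plus `τ` is `1 - (1-τ) H²`.
  have hcH : 1 - hellingerSqClamped P Q ε ≤ c := by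
    have := affinity_add_le P Q a b h2
    nlinarith
  by_contra! hcon
  unfold rate at hcon
  have hN : (0 : ℝ) ≤ N := Nat.cast_nonneg N
  have hs0 : 0 ≤ N * (τ * δ) := by positivity
  have hh0 : 0 ≤ N * hellingerSqClamped P Q ε := by positivity
  have hsum : N * (τ * δ) + N * hellingerSqClamped P Q ε < 1 / 8 := by
    refine lt_of_eq_of_lt ?_ hcon
    ring
  have hbern : 1 - N * hellingerSqClamped P Q ε ≤ c ^ N := by
    have h3 : 1 - hellingerSqClamped P Q ε ≤ c := hcH
    have := one_add_mul_le_pow (a := c - 1) (by linarith) N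
    rw [add_sub_cancel] at this
    nlinarith
  generalize N * (τ * δ) = s at *
  generalize N * hellingerSqClamped P Q ε = h' at *
  have h4 : (1 - h') ^ 2 ≤ (c ^ N) ^ 2 := pow_le_pow_left₀ (by linarith) hbern 2
  have h5 : 2 / 3 - s ≤ u - v := by linarith
  have h6 : (2 / 3 - s) ^ 2 ≤ (u - v) ^ 2 := pow_le_pow_left₀ (by linarith) h5 2
  -- From `s + h' < 1/8` follows `(2/3 - s)² > 1/4`, while `1 - (1 - h')² ≤ 2 h' < 1/4`.
  nlinarith

/-- The private test that answers "`P`" with probability `V / (1 + V)`, where `V` is the product of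
the scores. -/
def scoreTest (l : ℝ) : Test X where
  g n x := 1 - 1 / (1 + ∏ i, pointScore P Q a b l (x i))
  measurable_g n := by
    have := measurable_pointScore P Q a b l
    fun_prop
  mem_Icc n x := by
    have : 0 < ∏ i, pointScore P Q a b l (x i) :=
      Finset.prod_pos fun i _ => pointScore_pos P Q _
    refine ⟨sub_nonneg.2 ?_, sub_le_self _ (by positivity)⟩
    rw [div_le_one (by positivity)]
    linarith

theorem isPrivate_scoreTest (ha : 0 ≤ a) (hb : 0 ≤ b) (haε : a ≤ ε) (hbε : b ≤ ε) (l : ℝ) :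
    (scoreTest P Q a b l).IsPrivate ε := by
  rintro n x x' ⟨i, hi⟩
  have hp : ∀ x : Fin n → X, 0 < ∏ i, pointScore P Q a b l (x i) := fun x =>
    Finset.prod_pos fun i _ => pointScore_pos P Q _
  have hε : 0 ≤ ε := ha.trans haε
  have hc : (1 : ℝ) ≤ Real.exp (ε / 2) := Real.one_le_exp (by linarith)
  have hle : ∀ x x' : Fin n → X, (∀ j, j ≠ i → x j = x' j) →
      ∏ i, pointScore P Q a b l (x i) ≤ Real.exp (ε / 2) * ∏ i, pointScore P Q a b l (x' i) :=
    fun x x' h => prod_le_mul_prod (y := fun i => pointScore P Q a b l (x i))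
      (fun i => pointScore_pos P Q (x' i)) hc (fun j hj => by rw [h j hj])
      (pointScore_le_mul P Q ha hb haε hbε _ _) _
  have key := inv_one_add_le (hp x) (hp x') hc (hle x x' hi) (hle x' x fun j hj => (hi j hj).symm)
  have hexp : Real.exp (ε / 2) ≤ Real.exp ε := Real.exp_le_exp.2 (by linarith)
  have h1 := (scoreTest P Q a b l).mem_Icc n x'
  simp only [scoreTest, sub_sub_cancel] at h1 ⊢
  exact ⟨key.2.trans (mul_le_mul_of_nonneg_right hexp h1.1),
    key.1.trans (mul_le_mul_of_nonneg_right hexp (by linarith [h1.2]))⟩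

/-- The error under P is `1/(1+V) ≤ 1/V`, the error under Q is `V/(1+V) ≤ V`, and the means of `1/V`
and `V` factorize over the samples. -/
theorem one_sub_le_advantage (ha : 0 ≤ a) (hb : 0 ≤ b) {l r : ℝ} (hr : 0 ≤ r)
    (hP : ∫⁻ x, ENNReal.ofReal (pointScore P Q a b l x)⁻¹ ∂P ≤ ENNReal.ofReal r)
    (hQ : ∫⁻ x, ENNReal.ofReal (pointScore P Q a b l x) ∂Q ≤ ENNReal.ofReal r) (n : ℕ) :
    1 - 2 * r ^ n ≤ (scoreTest P Q a b l).advantage P Q n := by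
  have hm := measurable_pointScore P Q a b l
  have h0 : ∀ x, 0 < pointScore P Q a b l x := pointScore_pos P Q
  have iP : Integrable (fun x => (pointScore P Q a b l x)⁻¹) P := integrable_of_bounded hm.inv
    (fun x => (inv_pos.2 (h0 x)).le) (inv_pointScore_le P Q a b ha hb l)
  have iQ : Integrable (fun x => pointScore P Q a b l x) Q := integrable_of_bounded hm
    (fun x => (h0 x).le) (pointScore_le P Q ha hb)
  rw [← ofReal_integral_eq_lintegral_ofReal iP (Filter.Eventually.of_forall fun x =>
    (inv_pos.2 (h0 x)).le), ENNReal.ofReal_le_ofReal_iff hr] at hP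
  rw [← ofReal_integral_eq_lintegral_ofReal iQ (Filter.Eventually.of_forall fun x =>
    (h0 x).le), ENNReal.ofReal_le_ofReal_iff hr] at hQ
  have hp : ∀ x : Fin n → X, 0 < ∏ i, pointScore P Q a b l (x i) := fun x =>
    Finset.prod_pos fun i _ => h0 _
  have eP : 1 - r ^ n ≤ ∫ x, (scoreTest P Q a b l).g n x ∂(Measure.pi fun _ : Fin n => P) := by
    have h1 : ∫ x, (1 - ∏ i, (pointScore P Q a b l (x i))⁻¹) ∂(Measure.pi fun _ : Fin n => P) ≤
        ∫ x, (scoreTest P Q a b l).g n x ∂(Measure.pi fun _ : Fin n => P) := by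
      refine integral_mono ((integrable_const _).sub (Integrable.fintype_prod fun _ => iP))
        ((scoreTest P Q a b l).integrable_g n _) fun x => ?_
      simp only [scoreTest]
      rw [Finset.prod_inv_distrib, ← one_div]
      exact sub_le_sub_left (one_div_le_one_div_of_le (hp x) (by linarith)) _
    rw [integral_sub (integrable_const _) (Integrable.fintype_prod fun _ => iP),
      integral_fintype_prod_eq_prod (fun _ : Fin n => fun x => (pointScore P Q a b l x)⁻¹)] at h1
    simp only [integral_const, probReal_univ, one_smul, Finset.prod_const, Finset.card_univ,
      Fintype.card_fin] at h1
    have := pow_le_pow_left₀ (integral_nonneg fun x => (inv_pos.2 (h0 x)).le) hP n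
    linarith
  have eQ : ∫ x, (scoreTest P Q a b l).g n x ∂(Measure.pi fun _ : Fin n => Q) ≤ r ^ n := by
    have h1 : ∫ x, (scoreTest P Q a b l).g n x ∂(Measure.pi fun _ : Fin n => Q) ≤
        ∫ x, ∏ i, pointScore P Q a b l (x i) ∂(Measure.pi fun _ : Fin n => Q) := by
      refine integral_mono ((scoreTest P Q a b l).integrable_g n _)
        (Integrable.fintype_prod fun _ => iQ) fun x => ?_
      simp only [scoreTest]
      have := hp x
      generalize ∏ i, pointScore P Q a b l (x i) = V at *
      rw [one_sub_div (by positivity), add_sub_cancel_left, div_le_iff₀ (by positivity)]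
      nlinarith
    rw [integral_fintype_prod_eq_prod (fun _ : Fin n => fun x => pointScore P Q a b l x)] at h1
    simp only [Finset.prod_const, Finset.card_univ, Fintype.card_fin] at h1
    exact h1.trans (pow_le_pow_left₀ (integral_nonneg fun x => (h0 x).le) hQ n)
  unfold Test.advantage
  linarith

/-- The infimum of an empty set of naturals would be `0`, so some private test has to succeed for
all large sample sizes; `scoreTest` does. -/
theorem le_sampleComplexity_mul_rate (hε : 0 < ε) (hPQ : P ≠ Q) :
    1 / 8 ≤ sampleComplexity P Q ε * rate P Q ε := by
  have hne : {N : ℕ | ∃ K : Test X, K.IsPrivate ε ∧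
      ∀ n, N ≤ n → 2 / 3 ≤ K.advantage P Q n}.Nonempty := by
    obtain ⟨l, hP, hQ⟩ := exists_shift P Q hε.le
    obtain ⟨⟨ha, haε⟩, -⟩ := clampLevel_spec P Q hε.le
    obtain ⟨⟨hb, hbε⟩, -⟩ := clampLevel_spec Q P hε.le
    have h0 := rate_pos P Q hε hPQ
    have h2 := rate_le_two P Q hε.le
    have hr : 0 ≤ 1 - rate P Q ε / 16 := by linarith
    obtain ⟨N, hN⟩ := exists_pow_lt_of_lt_one (show (0 : ℝ) < 1 / 6 by norm_num)
      (show 1 - rate P Q ε / 16 < 1 by linarith)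
    refine ⟨N, _, isPrivate_scoreTest P Q _ _ ha hb haε hbε l, fun n hn => ?_⟩
    have h3 := one_sub_le_advantage P Q _ _ ha hb hr hP hQ n
    have h4 := pow_le_pow_of_le_one hr (by linarith) hn
    linarith
  obtain ⟨K, hK, h⟩ := Nat.sInf_mem hne
  exact le_mul_rate_of_test P Q hε.le hK (h _ le_rfl)

end LowerBound

end

end ChangePoint

namespace ChangePoint
noncomputable section

set_option linter.unusedSectionVars false

/-! ### Accuracy -/

section Expectations

theorem lintegral_infinitePi_prod {ι X : Type*} [MeasurableSpace X] (μ : ι → Measure X)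
    [∀ i, IsProbabilityMeasure (μ i)] (s : Finset ι) {f : ι → X → ENNReal}
    (hf : ∀ i, Measurable (f i)) :
    ∫⁻ x, ∏ i ∈ s, f i (x i) ∂(Measure.infinitePi μ) = ∏ i ∈ s, ∫⁻ u, f i u ∂(μ i) := by
  have hi : ProbabilityTheory.iIndepFun (fun i (x : ι → X) => f i (x i)) (Measure.infinitePi μ) :=
    ProbabilityTheory.iIndepFun_infinitePi (X := fun i u => f i u) fun i => hf i
  rw [ProbabilityTheory.lintegral_prod_eq_prod_lintegral_of_indepFun s _ hi
    fun i => (hf i).comp (measurable_pi_apply i)]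
  refine Finset.prod_congr rfl fun i _ => ?_
  rw [← lintegral_map (hf i) (measurable_pi_apply i)]
  exact congrArg (fun ν => ∫⁻ u, f i u ∂ν) (Measure.infinitePi_map_eval μ i)

theorem map_restrict_infinitePi {X : Type*} [MeasurableSpace X] (μ : ℕ → Measure X)
    [∀ i, IsProbabilityMeasure (μ i)] (n : ℕ) :
    (Measure.infinitePi μ).map (fun x (i : Fin n) => x i) = Measure.pi fun i : Fin n => μ i := by
  have hi : ProbabilityTheory.iIndepFun (fun i (x : ℕ → X) => x i) (Measure.infinitePi μ) :=
    ProbabilityTheory.iIndepFun_infinitePi (X := fun _ u => u) fun _ => measurable_id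
  have := (ProbabilityTheory.iIndepFun_iff_map_fun_eq_pi_map
    fun i : Fin n => (measurable_pi_apply (i : ℕ)).aemeasurable).1 (hi.precomp Fin.val_injective)
  rw [this]
  congr 1
  funext i
  exact Measure.infinitePi_map_eval μ i

/-- Only the error term has to be measurable; the output probability `F` of a program may be any
function. -/
theorem ofReal_one_sub_le_lintegral {Ω : Type*} [MeasurableSpace Ω] {μ : Measure Ω}
    [IsProbabilityMeasure μ] {F e : Ω → ENNReal} {β : ℝ} (hβ : 0 ≤ β) (he : Measurable e)
    (h : ∀ x, 1 ≤ F x + e x) (heβ : ∫⁻ x, e x ∂μ ≤ ENNReal.ofReal β) :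
    ENNReal.ofReal (1 - β) ≤ ∫⁻ x, F x ∂μ := by
  rw [ENNReal.ofReal_sub _ hβ, ENNReal.ofReal_one, tsub_le_iff_right]
  calc (1 : ENNReal) = ∫⁻ _, 1 ∂μ := by simp
    _ ≤ ∫⁻ x, (F x + e x) ∂μ := lintegral_mono h
    _ = ∫⁻ x, F x ∂μ + ∫⁻ x, e x ∂μ := lintegral_add_right _ he
    _ ≤ _ := by gcongr

theorem sum_geom_le {r : ℝ} (hr0 : 0 ≤ r) {m : ℕ} (hm : 1 ≤ m * (1 - r)) (n : ℕ) :
    ∑ p ∈ Finset.range n, r ^ p ≤ m := by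
  have h1 : 0 < 1 - r := by
    by_contra h
    have : (m : ℝ) * (1 - r) ≤ 0 := mul_nonpos_of_nonneg_of_nonpos (by positivity) (not_lt.1 h)
    linarith
  have h2 := mul_neg_geom_sum r n
  have h3 : (1 - r) * ∑ p ∈ Finset.range n, r ^ p ≤ (1 - r) * m := by
    rw [h2]
    have : 0 ≤ r ^ n := by positivity
    linarith
  exact le_of_mul_le_mul_left h3 h1

/-- A weight is a small part of the total weight if it is small compared with the weights in a
window. -/
theorem div_sum_le {w : ℕ → ℝ} (hw : ∀ j, 0 < w j) {N m : ℕ} (hm : m ≠ 0) {J : ℕ → ℕ}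
    (hJ : Function.Injective J) (hN : ∀ q < m, J q < N) {v : ℝ} (hv : 0 ≤ v) :
    v / ∑ j ∈ Finset.range N, w j ≤ ∑ q ∈ Finset.range m, ((m : ℝ) ^ 2)⁻¹ * (v / w (J q)) := by
  set W := ∑ j ∈ Finset.range N, w j
  have h1 : ∑ q ∈ Finset.range m, w (J q) ≤ W := by
    rw [← Finset.sum_image fun x _ y _ h => hJ h]
    refine Finset.sum_le_sum_of_subset_of_nonneg (fun j hj => ?_) fun j _ _ => (hw j).le
    obtain ⟨q, hq, rfl⟩ := Finset.mem_image.1 hj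
    exact Finset.mem_range.2 (hN q (Finset.mem_range.1 hq))
  -- The Cauchy-Schwarz bound `m² ≤ (∑ w)(∑ 1/w)` turns the reciprocal of the window's weight into
  -- an average of quotients of single weights.
  have h2 : (∑ _q ∈ Finset.range m, (1 : ℝ)) ^ 2 ≤
      (∑ q ∈ Finset.range m, w (J q)) * ∑ q ∈ Finset.range m, (w (J q))⁻¹ :=
    Finset.sum_sq_le_sum_mul_sum_of_sq_le_mul _ (fun q _ => (hw _).le)
      (fun q _ => (inv_pos.2 (hw _)).le) fun q _ => by
      rw [mul_inv_cancel₀ (hw _).ne', one_pow]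
  have h3 : 0 ≤ ∑ q ∈ Finset.range m, (w (J q))⁻¹ :=
    Finset.sum_nonneg fun q _ => (inv_pos.2 (hw _)).le
  have h0 : 0 < ∑ q ∈ Finset.range m, w (J q) :=
    Finset.sum_pos (fun q _ => hw _) (Finset.nonempty_range_iff.2 hm)
  have hm' : (0 : ℝ) < m ^ 2 := by positivity
  rw [Finset.sum_const, Finset.card_range, nsmul_eq_mul, mul_one] at h2
  have h4 : (m : ℝ) ^ 2 ≤ W * ∑ q ∈ Finset.range m, (w (J q))⁻¹ :=
    h2.trans (mul_le_mul_of_nonneg_right h1 h3)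
  have h5 : ∑ q ∈ Finset.range m, ((m : ℝ) ^ 2)⁻¹ * (v / w (J q)) =
      v * (((m : ℝ) ^ 2)⁻¹ * ∑ q ∈ Finset.range m, (w (J q))⁻¹) := by
    rw [Finset.mul_sum, Finset.mul_sum]
    exact Finset.sum_congr rfl fun q _ => by ring
  rw [h5, div_eq_mul_inv]
  refine mul_le_mul_of_nonneg_left ?_ hv
  rw [inv_mul_eq_div, le_div_iff₀ hm', inv_mul_le_iff₀ (h0.trans_le h1)]
  exact h4

/-- The expected relative weight of the candidates that are far from a window. -/
theorem lintegral_sum_div_le {Ω : Type*} [MeasurableSpace Ω] {μ : Measure Ω} {w : Ω → ℕ → ℝ}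
    (hw : ∀ x j, 0 < w x j) (hmeas : ∀ j, Measurable fun x => w x j) {r : ℝ} (hr0 : 0 ≤ r)
    {N m M E : ℕ} (hm : 1 ≤ m * (1 - r)) {I J : ℕ → ℕ} (hJ : Function.Injective J)
    (hN : ∀ q < m, J q < N)
    (hE : ∀ p < M, ∀ q < m, ∫⁻ x, ENNReal.ofReal (w x (I p) / w x (J q)) ∂μ ≤
      ENNReal.ofReal (r ^ (E + p + q))) :
    ∫⁻ x, ENNReal.ofReal ((∑ p ∈ Finset.range M, w x (I p)) / ∑ j ∈ Finset.range N, w x j) ∂μ ≤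
      ENNReal.ofReal (r ^ E) := by
  have hm0 : m ≠ 0 := by
    rintro rfl
    norm_num at hm
  have hm2 : (0 : ℝ) < m ^ 2 := by positivity
  have hmea (p q : ℕ) : Measurable fun x => ENNReal.ofReal (((m : ℝ) ^ 2)⁻¹) *
      ENNReal.ofReal (w x (I p) / w x (J q)) :=
    ((hmeas _).div (hmeas _)).ennreal_ofReal.const_mul _
  calc _ ≤ ∫⁻ x, ∑ p ∈ Finset.range M, ∑ q ∈ Finset.range m,
        ENNReal.ofReal (((m : ℝ) ^ 2)⁻¹) * ENNReal.ofReal (w x (I p) / w x (J q)) ∂μ := by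
        refine lintegral_mono fun x => ?_
        have hnn (p q : ℕ) : 0 ≤ ((m : ℝ) ^ 2)⁻¹ * (w x (I p) / w x (J q)) :=
          mul_nonneg (inv_pos.2 hm2).le (div_nonneg (hw _ _).le (hw _ _).le)
        have : (∑ p ∈ Finset.range M, w x (I p)) / ∑ j ∈ Finset.range N, w x j ≤
            ∑ p ∈ Finset.range M, ∑ q ∈ Finset.range m,
              ((m : ℝ) ^ 2)⁻¹ * (w x (I p) / w x (J q)) := by
          rw [Finset.sum_div]
          exact Finset.sum_le_sum fun p _ => div_sum_le (hw x) hm0 hJ hN (hw _ _).le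
        refine (ENNReal.ofReal_le_ofReal this).trans ?_
        rw [ENNReal.ofReal_sum_of_nonneg fun p _ => Finset.sum_nonneg fun q _ => hnn p q]
        refine Finset.sum_le_sum fun p _ => ?_
        rw [ENNReal.ofReal_sum_of_nonneg fun q _ => hnn p q]
        exact Finset.sum_le_sum fun q _ => (ENNReal.ofReal_mul (inv_pos.2 hm2).le).le
    _ = ∑ p ∈ Finset.range M, ∑ q ∈ Finset.range m, ENNReal.ofReal (((m : ℝ) ^ 2)⁻¹) *
        ∫⁻ x, ENNReal.ofReal (w x (I p) / w x (J q)) ∂μ := by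
        rw [lintegral_finsetSum _ fun p _ => Finset.measurable_sum _ fun q _ => hmea p q]
        refine Finset.sum_congr rfl fun p _ => ?_
        rw [lintegral_finsetSum _ fun q _ => hmea p q]
        exact Finset.sum_congr rfl fun q _ =>
          lintegral_const_mul _ ((hmeas _).div (hmeas _)).ennreal_ofReal
    _ ≤ ∑ p ∈ Finset.range M, ∑ q ∈ Finset.range m, ENNReal.ofReal (((m : ℝ) ^ 2)⁻¹) *
        ENNReal.ofReal (r ^ (E + p + q)) :=
        Finset.sum_le_sum fun p hp => Finset.sum_le_sum fun q hq =>
          mul_le_mul_right (hE p (Finset.mem_range.1 hp) q (Finset.mem_range.1 hq)) _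
    _ = ENNReal.ofReal (((m : ℝ) ^ 2)⁻¹ * r ^ E *
        ((∑ p ∈ Finset.range M, r ^ p) * ∑ q ∈ Finset.range m, r ^ q)) := by
        rw [Finset.sum_mul_sum, Finset.mul_sum, ENNReal.ofReal_sum_of_nonneg fun p _ => by positivity]
        refine Finset.sum_congr rfl fun p _ => ?_
        rw [Finset.mul_sum, ENNReal.ofReal_sum_of_nonneg fun p _ => by positivity]
        refine Finset.sum_congr rfl fun q _ => ?_
        rw [← ENNReal.ofReal_mul (inv_pos.2 hm2).le]
        congr 1
        ring
    _ ≤ _ := by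
        refine ENNReal.ofReal_le_ofReal ?_
        -- Each geometric sum is at most `1/(1-r) ≤ m`, so the two cancel the prefactor.
        calc _ ≤ ((m : ℝ) ^ 2)⁻¹ * r ^ E * ((m : ℝ) * m) := by
              have h1 := sum_geom_le hr0 hm M
              have h2 := sum_geom_le hr0 hm m
              gcongr
          _ = r ^ E := by field_simp

/-- The relative weight of the candidates at distance more than `A` from `κ`, among the first
`N`. -/
def farMass (y : ℕ → ℝ) (κ A N : ℕ) : ℝ :=
  (∑ j ∈ Finset.range (κ - A), weight y j) / totalWeight y N +
    (∑ j ∈ Finset.Ico (κ + A + 1) N, weight y j) / totalWeight y N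

theorem farMass_nonneg {y : ℕ → ℝ} (hy : ∀ i, 0 < y i) (κ A N : ℕ) : 0 ≤ farMass y κ A N :=
  add_nonneg
    (div_nonneg (Finset.sum_nonneg fun _ _ => (weight_pos hy _).le) (totalWeight_nonneg hy _))
    (div_nonneg (Finset.sum_nonneg fun _ _ => (weight_pos hy _).le) (totalWeight_nonneg hy _))

theorem one_le_candMean_add_farMass {y : ℕ → ℝ} (hy : ∀ i, 0 < y i) {f : ℕ → ℝ}
    (hf : ∀ j, 0 ≤ f j) {κ A N : ℕ} (hN : N ≠ 0)
    (h : ∀ j < N, κ ≤ j + A → j ≤ κ + A → f (j + 1) = 1) :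
    1 ≤ candMean y f 0 0 N + farMass y κ A N := by
  have hW := totalWeight_pos hy hN
  rw [candMean_zero, farMass, ← add_div, ← add_div, one_le_div hW, totalWeight]
  have hle : ∀ j ∈ Finset.range N, weight y j ≤ weight y j * f (j + 1) +
      ((if j < κ - A then weight y j else 0) + if κ + A + 1 ≤ j then weight y j else 0) := by
    intro j hj
    have h0 := (weight_pos hy j).le
    have h1 := mul_nonneg h0 (hf (j + 1))
    split_ifs with h2 h3 h3
    · linarith
    · linarith
    · linarith
    · rw [h j (Finset.mem_range.1 hj) (by omega) (by omega)]
      linarith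
  refine (Finset.sum_le_sum hle).trans ?_
  rw [Finset.sum_add_distrib, Finset.sum_add_distrib, ← Finset.sum_filter, ← Finset.sum_filter]
  refine add_le_add_right (add_le_add ?_ ?_) _
  · refine Finset.sum_le_sum_of_subset_of_nonneg (fun j hj => ?_) fun j _ _ => (weight_pos hy j).le
    exact Finset.mem_range.2 (Finset.mem_filter.1 hj).2
  · refine Finset.sum_le_sum_of_subset_of_nonneg (fun j hj => ?_) fun j _ _ => (weight_pos hy j).le
    obtain ⟨h1, h2⟩ := Finset.mem_filter.1 hj
    exact Finset.mem_Ico.2 ⟨h2, Finset.mem_range.1 h1⟩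

theorem measurable_weight {Ω : Type*} [MeasurableSpace Ω] {y : Ω → ℕ → ℝ}
    (hy : ∀ i, Measurable fun x => y x i) (j : ℕ) : Measurable fun x => weight (y x) j :=
  Finset.measurable_prod _ fun i _ => hy i

theorem measurable_totalWeight {Ω : Type*} [MeasurableSpace Ω] {y : Ω → ℕ → ℝ}
    (hy : ∀ i, Measurable fun x => y x i) (N : ℕ) : Measurable fun x => totalWeight (y x) N :=
  Finset.measurable_sum _ fun j _ => measurable_weight hy j

theorem measurable_farMass {Ω : Type*} [MeasurableSpace Ω] {y : Ω → ℕ → ℝ}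
    (hy : ∀ i, Measurable fun x => y x i) (κ A N : ℕ) :
    Measurable fun x => farMass (y x) κ A N :=
  ((Finset.measurable_sum _ fun j _ => measurable_weight hy j).div (measurable_totalWeight hy N)).add
    ((Finset.measurable_sum _ fun j _ => measurable_weight hy j).div (measurable_totalWeight hy N))

end Expectations

/-! ### Quotients of weights along a random stream -/

section Streams

variable {X : Type*} [MeasurableSpace X] (P Q : Measure X) [IsProbabilityMeasure P]
  [IsProbabilityMeasure Q] {a b l r : ℝ}

/-- The scores of a stream. -/
def streamScore (a b l : ℝ) (x : ℕ → X) (i : ℕ) : ℝ := pointScore P Q a b l (x i)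

theorem streamScore_pos (x : ℕ → X) (i : ℕ) : 0 < streamScore P Q a b l x i :=
  pointScore_pos P Q _

theorem measurable_streamScore (i : ℕ) : Measurable fun x => streamScore P Q a b l x i :=
  (measurable_pointScore P Q a b l).comp (measurable_pi_apply i)

theorem weight_div_weight {y : ℕ → ℝ} (hy : ∀ i, 0 < y i) {j t : ℕ} (h : j ≤ t) :
    weight y t / weight y j = ∏ i ∈ Finset.Ico j t, y i := by
  rw [div_eq_iff (weight_pos hy j).ne', weight, weight, mul_comm, Finset.prod_range_mul_prod_Ico _ h]

theorem weight_div_weight' {y : ℕ → ℝ} (hy : ∀ i, 0 < y i) {j t : ℕ} (h : j ≤ t) :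
    weight y j / weight y t = ∏ i ∈ Finset.Ico j t, (y i)⁻¹ := by
  rw [← inv_div, weight_div_weight hy h, Finset.prod_inv_distrib]

/-- Up to index `κ` all points come from P. The quotient is a product of `t - j` independent inverse
scores, each of mean at most `r`. -/
theorem lintegral_weight_before
    (hP : ∫⁻ u, ENNReal.ofReal (pointScore P Q a b l u)⁻¹ ∂P ≤ ENNReal.ofReal r)
    (hr0 : 0 ≤ r) {κ j t : ℕ} (hjt : j ≤ t) (ht : t ≤ κ) :
    ∫⁻ x, ENNReal.ofReal (weight (streamScore P Q a b l x) j / weight (streamScore P Q a b l x) t)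
      ∂(Measure.infinitePi fun i => law P Q (κ + 1) i) ≤ ENNReal.ofReal (r ^ (t - j)) := by
  have h1 (x : ℕ → X) : ENNReal.ofReal
      (weight (streamScore P Q a b l x) j / weight (streamScore P Q a b l x) t) =
      ∏ i ∈ Finset.Ico j t, ENNReal.ofReal (pointScore P Q a b l (x i))⁻¹ := by
    rw [weight_div_weight' (streamScore_pos P Q x) hjt, ENNReal.ofReal_prod_of_nonneg]
    · rfl
    · exact fun i _ => (inv_pos.2 (streamScore_pos P Q x i)).le
  simp_rw [h1]
  rw [lintegral_infinitePi_prod _ _ (f := fun _ u => ENNReal.ofReal (pointScore P Q a b l u)⁻¹)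
    fun _ => (measurable_pointScore P Q a b l).inv.ennreal_ofReal, ENNReal.ofReal_pow hr0]
  refine (Finset.prod_le_pow_card _ _ _ fun i hi => ?_).trans (by rw [Nat.card_Ico])
  have := Finset.mem_Ico.1 hi
  rwa [law, if_pos (by omega)]

theorem lintegral_weight_after
    (hQ : ∫⁻ u, ENNReal.ofReal (pointScore P Q a b l u) ∂Q ≤ ENNReal.ofReal r)
    (hr0 : 0 ≤ r) {κ j t : ℕ} (hj : κ ≤ j) (hjt : j ≤ t) :
    ∫⁻ x, ENNReal.ofReal (weight (streamScore P Q a b l x) t / weight (streamScore P Q a b l x) j)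
      ∂(Measure.infinitePi fun i => law P Q (κ + 1) i) ≤ ENNReal.ofReal (r ^ (t - j)) := by
  have h1 (x : ℕ → X) : ENNReal.ofReal
      (weight (streamScore P Q a b l x) t / weight (streamScore P Q a b l x) j) =
      ∏ i ∈ Finset.Ico j t, ENNReal.ofReal (pointScore P Q a b l (x i)) := by
    rw [weight_div_weight (streamScore_pos P Q x) hjt, ENNReal.ofReal_prod_of_nonneg]
    · rfl
    · exact fun i _ => (streamScore_pos P Q x i).le
  simp_rw [h1]
  rw [lintegral_infinitePi_prod _ _ (f := fun _ u => ENNReal.ofReal (pointScore P Q a b l u))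
    fun _ => (measurable_pointScore P Q a b l).ennreal_ofReal, ENNReal.ofReal_pow hr0]
  refine (Finset.prod_le_pow_card _ _ _ fun i hi => ?_).trans (by rw [Nat.card_Ico])
  have := Finset.mem_Ico.1 hi
  rwa [law, if_neg (by omega)]

theorem lintegral_farMass_le
    (hP : ∫⁻ u, ENNReal.ofReal (pointScore P Q a b l u)⁻¹ ∂P ≤ ENNReal.ofReal r)
    (hQ : ∫⁻ u, ENNReal.ofReal (pointScore P Q a b l u) ∂Q ≤ ENNReal.ofReal r)
    (hr0 : 0 ≤ r) (hr1 : r ≤ 1) {κ A N m : ℕ} (hκ : κ < N) (hm : 1 ≤ m * (1 - r)) (hmA : m ≤ A) :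
    ∫⁻ x, ENNReal.ofReal (farMass (streamScore P Q a b l x) κ A N)
      ∂(Measure.infinitePi fun i => law P Q (κ + 1) i) ≤ ENNReal.ofReal (2 * r ^ (A - m)) := by
  have hs (i : ℕ) := measurable_streamScore P Q (a := a) (b := b) (l := l) i
  have hpow {s t : ℕ} (h : t ≤ s) : ENNReal.ofReal (r ^ s) ≤ ENNReal.ofReal (r ^ t) :=
    ENNReal.ofReal_le_ofReal (pow_le_pow_of_le_one hr0 hr1 h)
  have hnn (x : ℕ → X) (s : Finset ℕ) : 0 ≤ (∑ j ∈ s, weight (streamScore P Q a b l x) j) /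
      totalWeight (streamScore P Q a b l x) N :=
    div_nonneg (Finset.sum_nonneg fun _ _ => (weight_pos (streamScore_pos P Q x) _).le)
      (totalWeight_nonneg (streamScore_pos P Q x) _)
  simp_rw [farMass, ENNReal.ofReal_add (hnn _ _) (hnn _ _)]
  have hD : Measurable fun x => ENNReal.ofReal
      ((∑ j ∈ Finset.range (κ - A), weight (streamScore P Q a b l x) j) /
        totalWeight (streamScore P Q a b l x) N) :=
    ((Finset.measurable_sum _ fun j _ => measurable_weight hs j).div (measurable_totalWeight hs N)).ennreal_ofReal
  rw [lintegral_add_left hD, two_mul, ENNReal.ofReal_add (by positivity) (by positivity)]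
  refine add_le_add ?_ ?_
  · rcases le_or_gt κ A with h | h
    · simp [Nat.sub_eq_zero_of_le h]
    -- The far candidates are listed backwards, starting next to the window `κ - m + 1, …, κ`. The
    -- distance between entries `p` and `q` is then at least `A - m + p + q`.
    · simp_rw [← Finset.sum_range_reflect (fun j => weight _ j) (κ - A)]
      refine lintegral_sum_div_le (fun x => weight_pos (streamScore_pos P Q x))
        (measurable_weight hs) hr0 hm (I := fun p => κ - A - 1 - p)
        (J := fun q => κ - m + 1 + q) (add_right_injective _) (fun q hq => by omega)
        fun p hp q hq => ?_
      refine (lintegral_weight_before P Q hP hr0 (by omega) (by omega)).trans (hpow ?_)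
      omega
  · rcases le_or_gt N (κ + A + 1) with h | h
    · simp [Finset.Ico_eq_empty_of_le h]
    · simp_rw [Finset.sum_Ico_eq_sum_range]
      rcases Nat.eq_zero_or_pos m with rfl | hm0
      · norm_num at hm
      simp_rw [totalWeight]
      -- Only the entries `q < m`, the window `κ, …, κ + m - 1` in reverse order, are used. The
      -- other branch makes the map injective on all naturals in spite of truncated subtraction.
      have hJ : Function.Injective fun q => if q < m then κ + m - 1 - q else κ + q := by
        intro q q' hqq
        simp only at hqq
        split_ifs at hqq <;> omega
      refine lintegral_sum_div_le (fun x => weight_pos (streamScore_pos P Q x))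
        (measurable_weight hs) hr0 hm hJ (fun q hq => by simp only [if_pos hq]; omega)
        fun p hp q hq => ?_
      simp only [if_pos hq]
      refine (lintegral_weight_after P Q hQ hr0 (by omega) (by omega)).trans (hpow ?_)
      omega

end Streams

end
end ChangePoint

namespace ChangePoint
noncomputable section

set_option linter.unusedSectionVars false

/-! ### The guarantees of the two programs -/

section Guarantees

variable {X : Type*} [MeasurableSpace X] (P Q : Measure X) [IsProbabilityMeasure P]
  [IsProbabilityMeasure Q] {a b l r : ℝ}

theorem measurable_dataScore {n : ℕ} (i : ℕ) :
    Measurable fun x : Fin n → X => dataScore P Q a b l x i := by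
  unfold dataScore
  split_ifs with h
  · exact (measurable_pointScore P Q a b l).comp (measurable_pi_apply _)
  · exact measurable_const

theorem farMass_congr {y y' : ℕ → ℝ} {κ A N : ℕ} (hκ : κ ≤ N) (h : ∀ i < N, y i = y' i) :
    farMass y κ A N = farMass y' κ A N := by
  have hw : ∀ j ≤ N, weight y j = weight y' j := fun j hj =>
    Finset.prod_congr rfl fun i hi => h i ((Finset.mem_range.1 hi).trans_le hj)
  have hW : totalWeight y N = totalWeight y' N :=
    Finset.sum_congr rfl fun j hj => hw j (Finset.mem_range.1 hj).le
  have h1 : ∀ j ∈ Finset.range (κ - A), weight y j = weight y' j := fun j hj => by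
    have := Finset.mem_range.1 hj
    exact hw j (by omega)
  have h2 : ∀ j ∈ Finset.Ico (κ + A + 1) N, weight y j = weight y' j := fun j hj =>
    hw j (Finset.mem_Ico.1 hj).2.le
  rw [farMass, farMass, hW, Finset.sum_congr rfl h1, Finset.sum_congr rfl h2]

theorem abs_sub_le_of_near {α : ℝ} {κ A j : ℕ} (hA : (A : ℝ) ≤ α) (h1 : κ ≤ j + A)
    (h2 : j ≤ κ + A) : |((j + 1 : ℕ) : ℝ) - (κ + 1 : ℕ)| ≤ α := by
  have h1' : (κ : ℝ) ≤ j + A := by exact_mod_cast h1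
  have h2' : (j : ℝ) ≤ κ + A := by exact_mod_cast h2
  rw [abs_le]
  push_cast
  constructor <;> linarith

theorem offlineAccurate_offlineProg
    (hP : ∫⁻ u, ENNReal.ofReal (pointScore P Q a b l u)⁻¹ ∂P ≤ ENNReal.ofReal r)
    (hQ : ∫⁻ u, ENNReal.ofReal (pointScore P Q a b l u) ∂Q ≤ ENNReal.ofReal r)
    (hr0 : 0 ≤ r) (hr1 : r ≤ 1) {A m : ℕ} (hm : 1 ≤ m * (1 - r)) (hmA : m ≤ A) {α β : ℝ}
    (hA : (A : ℝ) ≤ α) (hβ0 : 0 ≤ β) (hβ : 2 * r ^ (A - m) ≤ β) :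
    OfflineAccurate P Q offlineProg (0 :: params a b l) α β := by
  intro n k hk hkn
  obtain ⟨κ, rfl⟩ : ∃ κ, k = κ + 1 := ⟨k - 1, by omega⟩
  have hn : n ≠ 0 := by omega
  have hmeas : Measurable fun x : Fin n → X =>
      ENNReal.ofReal (farMass (dataScore P Q a b l x) κ A n) :=
    (measurable_farMass (fun i => measurable_dataScore P Q i) κ A n).ennreal_ofReal
  refine ofReal_one_sub_le_lintegral hβ0 hmeas (fun x => ?_) ?_
  · have hy := dataScore_pos P Q (a := a) (b := b) (l := l) x
    rw [outProb_offlineProg P Q hn, ← ENNReal.ofReal_add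
      (candMean_nonneg hy (fun j => ind_nonneg _ _) _ _ _) (farMass_nonneg hy _ _ _),
      ← ENNReal.ofReal_one]
    refine ENNReal.ofReal_le_ofReal (one_le_candMean_add_farMass hy (fun j => ind_nonneg _ _) hn ?_)
    exact fun j _ h1 h2 => if_pos (abs_sub_le_of_near hA h1 h2)
  -- The data set is the beginning of a stream, and the first `n` scores determine the far mass.
  · rw [← map_restrict_infinitePi (fun i => law P Q (κ + 1) i) n,
      lintegral_map hmeas (measurable_pi_lambda _ fun i => measurable_pi_apply _)]
    have hc (x : ℕ → X) : farMass (dataScore P Q a b l fun i : Fin n => x i) κ A n =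
        farMass (streamScore P Q a b l x) κ A n :=
      farMass_congr (by omega) fun i hi => by rw [dataScore, dif_pos hi, streamScore]
    simp_rw [hc]
    exact (lintegral_farMass_le P Q hP hQ hr0 hr1 (by omega) hm hmA).trans
      (ENNReal.ofReal_le_ofReal hβ)

theorem blockLen_pos (n : ℕ) : 0 < blockLen n := Nat.succ_pos _

theorem prod_alarm_nonneg {y : ℕ → ℝ} (hy : ∀ i, 0 < y i) (L : ℕ) (s : Finset ℕ) :
    0 ≤ ∏ i ∈ s, (1 - alarm L y i) :=
  Finset.prod_nonneg fun i _ => sub_nonneg.2 (alarm_le_one hy L i)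

theorem prod_alarm_le_one {y : ℕ → ℝ} (hy : ∀ i, 0 < y i) (L : ℕ) (s : Finset ℕ) :
    ∏ i ∈ s, (1 - alarm L y i) ≤ 1 :=
  Finset.prod_le_one (fun i _ => sub_nonneg.2 (alarm_le_one hy L i))
    fun i _ => sub_le_self _ (alarm_nonneg hy L i)

/-- The online algorithm is accurate unless it raises the alarm before the change point, or misses
it in the first full block after the change point, or the offline algorithm is inaccurate. -/
theorem one_le_alarmSum_add {n : ℕ} (hn : 4 ≤ n) {y : ℕ → ℝ} (hy : ∀ i, 0 < y i) {κ A : ℕ}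
    {α : ℝ} (hA : (A : ℝ) ≤ α) :
    1 ≤ alarmSum n y {p | |(p.1 : ℝ) - (κ + 1 : ℕ)| ≤ α} ((κ / blockLen n + 2) * blockLen n) 0 0 +
      (∑ t ∈ Finset.range κ, alarm (blockLen n) y t +
        farMass y κ A ((κ / blockLen n + 1) * blockLen n) +
        farMass y κ A ((κ / blockLen n + 2) * blockLen n) +
        (1 - alarm (blockLen n) y ((κ / blockLen n + 2) * blockLen n - 1))) := by
  have hL2 : 2 * blockLen n ≤ n := by unfold blockLen; omega
  have hL0 := blockLen_pos n
  simp only [alarmSum, zero_add, ← Finset.range_eq_Ico]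
  generalize blockLen n = L at *
  have hLd : κ / L * L ≤ κ ∧ κ < (κ / L + 1) * L := by
    rw [add_mul, one_mul, mul_comm]
    have h1 := Nat.div_add_mod κ L
    have h2 := Nat.mod_lt κ hL0
    constructor <;> omega
  generalize κ / L = J at *
  have hs1 : (J + 1) * L = J * L + L := by ring
  have hs2 : (J + 2) * L = J * L + 2 * L := by ring
  set S : Set (ℕ × ℕ) := {p | |(p.1 : ℝ) - (κ + 1 : ℕ)| ≤ α}
  set c : ℕ → ℝ := fun N => candMean y (fun j => ind S (onlineResult n N j)) 0 0 N
  have hc0 (N : ℕ) : 0 ≤ c N := candMean_nonneg hy (fun j => ind_nonneg _ _) _ _ _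
  -- As long as `N - n ≤ κ + 1`, raising the candidate to `N - n` cannot push a near candidate away
  -- from the change point.
  have hc {N : ℕ} (hN0 : N ≠ 0) (hN : N ≤ κ + 1 + n) : 1 ≤ c N + farMass y κ A N := by
    refine one_le_candMean_add_farMass hy (fun j => ind_nonneg _ _) hN0 fun j _ h1 h2 => if_pos ?_
    change |((max (j + 1) (N - n) : ℕ) : ℝ) - (κ + 1 : ℕ)| ≤ α
    rcases le_total (N - n) (j + 1) with h | h
    · rw [max_eq_left h]
      exact abs_sub_le_of_near hA h1 h2
    · rw [max_eq_right h]
      obtain ⟨j', hj'⟩ : ∃ j', max (N - n) 1 = j' + 1 := ⟨max (N - n) 1 - 1, by omega⟩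
      have : N - n = j' + 1 := by omega
      rw [this]
      exact abs_sub_le_of_near hA (by omega) (by omega)
  have hf (N : ℕ) := farMass_nonneg hy κ A N
  -- From `κ` on, alarms within the horizon are possible only at the ends of two blocks, so the
  -- random stopping time costs only two far masses. Earlier alarms are charged in full.
  have hterm : ∀ t ∈ Finset.range ((J + 2) * L),
      (∏ i ∈ Finset.range t, (1 - alarm L y i)) * alarm L y t ≤
        (∏ i ∈ Finset.range t, (1 - alarm L y i)) * alarm L y t * c (t + 1) +
        ((if t < κ then alarm L y t else 0) +
          (if t = (J + 1) * L - 1 then farMass y κ A ((J + 1) * L) else 0) +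
          if t = (J + 2) * L - 1 then farMass y κ A ((J + 2) * L) else 0) := by
    intro t ht
    rw [Finset.mem_range] at ht
    set π := ∏ i ∈ Finset.range t, (1 - alarm L y i)
    have h0 : 0 ≤ π := prod_alarm_nonneg hy L _
    have h1 : π ≤ 1 := prod_alarm_le_one hy L _
    have ha0 := alarm_nonneg hy L t
    have ha1 := alarm_le_one hy L t
    have hpa : 0 ≤ π * alarm L y t := mul_nonneg h0 ha0
    have hpa1 : π * alarm L y t ≤ 1 := mul_le_one₀ h1 ha0 ha1
    have hq : 0 ≤ π * alarm L y t * c (t + 1) := mul_nonneg hpa (hc0 _)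
    have hi1 : 0 ≤ if t = (J + 1) * L - 1 then farMass y κ A ((J + 1) * L) else 0 := by
      split_ifs
      exacts [hf _, le_rfl]
    have hi2 : 0 ≤ if t = (J + 2) * L - 1 then farMass y κ A ((J + 2) * L) else 0 := by
      split_ifs
      exacts [hf _, le_rfl]
    have hi0 : 0 ≤ if t < κ then alarm L y t else 0 := by
      split_ifs
      exacts [ha0, le_rfl]
    have hfar {N : ℕ} (hN0 : N ≠ 0) (hN : N ≤ κ + 1 + n) (htN : t + 1 = N) :
        π * alarm L y t ≤ π * alarm L y t * c (t + 1) + farMass y κ A N := by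
      have h2 := hc hN0 hN
      rw [htN]
      nlinarith [mul_le_mul_of_nonneg_left h2 hpa, mul_le_mul_of_nonneg_right hpa1 (hf N)]
    rcases lt_or_ge t κ with h | h
    · rw [if_pos h]
      nlinarith
    · by_cases hd : (t + 1) % L = 0
      · obtain ⟨q, hq'⟩ := Nat.dvd_of_mod_eq_zero hd
        have hq1 : J < q := by
          by_contra hcon
          have : L * q ≤ L * J := Nat.mul_le_mul_left _ (not_lt.1 hcon)
          rw [mul_comm L J] at this
          omega
        have hq2 : q ≤ J + 2 := by
          by_contra hcon
          have : L * (J + 3) ≤ L * q := Nat.mul_le_mul_left _ (by omega)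
          rw [show L * (J + 3) = J * L + 3 * L by ring] at this
          omega
        obtain rfl | rfl : q = J + 1 ∨ q = J + 2 := by omega
        · rw [mul_comm] at hq'
          have h3 := hfar (by omega) (by omega) hq'
          rw [if_pos (by omega : t = (J + 1) * L - 1)]
          linarith
        · rw [mul_comm] at hq'
          have h3 := hfar (by omega) (by omega) hq'
          rw [if_pos (by omega : t = (J + 2) * L - 1)]
          linarith
      · have : alarm L y t = 0 := if_neg hd
        rw [this] at hq hi0 ⊢
        rw [mul_zero]
        linarith
  have hsum := Finset.sum_le_sum hterm
  rw [sum_alarm_eq, Finset.sum_add_distrib, Finset.sum_add_distrib, Finset.sum_add_distrib,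
    ← Finset.sum_filter, Finset.sum_ite_eq' , Finset.sum_ite_eq',
    if_pos (Finset.mem_range.2 (by omega)), if_pos (Finset.mem_range.2 (by omega))] at hsum
  have h1 : ∑ t ∈ (Finset.range ((J + 2) * L)).filter (· < κ), alarm L y t ≤
      ∑ t ∈ Finset.range κ, alarm L y t :=
    Finset.sum_le_sum_of_subset_of_nonneg
      (fun t ht => Finset.mem_range.2 (Finset.mem_filter.1 ht).2) fun t _ _ => alarm_nonneg hy L t
  have h2 : ∏ i ∈ Finset.range ((J + 2) * L), (1 - alarm L y i) ≤
      1 - alarm L y ((J + 2) * L - 1) := by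
    rw [← Nat.sub_add_cancel (show 1 ≤ (J + 2) * L by omega), Finset.prod_range_succ,
      Nat.add_sub_cancel]
    exact mul_le_of_le_one_left (sub_nonneg.2 (alarm_le_one hy L _)) (prod_alarm_le_one hy L _)
  linarith

theorem measurable_alarm (L s : ℕ) : Measurable fun x => alarm L (streamScore P Q a b l x) s := by
  unfold alarm
  split_ifs
  · exact (measurable_const.add
      (Finset.measurable_prod _ fun i _ => measurable_streamScore P Q i)).const_div 1
  · exact measurable_const

/-- The block ends before the change, and a false alarm has probability `1/(1+V) ≤ 1/V`. -/
theorem lintegral_alarm_le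
    (hP : ∫⁻ u, ENNReal.ofReal (pointScore P Q a b l u)⁻¹ ∂P ≤ ENNReal.ofReal r)
    (hr0 : 0 ≤ r) {κ L t : ℕ} (ht : t < κ) :
    ∫⁻ x, ENNReal.ofReal (alarm L (streamScore P Q a b l x) t)
      ∂(Measure.infinitePi fun i => law P Q (κ + 1) i) ≤
      if L ∣ t + 1 then ENNReal.ofReal (r ^ L) else 0 := by
  by_cases hd : L ∣ t + 1
  · rw [if_pos hd]
    have hL : L ≤ t + 1 := Nat.le_of_dvd t.succ_pos hd
    have h := lintegral_weight_before P Q hP hr0 (Nat.sub_le (t + 1) L) ht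
    rw [Nat.sub_sub_self hL] at h
    refine (lintegral_mono fun x => ENNReal.ofReal_le_ofReal ?_).trans h
    have hy := streamScore_pos P Q (a := a) (b := b) (l := l) x
    rw [alarm, if_pos (Nat.mod_eq_zero_of_dvd hd), one_div,
      ← inv_div (weight (streamScore P Q a b l x) (t + 1)), weight_div_weight hy (Nat.sub_le _ _)]
    have hp : 0 < ∏ i ∈ Finset.Ico (t + 1 - L) (t + 1), streamScore P Q a b l x i :=
      Finset.prod_pos fun i _ => hy i
    exact inv_anti₀ hp (by linarith)
  · rw [if_neg hd]
    have (x : ℕ → X) : alarm L (streamScore P Q a b l x) t = 0 :=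
      if_neg fun h => hd (Nat.dvd_of_mod_eq_zero h)
    simp [this]

theorem lintegral_sum_alarm_le
    (hP : ∫⁻ u, ENNReal.ofReal (pointScore P Q a b l u)⁻¹ ∂P ≤ ENNReal.ofReal r)
    (hr0 : 0 ≤ r) (κ L : ℕ) :
    ∫⁻ x, ENNReal.ofReal (∑ t ∈ Finset.range κ, alarm L (streamScore P Q a b l x) t)
      ∂(Measure.infinitePi fun i => law P Q (κ + 1) i) ≤
      ENNReal.ofReal ((κ / L : ℕ) * r ^ L) := by
  have h (x : ℕ → X) := ENNReal.ofReal_sum_of_nonneg (s := Finset.range κ) fun t _ =>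
    alarm_nonneg (streamScore_pos P Q (a := a) (b := b) (l := l) x) L t
  simp_rw [h]
  rw [lintegral_finsetSum _ fun t _ => (measurable_alarm P Q L t).ennreal_ofReal]
  refine (Finset.sum_le_sum fun t ht =>
    lintegral_alarm_le P Q hP hr0 (Finset.mem_range.1 ht)).trans ?_
  rw [← Finset.sum_filter, Finset.sum_const, Nat.card_multiples, nsmul_eq_mul,
    ENNReal.ofReal_mul (Nat.cast_nonneg _), ENNReal.ofReal_natCast]

theorem one_sub_inv_one_add_le {v : ℝ} (hv : 0 < v) : 1 - 1 / (1 + v) ≤ v := by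
  rw [one_sub_div (by positivity), add_sub_cancel_left]
  exact div_le_self hv.le (by linarith)

/-- The probability of raising no alarm during some consecutive blocks. -/
theorem prod_alarm_le_weight_div {y : ℕ → ℝ} (hy : ∀ i, 0 < y i) {L : ℕ} (hL : 0 < L) (M J : ℕ) :
    ∏ i ∈ Finset.range ((M + J) * L), (1 - alarm L y i) ≤
      weight y ((M + J) * L) / weight y (M * L) := by
  induction J with
  | zero =>
    rw [add_zero, div_self (weight_pos hy _).ne']
    exact prod_alarm_le_one hy L _
  | succ J ih =>
    have hle : (M + J) * L ≤ (M + (J + 1)) * L := Nat.mul_le_mul_right _ (by omega)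
    have h := (prod_alarm_block_le hy hL (M + J)).trans
      (one_sub_inv_one_add_le (Finset.prod_pos fun i _ => hy i))
    rw [add_assoc, ← weight_div_weight hy hle] at h
    rw [← Finset.prod_range_mul_prod_Ico _ hle]
    calc _ ≤ weight y ((M + J) * L) / weight y (M * L) *
          (weight y ((M + (J + 1)) * L) / weight y ((M + J) * L)) :=
          mul_le_mul ih h (prod_alarm_nonneg hy L _)
            (div_nonneg (weight_pos hy _).le (weight_pos hy _).le)
      _ = _ := by
          rw [mul_comm, div_mul_div_cancel₀ (weight_pos hy _).ne']

/-- The block starts after the change, and an alarm is missed with probability `V/(1+V) ≤ V`. -/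
theorem lintegral_one_sub_alarm_le
    (hQ : ∫⁻ u, ENNReal.ofReal (pointScore P Q a b l u) ∂Q ≤ ENNReal.ofReal r)
    (hr0 : 0 ≤ r) {κ L M : ℕ} (hL : 0 < L) (hM : κ ≤ M * L) :
    ∫⁻ x, ENNReal.ofReal (1 - alarm L (streamScore P Q a b l x) ((M + 1) * L - 1))
      ∂(Measure.infinitePi fun i => law P Q (κ + 1) i) ≤ ENNReal.ofReal (r ^ L) := by
  have hs : (M + 1) * L = M * L + L := by ring
  have h := lintegral_weight_after P Q hQ hr0 hM (show M * L ≤ (M + 1) * L by omega)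
  rw [show (M + 1) * L - M * L = L by omega] at h
  refine (lintegral_mono fun x => ENNReal.ofReal_le_ofReal ?_).trans h
  have hy := streamScore_pos P Q (a := a) (b := b) (l := l) x
  rw [weight_div_weight hy (by omega), alarm, Nat.sub_add_cancel (by omega),
    if_pos (Nat.mul_mod_left _ _), show (M + 1) * L - L = M * L by omega]
  exact one_sub_inv_one_add_le (Finset.prod_pos fun i _ => hy i)

theorem onlineProb_near_ge {n : ℕ} (hn : 4 ≤ n) {T : ℝ} (hT : T ≤ n)
    (hP : ∫⁻ u, ENNReal.ofReal (pointScore P Q a b l u)⁻¹ ∂P ≤ ENNReal.ofReal r)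
    (hQ : ∫⁻ u, ENNReal.ofReal (pointScore P Q a b l u) ∂Q ≤ ENNReal.ofReal r)
    (hr0 : 0 ≤ r) (hr1 : r ≤ 1) {A m : ℕ} (hm : 1 ≤ m * (1 - r)) (hmA : m ≤ A) {α β : ℝ}
    (hA : (A : ℝ) ≤ α) (hβ0 : 0 ≤ β) (κ : ℕ)
    (hβ : ((κ / blockLen n : ℕ) + 1) * r ^ blockLen n + 4 * r ^ (A - m) ≤ β) :
    ENNReal.ofReal (1 - β) ≤ onlineProb P Q onlineProg ((n : ℝ) :: onlineParams a b l T) (κ + 1)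
      {p | |(p.1 : ℝ) - (κ + 1 : ℕ)| ≤ α} := by
  set L := blockLen n with hL
  have hL0 : 0 < L := blockLen_pos n
  set y := streamScore P Q a b l with hy_def
  have hy (x : ℕ → X) : ∀ i, 0 < y x i := streamScore_pos P Q x
  have hys (i : ℕ) : Measurable fun x => y x i := measurable_streamScore P Q i
  set e₁ : (ℕ → X) → ENNReal := fun x =>
    ENNReal.ofReal (∑ t ∈ Finset.range κ, alarm L (y x) t)
  set e₂ : (ℕ → X) → ENNReal := fun x => ENNReal.ofReal (farMass (y x) κ A ((κ / L + 1) * L))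
  set e₃ : (ℕ → X) → ENNReal := fun x => ENNReal.ofReal (farMass (y x) κ A ((κ / L + 2) * L))
  set e₄ : (ℕ → X) → ENNReal := fun x =>
    ENNReal.ofReal (1 - alarm L (y x) ((κ / L + 2) * L - 1))
  have m₁ : Measurable e₁ :=
    (Finset.measurable_sum _ fun t _ => measurable_alarm P Q L t).ennreal_ofReal
  have m₂ : Measurable e₂ := (measurable_farMass hys _ _ _).ennreal_ofReal
  have m₃ : Measurable e₃ := (measurable_farMass hys _ _ _).ennreal_ofReal
  have m₄ : Measurable e₄ := (measurable_const.sub (measurable_alarm P Q L _)).ennreal_ofReal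
  have hκ : κ < (κ / L + 1) * L := by
    rw [mul_comm]
    exact Nat.lt_mul_div_succ κ hL0
  have hκ2 : (κ / L + 1) * L ≤ (κ / L + 2) * L := Nat.mul_le_mul_right _ (by omega)
  refine ofReal_one_sub_le_lintegral hβ0 (((m₁.add m₂).add m₃).add m₄) (fun x => ?_) ?_
  · have h0 := hy x
    have hf (N : ℕ) := farMass_nonneg h0 κ A N
    have ha : 0 ≤ ∑ t ∈ Finset.range κ, alarm L (y x) t :=
      Finset.sum_nonneg fun t _ => alarm_nonneg h0 L t
    have ha' (s : ℕ) : 0 ≤ 1 - alarm L (y x) s := sub_nonneg.2 (alarm_le_one h0 L s)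
    have hmain := one_le_alarmSum_add hn h0 (κ := κ) hA
    have hout := (outProb_onlineProg P Q hT x (a := a) (b := b) (l := l)
      {p | |(p.1 : ℝ) - (κ + 1 : ℕ)| ≤ α} ((κ / L + 2) * L)).1
    refine le_trans ?_ (add_le_add_left hout _)
    have he : (((e₁ + e₂) + e₃) + e₄) x = ENNReal.ofReal
        (∑ t ∈ Finset.range κ, alarm L (y x) t + farMass (y x) κ A ((κ / L + 1) * L) +
          farMass (y x) κ A ((κ / L + 2) * L) + (1 - alarm L (y x) ((κ / L + 2) * L - 1))) := by
      rw [ENNReal.ofReal_add (add_nonneg (add_nonneg ha (hf _)) (hf _)) (ha' _),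
        ENNReal.ofReal_add (add_nonneg ha (hf _)) (hf _), ENNReal.ofReal_add ha (hf _)]
      rfl
    rw [he]
    refine le_trans ?_ ENNReal.ofReal_add_le
    rw [← ENNReal.ofReal_one]
    exact ENNReal.ofReal_le_ofReal hmain
  · have i₁ := lintegral_sum_alarm_le P Q hP hr0 κ L
    have i₂ := lintegral_farMass_le P Q hP hQ hr0 hr1 (A := A) hκ hm hmA
    have i₃ := lintegral_farMass_le P Q hP hQ hr0 hr1 (A := A) (hκ.trans_le hκ2) hm hmA
    have i₄ := lintegral_one_sub_alarm_le P Q hQ hr0 hL0 hκ.le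
    calc _ = ∫⁻ x, (e₁ x + e₂ x + e₃ x + e₄ x) ∂(Measure.infinitePi fun i => law P Q (κ + 1) i) := rfl
      _ = ∫⁻ x, e₁ x ∂(Measure.infinitePi fun i => law P Q (κ + 1) i) +
          ∫⁻ x, e₂ x ∂(Measure.infinitePi fun i => law P Q (κ + 1) i) +
          ∫⁻ x, e₃ x ∂(Measure.infinitePi fun i => law P Q (κ + 1) i) +
          ∫⁻ x, e₄ x ∂(Measure.infinitePi fun i => law P Q (κ + 1) i) := by
          rw [lintegral_add_right _ m₄, lintegral_add_right _ m₃, lintegral_add_right _ m₂]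
      _ ≤ ENNReal.ofReal ((κ / L : ℕ) * r ^ L) + ENNReal.ofReal (2 * r ^ (A - m)) +
          ENNReal.ofReal (2 * r ^ (A - m)) + ENNReal.ofReal (r ^ L) :=
          add_le_add (add_le_add (add_le_add i₁ i₂) i₃) i₄
      _ ≤ ENNReal.ofReal β := by
          rw [← ENNReal.ofReal_add (by positivity) (by positivity),
            ← ENNReal.ofReal_add (by positivity) (by positivity),
            ← ENNReal.ofReal_add (by positivity) (by positivity)]
          exact ENNReal.ofReal_le_ofReal (by linarith)

/-- Missing the alarm in `J` consecutive blocks from Q has probability at most the product of all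
their scores, of mean at most `r ^ (J * L)` for blocks of length `L`. An earlier alarm only helps.
-/
theorem onlineProb_pos_le_ge {n : ℕ} {T : ℝ} (hT : T ≤ n)
    (hQ : ∫⁻ u, ENNReal.ofReal (pointScore P Q a b l u) ∂Q ≤ ENNReal.ofReal r)
    (hr0 : 0 ≤ r) (κ J : ℕ) {η B : ℝ} (hη0 : 0 ≤ η) (hη : r ^ (J * blockLen n) ≤ η)
    (hB : ((κ / blockLen n + 1 + J) * blockLen n : ℕ) ≤ B) :
    ENNReal.ofReal (1 - η) ≤ onlineProb P Q onlineProg ((n : ℝ) :: onlineParams a b l T) (κ + 1)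
      {p | (p.2 : ℝ) ≤ B} := by
  set L := blockLen n with hL
  have hL0 : 0 < L := blockLen_pos n
  set M := κ / L + 1
  have hκ : κ ≤ M * L := by
    rw [mul_comm]
    exact (Nat.lt_mul_div_succ κ hL0).le
  have hMJ : M * L ≤ (M + J) * L := Nat.mul_le_mul_right _ (by omega)
  have hys (i : ℕ) : Measurable fun x => streamScore P Q a b l x i := measurable_streamScore P Q i
  refine ofReal_one_sub_le_lintegral (e := fun x => ENNReal.ofReal
    (weight (streamScore P Q a b l x) ((M + J) * L) / weight (streamScore P Q a b l x) (M * L)))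
    hη0 ((measurable_weight hys _).div (measurable_weight hys _)).ennreal_ofReal (fun x => ?_) ?_
  · have hy := streamScore_pos P Q (a := a) (b := b) (l := l) x
    have hout := (outProb_onlineProg P Q hT x (a := a) (b := b) (l := l)
      {p | (p.2 : ℝ) ≤ B} ((M + J) * L)).1
    refine le_trans ?_ (add_le_add_left hout _)
    refine le_trans ?_ ENNReal.ofReal_add_le
    rw [← ENNReal.ofReal_one]
    refine ENNReal.ofReal_le_ofReal ?_
    have h1 := prod_alarm_le_weight_div hy hL0 M J
    have h2 := alarmSum_eq_of_forall hy (n := n) (S := {p : ℕ × ℕ | (p.2 : ℝ) ≤ B})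
      (h := (M + J) * L) fun t ht k => le_trans (by exact_mod_cast ht) hB
    change _ ≤ alarmSum n (streamScore P Q a b l x) _ _ 0 0 + _
    rw [h2]
    linarith
  · refine (lintegral_weight_after P Q hQ hr0 hκ hMJ).trans (ENNReal.ofReal_le_ofReal ?_)
    rwa [← Nat.sub_mul, Nat.add_sub_cancel_left]

end Guarantees

end
end ChangePoint

namespace ChangePoint
noncomputable section

set_option linter.unusedSectionVars false

/-! ### The choice of the constants -/

section Constants

variable {ℓ g α : ℝ}

theorem one_sub_pow_le {g : ℝ} (hg1 : g ≤ 1) (s : ℕ) : (1 - g) ^ s ≤ Real.exp (-(g * s)) := by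
  have h := pow_le_pow_left₀ (sub_nonneg.2 hg1) (Real.one_sub_le_exp_neg g) s
  rwa [← Real.exp_nat_mul, mul_comm, neg_mul] at h

theorem exp_neg_three_le : Real.exp (-3) ≤ 1 / 16 := by
  have h1 := Real.exp_one_gt_d9
  have h2 : Real.exp (-3) * (Real.exp 1 ^ 3) = 1 := by
    rw [← Real.exp_nat_mul, ← Real.exp_add]
    norm_num
  have h3 : (16 : ℝ) ≤ Real.exp 1 ^ 3 :=
    (by norm_num : (16 : ℝ) ≤ 2.7182818283 ^ 3).trans
      (pow_le_pow_left₀ (by norm_num) h1.le 3)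
  have h4 := Real.exp_pos (-3)
  nlinarith

/-- The number of windows and the accuracy that are used in the analysis. -/
theorem exists_window (hg0 : 0 < g) (hg1 : g ≤ 1 / 8) (hℓ : 0 ≤ ℓ) (hα : 8 * ℓ + 24 ≤ g * α) :
    ∃ A m : ℕ, (A : ℝ) ≤ α ∧ m ≤ A ∧ 1 ≤ m * (1 - (1 - g)) ∧
      (1 - g) ^ (A - m) ≤ Real.exp (-ℓ) / 16 := by
  have hα0 : 0 ≤ α := by
    by_contra h
    nlinarith
  have h1 : α < ⌊α⌋₊ + 1 := Nat.lt_floor_add_one α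
  have h2 : (⌈g⁻¹⌉₊ : ℝ) < g⁻¹ + 1 := Nat.ceil_lt_add_one (by positivity)
  have h3 : g * g⁻¹ = 1 := mul_inv_cancel₀ hg0.ne'
  have h4 : ⌈g⁻¹⌉₊ ≤ ⌊α⌋₊ := by
    have : (⌈g⁻¹⌉₊ : ℝ) ≤ ⌊α⌋₊ := by
      refine le_of_mul_le_mul_left ?_ hg0
      nlinarith
    exact_mod_cast this
  -- A window of `1/g` candidates makes the geometric sums cancel. Rounding costs little, so `g * (A
  -- - m) ≥ ℓ + 3`, and `e^(-3) ≤ 1/16`.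
  refine ⟨⌊α⌋₊, ⌈g⁻¹⌉₊, Nat.floor_le hα0, h4, ?_, ?_⟩
  · have := Nat.le_ceil g⁻¹
    rw [sub_sub_cancel]
    nlinarith
  · refine (one_sub_pow_le (by linarith) _).trans ?_
    rw [Nat.cast_sub h4, div_eq_mul_one_div]
    refine le_trans ?_ (mul_le_mul_of_nonneg_left exp_neg_three_le (Real.exp_pos _).le)
    rw [← Real.exp_add]
    refine Real.exp_le_exp.2 ?_
    nlinarith

theorem blockLen_bounds {n : ℕ} (hn : 4 ≤ n) : (n : ℝ) / 4 ≤ blockLen n ∧ (blockLen n : ℝ) ≤ n / 2 := by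
  unfold blockLen
  have h1 : n ≤ 4 * (n / 4 + 1) := by omega
  have h2 : 2 * (n / 4 + 1) ≤ n := by omega
  have h1' : (n : ℝ) ≤ 4 * ((n / 4 + 1 : ℕ) : ℝ) := by exact_mod_cast h1
  have h2' : 2 * ((n / 4 + 1 : ℕ) : ℝ) ≤ n := by exact_mod_cast h2
  constructor <;> linarith

/-- The bound for the failure probability of the online algorithm. -/
theorem online_error_le (hg0 : 0 < g) (hg1 : g ≤ 1 / 8) (hℓ : 0 ≤ ℓ) {n κ : ℕ} (hn : 4 ≤ n)
    (hgn : 8 * ℓ + 24 ≤ g * n)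
    (hκ : ((κ + 1 : ℕ) : ℝ) ≤ n * Real.exp (-ℓ) * Real.exp (g * n / 8)) :
    ((κ / blockLen n : ℕ) + 1) * (1 - g) ^ blockLen n ≤ Real.exp (-ℓ) / 2 := by
  obtain ⟨hL, -⟩ := blockLen_bounds hn
  have hn0 : (0 : ℝ) < n := by
    have : 0 < n := by omega
    exact_mod_cast this
  have hL0 : (0 : ℝ) < blockLen n := by linarith
  have h1 : ((κ / blockLen n : ℕ) : ℝ) ≤ 4 * Real.exp (-ℓ) * Real.exp (g * n / 8) := by
    refine Nat.cast_div_le.trans ?_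
    rw [div_le_iff₀ hL0]
    have hκ' : (κ : ℝ) ≤ n * Real.exp (-ℓ) * Real.exp (g * n / 8) :=
      le_trans (by push_cast; linarith) hκ
    have h2 : 0 < Real.exp (-ℓ) * Real.exp (g * n / 8) := by positivity
    nlinarith
  have h2 : (1 - g) ^ blockLen n ≤ Real.exp (-(g * n / 4)) :=
    (one_sub_pow_le (by linarith) _).trans (Real.exp_le_exp.2 (by nlinarith))
  -- Blocks of length at least `n / 4` beat the allowed exponential growth of `κ`, and `g * n ≥ 24`
  -- leaves an exponent of at most `-3`.
  have h3 : Real.exp (-(g * n / 4)) * Real.exp (g * n / 8) ≤ 1 / 16 := by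
    rw [← Real.exp_add]
    exact (Real.exp_le_exp.2 (by linarith)).trans exp_neg_three_le
  have h4 : Real.exp (-(g * n / 4)) ≤ Real.exp (-ℓ) * (1 / 16) := by
    refine le_trans ?_ (mul_le_mul_of_nonneg_left exp_neg_three_le (Real.exp_pos _).le)
    rw [← Real.exp_add]
    exact Real.exp_le_exp.2 (by linarith)
  have h5 := Real.exp_pos (-ℓ)
  have h6 : 0 ≤ ((κ / blockLen n : ℕ) : ℝ) + 1 := by positivity
  calc _ ≤ (4 * Real.exp (-ℓ) * Real.exp (g * n / 8) + 1) * Real.exp (-(g * n / 4)) := by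
        gcongr
        exact pow_nonneg (by linarith) _
    _ = 4 * Real.exp (-ℓ) * (Real.exp (-(g * n / 4)) * Real.exp (g * n / 8)) +
        Real.exp (-(g * n / 4)) := by ring
    _ ≤ 4 * Real.exp (-ℓ) * (1 / 16) + Real.exp (-ℓ) * (1 / 16) := by gcongr
    _ ≤ _ := by linarith

/-- The bound for the number of points that the online algorithm observes. -/
theorem online_late_le (hg0 : 0 < g) (hg1 : g ≤ 1 / 8) {n : ℕ} (hn : 4 ≤ n) (hgn : 24 ≤ g * n)
    (κ d : ℕ) : ∃ J : ℕ, (1 - g) ^ (J * blockLen n) ≤ 1 / (n : ℝ) ^ d ∧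
      ((κ / blockLen n + 1 + J) * blockLen n : ℕ) ≤
        ((κ + 1 : ℕ) : ℝ) + (d + 1 : ℕ) * (n * Real.log n) := by
  obtain ⟨hL, hL'⟩ := blockLen_bounds hn
  have hn4 : (4 : ℝ) ≤ n := by exact_mod_cast hn
  have hlog : 1 ≤ Real.log n := by
    rw [Real.le_log_iff_exp_le (by linarith)]
    linarith [Real.exp_one_lt_d9]
  -- A block is missed with probability at most `e^(-1)`, since `g * blockLen n ≥ 1`; hence `d * log
  -- n` blocks suffice for `n ^ (-d)`.
  refine ⟨⌈d * Real.log n⌉₊, ?_, ?_⟩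
  · refine (one_sub_pow_le (by linarith) _).trans ?_
    have h1 : d * Real.log n ≤ ⌈d * Real.log n⌉₊ := Nat.le_ceil _
    have h2 : 1 ≤ g * blockLen n := by nlinarith
    have h3 : 1 / (n : ℝ) ^ d = Real.exp (-(d * Real.log n)) := by
      rw [Real.exp_neg, Real.exp_nat_mul, Real.exp_log (by linarith), one_div]
    rw [h3, Real.exp_le_exp, neg_le_neg_iff]
    push_cast
    have h4 : (0 : ℝ) ≤ ⌈d * Real.log n⌉₊ := by positivity
    nlinarith
  · have h1 : (⌈d * Real.log n⌉₊ : ℝ) < d * Real.log n + 1 :=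
      Nat.ceil_lt_add_one (by positivity)
    have h2 : ((κ / blockLen n : ℕ) : ℝ) * blockLen n ≤ κ := by
      exact_mod_cast Nat.div_mul_le_self κ (blockLen n)
    have h3 : (0 : ℝ) ≤ d * Real.log n := by positivity
    push_cast
    have hL0 : (0 : ℝ) ≤ blockLen n := by positivity
    have h4 : (⌈d * Real.log n⌉₊ : ℝ) * blockLen n ≤ (d * Real.log n + 1) * (n / 2) := by gcongr
    have h5 : (d * Real.log n) * (n / 2) ≤ d * Real.log n * n := by
      refine mul_le_mul_of_nonneg_left (by linarith) h3
    have h6 : (n : ℝ) * 1 ≤ n * Real.log n := by gcongr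
    nlinarith

end Constants

end
end ChangePoint

/-! ### Choice of the constants and proof of the theorem -/

theorem mainTheorem2 :
    ∃ (offline online : ChangePoint.Prog) (T : ℕ), ∀ β₀ : ℝ, 0 < β₀ → β₀ < 1 →
      ∃ (C C₀ : ℝ) (D : ℕ → ℝ), 0 < C ∧ 0 < C₀ ∧
        ∀ (X : Type*) [MeasurableSpace X] (P Q : MeasureTheory.Measure X)
          [MeasureTheory.IsProbabilityMeasure P] [MeasureTheory.IsProbabilityMeasure Q]
          (ε β α : ℝ), P ≠ Q → 0 < ε → 0 < β → β ≤ β₀ →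
          α = C * (1 / (min ε 1 * ChangePoint.tau P Q ε + ChangePoint.hellingerSqClamped P Q ε)
                * Real.log (1 / β)) →
          (∃ θ : List ℝ,
            ChangePoint.OfflineEfficient P Q offline θ T ∧
            ChangePoint.OfflinePrivate P Q offline θ ε ∧
            ChangePoint.OfflineAccurate P Q offline θ α β) ∧
          (∃ θ : List ℝ, ∀ n : ℕ, 1 ≤ n →
            ChangePoint.OnlineEfficient P Q online ((n : ℝ) :: θ) T ∧
            ChangePoint.OnlinePrivate P Q online ((n : ℝ) :: θ) ε ∧
            ∀ k : ℕ, 1 ≤ k →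
              C₀ * (ChangePoint.sampleComplexity P Q ε * Real.log (k / (n * β))) ≤ n →
              ENNReal.ofReal (1 - β) ≤
                ChangePoint.onlineProb P Q online ((n : ℝ) :: θ) k {r | |(r.1 : ℝ) - k| ≤ α} ∧
              (∀ x : ℕ → X,
                ChangePoint.outProb online ((n : ℝ) :: θ) (ChangePoint.onlineData P Q x)
                  {r | |(r.1 : ℝ) - k| ≤ α ∧ k + 2 * n < r.2} = 0) ∧
              ∀ d : ℕ,
                ENNReal.ofReal (1 - 1 / (n : ℝ) ^ d) ≤
                  ChangePoint.onlineProb P Q online ((n : ℝ) :: θ) k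
                    {r | (r.2 : ℝ) ≤ k + D d * (n * Real.log n)}) := by
  open ChangePoint in
  refine ⟨offlineProg, onlineProg, 100, fun β₀ hβ₀ hβ₀1 => ?_⟩
  have hℓ₀ : 0 < Real.log (1 / β₀) := Real.log_pos (by rw [one_lt_div hβ₀]; exact hβ₀1)
  -- The factor 16 cancels that in `g = rate / 16`. The term with `β₀` turns the additive constant
  -- 24 into a multiple of `log (1/β)`.
  set C : ℝ := 16 * (8 + 24 / Real.log (1 / β₀)) with hC
  have hC0 : 0 < C := by positivity
  -- The sample complexity is at least `1 / (8 * rate)`. The summand `8 * C` serves the case `n <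
  -- α`; 1024 serves `n ≥ α`, as `8 * rate * n = 1024 * (g * n / 8)`.
  refine ⟨C, 8 * C + 1024, fun d => (d + 1 : ℕ), hC0, by positivity, ?_⟩
  intro X _ P Q _ _ ε β α hPQ hε hβ hββ₀ hα
  have hγ : 0 < rate P Q ε := rate_pos P Q hε hPQ
  have hγ2 : rate P Q ε ≤ 2 := rate_le_two P Q hε.le
  have hSC := le_sampleComplexity_mul_rate P Q hε hPQ
  change α = C * (1 / rate P Q ε * Real.log (1 / β)) at hα
  obtain ⟨⟨ha, haε⟩, -⟩ := clampLevel_spec P Q hε.le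
  obtain ⟨⟨hb, hbε⟩, -⟩ := clampLevel_spec Q P hε.le
  obtain ⟨l, hP, hQ⟩ := exists_shift P Q hε.le
  set g := rate P Q ε / 16 with hg
  have hg0 : 0 < g := by positivity
  have hg1 : g ≤ 1 / 8 := by linarith
  set ℓ := Real.log (1 / β) with hℓ
  have hℓℓ : Real.log (1 / β₀) ≤ ℓ :=
    Real.log_le_log (by positivity) (one_div_le_one_div_of_le hβ hββ₀)
  have hℓ0 : 0 < ℓ := hℓ₀.trans_le hℓℓ
  have hβℓ : Real.exp (-ℓ) = β := by
    rw [hℓ, one_div, Real.log_inv, neg_neg, Real.exp_log hβ]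
  have hγα : rate P Q ε * α = C * ℓ := by
    rw [hα]
    field_simp
  have hgα : 8 * ℓ + 24 ≤ g * α := by
    have h1 : g * α = 8 * ℓ + 24 / Real.log (1 / β₀) * ℓ := by
      rw [hg, div_mul_eq_mul_div, hγα, hC]
      ring
    have h2 : 24 ≤ 24 / Real.log (1 / β₀) * ℓ := by
      rw [div_mul_eq_mul_div, le_div_iff₀ hℓ₀]
      linarith
    linarith
  obtain ⟨A, m, hA, hmA, hm, hpow⟩ := exists_window hg0 hg1 hℓ0.le hgα
  rw [hβℓ] at hpow
  have hα192 : 192 ≤ α := by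
    by_contra h
    nlinarith
  have hr0 : 0 ≤ 1 - g := by linarith
  have hr1 : 1 - g ≤ 1 := by linarith
  refine ⟨⟨0 :: params (clampLevel P Q ε) (clampLevel Q P ε) l,
    offlineEfficient_offlineProg P Q _, offlinePrivate_offlineProg P Q ha hb haε hbε,
    offlineAccurate_offlineProg P Q hP hQ hr0 hr1 hm hmA hA hβ.le (by linarith)⟩,
    onlineParams (clampLevel P Q ε) (clampLevel Q P ε) l α, fun n hn =>
    ⟨onlineEfficient_onlineProg P Q ha hb, onlinePrivate_onlineProg P Q ha hb haε hbε,
    fun k hk hcond => ⟨?_, fun x => outProb_onlineProg_late P Q ha hb x le_rfl k, fun d => ?_⟩⟩⟩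
  · have hn0 : (0 : ℝ) < n := by exact_mod_cast hn
    have hk0 : (0 : ℝ) < k := by exact_mod_cast hk
    have hlog : (8 * C + 1024) * Real.log (k / (n * β)) ≤ 8 * rate P Q ε * n := by
      rcases le_or_gt (Real.log (k / (n * β))) 0 with h | h
      · have : 0 ≤ 8 * rate P Q ε * n := by positivity
        nlinarith
      · have h1 : 1 / 8 * ((8 * C + 1024) * Real.log (k / (n * β))) ≤
            sampleComplexity P Q ε * rate P Q ε * ((8 * C + 1024) * Real.log (k / (n * β))) :=
          mul_le_mul_of_nonneg_right hSC (by positivity)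
        have h2 := mul_le_mul_of_nonneg_left hcond hγ.le
        linarith
    have hkexp : k / (n * β) = Real.exp (Real.log (k / (n * β))) :=
      (Real.exp_log (by positivity)).symm
    have hkn {c : ℝ} (hc : Real.log (k / (n * β)) ≤ c) : (k : ℝ) ≤ n * β * Real.exp c := by
      rw [← div_le_iff₀' (by positivity), hkexp]
      exact Real.exp_le_exp.2 hc
    -- For `n < α` the program answers `0` at once, which is accurate: the condition on `n` gives
    -- `log (k / (n * β)) ≤ log (1/β)`, that is `k ≤ n < α`.
    rcases lt_or_ge (n : ℝ) α with hnα | hnα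
    · have h1 : Real.log (k / (n * β)) ≤ ℓ := by
        by_contra h
        rw [not_le] at h
        have h2 : rate P Q ε * n ≤ rate P Q ε * α := mul_le_mul_of_nonneg_left hnα.le hγ.le
        nlinarith
      have h2 := hkn h1
      rw [mul_assoc, ← hβℓ, ← Real.exp_add, neg_add_cancel, Real.exp_zero, mul_one] at h2
      have h3 : ((0 : ℕ), (0 : ℕ)) ∈ {r : ℕ × ℕ | |(r.1 : ℝ) - k| ≤ α} := by
        simp only [Set.mem_ofPred_eq, Nat.cast_zero, zero_sub, abs_neg, Nat.abs_cast]
        linarith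
      have h4 : ind {r : ℕ × ℕ | |(r.1 : ℝ) - k| ≤ α} (0, 0) = 1 := if_pos h3
      simp_rw [onlineProb, outProb_onlineProg_of_lt P Q hnα, h4]
      simp [hβ.le]
    · have hn4 : 4 ≤ n := by
        have : (4 : ℝ) ≤ n := by linarith
        exact_mod_cast this
      obtain ⟨κ, rfl⟩ : ∃ κ, k = κ + 1 := ⟨k - 1, by omega⟩
      have hgn : 8 * ℓ + 24 ≤ g * n := hgα.trans (mul_le_mul_of_nonneg_left hnα hg0.le)
      -- This allows `k` to be exponentially large in `g * n`, with half the exponent by which `r ^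
      -- blockLen n` is bounded.
      have h1 : Real.log ((κ + 1 : ℕ) / (n * β)) ≤ g * n / 8 := by
        by_contra h
        rw [not_le] at h
        have : 0 < g * n / 8 := by positivity
        nlinarith
      have h2 := hkn h1
      rw [← hβℓ] at h2
      have h3 := online_error_le hg0 hg1 hℓ0.le hn4 hgn h2
      rw [hβℓ] at h3
      exact onlineProb_near_ge P Q hn4 hnα hP hQ hr0 hr1 hm hmA hA hβ.le κ (by linarith)
  · rcases lt_or_ge (n : ℝ) α with hnα | hnα
    · have h3 : ((0 : ℕ), (0 : ℕ)) ∈ {r : ℕ × ℕ | (r.2 : ℝ) ≤ k + (d + 1 : ℕ) * (n * Real.log n)} := by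
        simp only [Set.mem_ofPred_eq, Nat.cast_zero]
        positivity
      have h4 : ind {r : ℕ × ℕ | (r.2 : ℝ) ≤ k + (d + 1 : ℕ) * (n * Real.log n)} (0, 0) = 1 :=
        if_pos h3
      simp_rw [onlineProb, outProb_onlineProg_of_lt P Q hnα, h4]
      simp
    · have hn4 : 4 ≤ n := by
        have : (4 : ℝ) ≤ n := by linarith
        exact_mod_cast this
      obtain ⟨κ, rfl⟩ : ∃ κ, k = κ + 1 := ⟨k - 1, by omega⟩
      have hgn : 8 * ℓ + 24 ≤ g * n := hgα.trans (mul_le_mul_of_nonneg_left hnα hg0.le)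
      obtain ⟨J, hJ1, hJ2⟩ := online_late_le hg0 hg1 hn4 (by linarith) κ d
      exact onlineProb_pos_le_ge P Q hnα hQ hr0 κ J (by positivity) hJ1 hJ2
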